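/- Theorem 3.5. Let $M$ be a compact connected orientable $3$-manifold whose boundary is a disjoint union of tori $T^2_1,\dots,T^2_m$, with a meridian-longitude pair $(q_j,h_j)$, i.e. $\pi_1(T^2_j)=\langle q_j,h_j\mid [q_j,h_j]=1\rangle$. Let $\widehat M=M\big(\tfrac{\alpha_1}{\beta_1},\dots,\tfrac{\alpha_m}{\beta_m}\big)=M\cup S_1\cup\dots\cup S_m$ be the closed $3$-manifold obtained by gluing solid tori $S_j=D^2\times S^1$ to $M$ along the $T^2_j$ so that $\partial D^2\times\{*\}$ is glued to a curve representing $q_j^{\alpha_j}h_j^{\beta_j}$, and let $\ell_j$ be the homotopy class of the core $\{0\}\times S^1\subset S_j$. Let $\rho:\pi_1(M)\to \mathrm{SL}(2,\mathbb C)$ be a homomorphism with $\rho(q_j^{\alpha_j}h_j^{\beta_j})=I$ for all $j$, and denote the induced homomorphism of $\pi_1(\widehat M)$ (the one whose composition with $\pi_1(M)\to\pi_1(\widehat M)$ is $\rho$) also by $\rho$. Assume that for every $j$ (i) $\rho(q_j)$ or $\rho(h_j)$ has finite even order, and (ii) $\rho(\ell_j)$ has finite even order $2\lambda_j$. For $n\ge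 1$ let $V_n$ be the space of homogeneous complex polynomials $p(z_1,z_2)$ of degree $n-1$, on which $A\in\mathrm{SL}(2,\mathbb C)$ acts by $\sigma_n(A)p(z)=p(A^{-1}z)$, and put $\rho_n=\sigma_n\circ\rho$. For a finite complex $W$ with a representation $\rho_n$ of $\pi_1(W)$, put $C_*(W;V_n)=V_n\otimes_{\mathbb Z[\pi_1(W)]}C_*(\widetilde W;\mathbb Z)$, where $\widetilde W$ is the universal cover and $v\otimes\gamma c=\rho_n(\gamma)^{-1}v\otimes c$; $\rho_n$ is acyclic on $W$ if this complex is exact. In that case $$\mathrm{Tor}(W;\rho_n)=\prod_{i\ge 0}\big[\partial_{i+1}(\tilde b_{i+1})\cup\tilde b_i\,/\,c_i\big]^{(-1)^{i+1}},$$ where $c_i$ is the basis of $C_i(W;V_n)$ formed by the $v_k\otimes\tilde e$ with $(v_k)$ a basis of $V_n$ and $\tilde e$ one lift of each $i$-cell, $\tilde b_i\subset C_i(W;V_n)$ is a family mapped by $\partial_i$ to a basis of $\partial_i(C_i(W;V_n))$, and $[b/c]$ is the determinant of the base change matrix; only $|\mathrm{Tor}|$ is used. The torsions of $\widehat M$ and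 $M$ are computed from a triangulation of $\widehat M$ in which $M$ and the $S_j$ are subcomplexes. Suppose that $\rho_{2N}$ is acyclic on $M$ for every $N\ge 1$. Then $\rho_{2N}$ is acyclic on $\widehat M$ for every $N\ge 1$, and $$\lim_{N\to\infty}\frac{\log|\mathrm{Tor}(\widehat M;\rho_{2N})|}{(2N)^2}=\lim_{N\to\infty}\frac{\log|\mathrm{Tor}(M;\rho_{2N})|}{(2N)^2},$$ $$\lim_{N\to\infty}\frac{\log|\mathrm{Tor}(\widehat M;\rho_{2N})|}{2N}=\lim_{N\to\infty}\frac{\log|\mathrm{Tor}(M;\rho_{2N})|}{2N}-\log 2\sum_{j=1}^m\frac1{\lambda_j},$$ where in each equation one limit exists in $[-\infty,\infty]$ if and only if the other one does. -/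

import Mathlib

open Filter Topology

noncomputable section

namespace SurgeryTorsion

/-! ### Torsion of based chain complexes -/

section Algebra

variable {C : ℕ → Type*} [∀ i, AddCommGroup (C i)] [∀ i, Module ℂ (C i)]

/-- The complex `⋯ → C 2 → C 1 → C 0 → 0` with boundary maps `d i : C (i + 1) → C i` has vanishing
homology in every degree. -/
def Acyclic (d : ∀ i, C (i + 1) →ₗ[ℂ] C i) : Prop :=
  Function.Surjective (d 0) ∧ ∀ i, LinearMap.range (d (i + 1)) = LinearMap.ker (d i)

/-- `τ` is a value of the torsion `∏_{i < n} [∂ b̃_{i+1} ∪ b̃_i / c_i] ^ ((-1)^(i+1))` of the complex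
`(C, d)` (with `C i = 0` for `n ≤ i`), where `c i` is the given basis of `C i`, and `b i = b̃_i` is a
finite family in `C i` which `∂` maps to a basis of the image `B_i = ∂ (C i)`
(so `b̃_0` is empty). The bijections `e i` fix the order in which the vectors of
`∂ b̃_{i+1} ∪ b̃_i` are listed; they influence `τ` only through its sign. -/
def IsTorsion {κ : ℕ → Type*} [∀ i, Fintype (κ i)] [∀ i, DecidableEq (κ i)]
    (d : ∀ i, C (i + 1) →ₗ[ℂ] C i) (c : ∀ i, Module.Basis (κ i) ℂ (C i)) (n : ℕ) (τ : ℂ) : Prop :=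
  ∃ (r : ℕ → ℕ) (b : ∀ i, Fin (r i) → C i) (e : ∀ i, κ i ≃ Fin (r (i + 1)) ⊕ Fin (r i)),
    r 0 = 0 ∧
    (∀ i, LinearIndependent ℂ (fun k => d i (b (i + 1) k)) ∧
      Submodule.span ℂ (Set.range fun k => d i (b (i + 1) k)) = LinearMap.range (d i)) ∧
    τ = ∏ i ∈ Finset.range n,
      ((c i).det (fun k => Sum.elim (fun l => d i (b (i + 1) l)) (b i) (e i k))) ^
        ((-1 : ℤ) ^ (i + 1))

open Classical in
/-- The torsion of an acyclic based complex; it is well defined up to sign. -/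
def torsion {κ : ℕ → Type*} [∀ i, Fintype (κ i)] [∀ i, DecidableEq (κ i)]
    (d : ∀ i, C (i + 1) →ₗ[ℂ] C i) (c : ∀ i, Module.Basis (κ i) ℂ (C i)) (n : ℕ) : ℂ :=
  if h : ∃ τ, IsTorsion d c n τ then h.choose else 0

end Algebra

/-! ### The irreducible representations of `SL(2, ℂ)` -/

abbrev SL2 : Type := Matrix.SpecialLinearGroup (Fin 2) ℂ

/-- The space `V_n` of homogeneous polynomials of degree `n - 1` in two variables (`n ≥ 1`). -/
abbrev V (n : ℕ) : Submodule ℂ (MvPolynomial (Fin 2) ℂ) :=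
  MvPolynomial.homogeneousSubmodule (Fin 2) ℂ (n - 1)

instance (n : ℕ) : Module.Finite ℂ (V n) :=
  Module.Finite.iff_fg.mpr (MvPolynomial.homogeneousSubmodule_fg (σ := Fin 2) (R := ℂ) (n - 1))

/-- Substitution of the linear forms `(A⁻¹ z)_i` for the variables `z_i`, that is
`p(z) ↦ p(A⁻¹ z)`. -/
def substInv (A : SL2) : MvPolynomial (Fin 2) ℂ →ₐ[ℂ] MvPolynomial (Fin 2) ℂ :=
  MvPolynomial.aeval fun i =>
    ∑ j, MvPolynomial.C ((A⁻¹ : SL2).1 i j) * (MvPolynomial.X j : MvPolynomial (Fin 2) ℂ)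

theorem substInv_mem (A : SL2) (n : ℕ) (p : MvPolynomial (Fin 2) ℂ) (hp : p ∈ V n) :
    substInv A p ∈ V n := by
  rw [MvPolynomial.mem_homogeneousSubmodule] at hp ⊢
  have h := hp.aeval
    (fun i => ∑ j, MvPolynomial.C ((A⁻¹ : SL2).1 i j) * (MvPolynomial.X j : MvPolynomial (Fin 2) ℂ))
    (n := 1) (fun i => MvPolynomial.IsHomogeneous.sum _ _ _ fun j _ => by
      simpa using (MvPolynomial.isHomogeneous_C (Fin 2) ((A⁻¹ : SL2).1 i j)).mul
        (MvPolynomial.isHomogeneous_X ℂ j))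
  simpa [substInv] using h

theorem substInv_one : substInv 1 = AlgHom.id ℂ _ := by
  refine MvPolynomial.algHom_ext fun i => ?_
  simp [substInv, Matrix.one_apply]

theorem substInv_mul (A B : SL2) : substInv (A * B) = (substInv A).comp (substInv B) := by
  refine MvPolynomial.algHom_ext fun i => ?_
  simp only [substInv, MvPolynomial.aeval_X, AlgHom.comp_apply, map_sum, map_mul,
    MvPolynomial.algHom_C, mul_inv_rev, Matrix.SpecialLinearGroup.coe_mul, Matrix.mul_apply,
    MvPolynomial.algebraMap_eq, Finset.mul_sum, Finset.sum_mul]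
  rw [Finset.sum_comm]
  simp only [mul_assoc]

/-- The `n`-dimensional irreducible representation `σ_n` of `SL(2, ℂ)` on `V_n`,
`(σ_n(A) p)(z) = p(A⁻¹ z)`. -/
def sigma (n : ℕ) : Representation ℂ SL2 (V n) where
  toFun A := (substInv A).toLinearMap.restrict (substInv_mem A n)
  map_one' := by
    ext p : 2
    simp [substInv_one]
  map_mul' A B := by
    refine LinearMap.ext fun p => Subtype.ext ?_
    change substInv (A * B) p.1 = substInv A (substInv B p.1)
    rw [substInv_mul, AlgHom.comp_apply]

/-! ### Geometric realizations -/

section Realization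

variable {ι : Type*}

theorem mem_faces_of_subset {K : PreAbstractSimplicialComplex ι} {s t : Finset ι}
    (hs : s ∈ K.faces) (h : t ⊆ s) (ht : t.Nonempty) : t ∈ K.faces :=
  (K.isRelLowerSet_faces hs).2 h ht

theorem vertex_mem {K : PreAbstractSimplicialComplex ι} {s : Finset ι} {a : ι}
    (hs : s ∈ K.faces) (ha : a ∈ s) : {a} ∈ K.faces :=
  mem_faces_of_subset hs (by simpa using ha) (Finset.singleton_nonempty a)

variable [Fintype ι]

/-- The geometric realization `|K|` of a finite simplicial complex, in barycentric coordinates. -/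
def realization (K : PreAbstractSimplicialComplex ι) : Set (ι → ℝ) :=
  {x | x ∈ stdSimplex ℝ ι ∧ Finset.univ.filter (fun v => x v ≠ 0) ∈ K.faces}

theorem realization_mono {K L : PreAbstractSimplicialComplex ι} (h : K ≤ L) :
    realization K ⊆ realization L := fun _ hx => ⟨hx.1, h hx.2⟩

/-- The inclusion `|K| → |L|` of a subcomplex. -/
def incl {K L : PreAbstractSimplicialComplex ι} (h : K ≤ L) : C(realization K, realization L) :=
  ⟨Set.inclusion (realization_mono h), continuous_inclusion (realization_mono h)⟩

theorem mem_realization_of_support {K : PreAbstractSimplicialComplex ι} {x : ι → ℝ} {s : Finset ι}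
    (hx : x ∈ stdSimplex ℝ ι) (hs : s ∈ K.faces) (h : ∀ v, v ∉ s → x v = 0) :
    x ∈ realization K := by
  refine ⟨hx, mem_faces_of_subset hs (fun v hv => ?_) ?_⟩
  · by_contra hvs
    exact (Finset.mem_filter.mp hv).2 (h v hvs)
  · by_contra hne
    rw [Finset.not_nonempty_iff_eq_empty, Finset.filter_eq_empty_iff] at hne
    have h1 : ∑ v, x v = 0 := Finset.sum_eq_zero fun v hv => by simpa using hne hv
    rw [hx.2] at h1
    exact one_ne_zero h1

variable [LinearOrder ι]

/-- A vertex of `K`, as a point of `|K|`. -/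
def vertexPt (K : PreAbstractSimplicialComplex ι) (v : ι) (hv : {v} ∈ K.faces) : realization K :=
  ⟨Pi.single v 1, mem_realization_of_support (single_mem_stdSimplex ℝ v) hv fun w hw =>
    Pi.single_eq_of_ne (by simpa using hw) 1⟩

/-- The straight path in `|K|` between two vertices `a`, `b` of a simplex `s` (constant if
`a = b`). -/
def edgePath {K : PreAbstractSimplicialComplex ι} {s : Finset ι} (hs : s ∈ K.faces) {a b : ι}
    (ha : a ∈ s) (hb : b ∈ s) :
    Path (vertexPt K a (vertex_mem hs ha)) (vertexPt K b (vertex_mem hs hb)) where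
  toFun t := ⟨AffineMap.lineMap (Pi.single a 1 : ι → ℝ) (Pi.single b 1) (t : ℝ), by
    refine mem_realization_of_support
      ((convex_stdSimplex ℝ ι).segment_subset (single_mem_stdSimplex ℝ a)
        (single_mem_stdSimplex ℝ b) ?_) hs ?_
    · rw [segment_eq_image_lineMap]
      exact ⟨t, t.2, rfl⟩
    · intro v hv
      have h1 : v ≠ a := fun h => hv (h ▸ ha)
      have h2 : v ≠ b := fun h => hv (h ▸ hb)
      simp [AffineMap.lineMap_apply, h1, h2]⟩
  continuous_toFun := by
    refine Continuous.subtype_mk ?_ _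
    fun_prop
  source' := Subtype.ext (by simp [vertexPt])
  target' := Subtype.ext (by simp [vertexPt])

end Realization

/-! ### Loops -/

/-- The element `c · g · c⁻¹` of `π₁(X, x)` for a loop `g` at `y` and a path `c` from `x` to `y`. -/
def pullLoop {X : Type*} [TopologicalSpace X] {x y : X} (c : Path.Homotopic.Quotient x y)
    (g : FundamentalGroup X y) : FundamentalGroup X x :=
  FundamentalGroup.fromPath ((c.trans (FundamentalGroup.toPath g)).trans c.symm)

/-- The order of `g` is finite and even. -/
def HasEvenOrder {G : Type*} [Monoid G] (g : G) : Prop := 0 < orderOf g ∧ Even (orderOf g)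

/-- The loop `t ↦ f (exp (2π√-1 t))`. -/
def circleLoop {X : Type*} [TopologicalSpace X] (f : C(Circle, X)) (x : X) (hx : f 1 = x) :
    Path x x where
  toFun t := f (Circle.exp (2 * Real.pi * (t : ℝ)))
  continuous_toFun := by fun_prop
  source' := by simp [hx]
  target' := by simp [hx]

/-! ### Twisted simplicial chains -/

section Twisted

variable {ι : Type*}

/-- The `i`-dimensional simplices of `K`. -/
def Face (K : PreAbstractSimplicialComplex ι) (i : ℕ) : Type _ :=
  {s : Finset ι // s ∈ K.faces ∧ s.card = i + 1}

theorem Face.nonempty {K : PreAbstractSimplicialComplex ι} {i : ℕ} (τ : Face K i) : τ.1.Nonempty :=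
  (K.isRelLowerSet_faces τ.2.1).1

variable [Fintype ι] [LinearOrder ι]

instance (K : PreAbstractSimplicialComplex ι) (i : ℕ) : Fintype (Face K i) := by
  classical exact Subtype.fintype _

instance (K : PreAbstractSimplicialComplex ι) (i : ℕ) : DecidableEq (Face K i) :=
  inferInstanceAs (DecidableEq {s : Finset ι // s ∈ K.faces ∧ s.card = i + 1})

/-- The simplex spanned by `τ` and a further vertex `v`. -/
def Face.cons {K : PreAbstractSimplicialComplex ι} {i : ℕ} (τ : Face K i) (v : ι)
    (h : v ∉ τ.1 ∧ insert v τ.1 ∈ K.faces) : Face K (i + 1) :=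
  ⟨insert v τ.1, h.2, by rw [Finset.card_insert_of_notMem h.1, τ.2.2]⟩

/-- A choice of a lift of every vertex of `K` to the universal cover of `|K|`, whose points are the
homotopy classes of paths from `x₀`. It determines a lift of every simplex, the one whose first
vertex is the chosen lift of the first vertex of the simplex. -/
abbrev Lifts (K : PreAbstractSimplicialComplex ι) (x₀ : realization K) : Type _ :=
  ∀ (v : ι) (hv : {v} ∈ K.faces), Path.Homotopic.Quotient x₀ (vertexPt K v hv)

/-- The class in `π₁(|K|, x₀)` of the loop that runs along the path to `a`, along the edge from `a`
to `b`, and back from `b`. -/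
def edgeLoop {K : PreAbstractSimplicialComplex ι} {x₀ : realization K} (γ : Lifts K x₀)
    {s : Finset ι} (hs : s ∈ K.faces) {a b : ι} (ha : a ∈ s) (hb : b ∈ s) :
    FundamentalGroup (realization K) x₀ :=
  FundamentalGroup.fromPath
    (((γ a (vertex_mem hs ha)).trans (Path.Homotopic.Quotient.mk (edgePath hs ha hb))).trans
      (γ b (vertex_mem hs hb)).symm)

variable {W : Type*} [AddCommGroup W] [Module ℂ W]

open Classical in
/-- The boundary map of the twisted chain complex `W ⊗_{ℤ[π₁]} C_*(universal cover of |K|; ℤ)`, in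
terms of the chosen lifts: a chain `∑_σ w_σ ⊗ σ̃` is the function `σ ↦ w_σ`. Simplices are oriented
by the order of the vertices. If the first vertices of `σ` and of its facet `τ` are `a` and `b`, the
facet of `σ̃` over `τ` is the translate of `τ̃` by the class `g` of the loop
`edgeLoop` from `a` to `b`, and `w ⊗ g τ̃ = R(g) w ⊗ τ̃`.

In Mathlib's fundamental group the product `p * q` is the loop `q` followed by `p`; the
representation `g ↦ R(g)⁻¹` is the corresponding one of the group with the concatenation product,
so that this is the usual rule `w ⊗ g c = R(g)⁻¹ w ⊗ c` for that group. -/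
def twistedBoundary {K : PreAbstractSimplicialComplex ι} {x₀ : realization K} (γ : Lifts K x₀)
    (R : Representation ℂ (FundamentalGroup (realization K) x₀) W) (i : ℕ) :
    (Face K (i + 1) → W) →ₗ[ℂ] (Face K i → W) :=
  LinearMap.pi fun τ => ∑ v : ι,
    if h : v ∉ τ.1 ∧ insert v τ.1 ∈ K.faces then
      (-1 : ℂ) ^ (τ.1.filter (· < v)).card •
        (R (edgeLoop γ h.2 (Finset.min'_mem (insert v τ.1) (Finset.insert_nonempty v τ.1))
            (Finset.mem_insert_of_mem (Finset.min'_mem τ.1 τ.nonempty))) ∘ₗ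
          LinearMap.proj (τ.cons v h))
    else 0

/-- The representation `R` of `π₁(|K|, x₀)` is acyclic: the homology twisted by `R` vanishes. -/
def IsAcyclicRep {K : PreAbstractSimplicialComplex ι} {x₀ : realization K} (γ : Lifts K x₀)
    (R : Representation ℂ (FundamentalGroup (realization K) x₀) W) : Prop :=
  Acyclic (C := fun i => Face K i → W) (twistedBoundary γ R)

/-- The Reidemeister torsion `Tor(|K|; W_R)`: the torsion of the twisted chain complex with respect
to the basis `w_k ⊗ σ̃`, where `w_k` is a basis of `W` and `σ̃` are the chosen lifts. -/
def reidemeisterTorsion {K : PreAbstractSimplicialComplex ι} {x₀ : realization K} (γ : Lifts K x₀)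
    [Module.Finite ℂ W] (R : Representation ℂ (FundamentalGroup (realization K) x₀) W) : ℂ :=
  torsion (C := fun i => Face K i → W) (twistedBoundary γ R)
    (fun i => Pi.basis fun _ : Face K i => Module.finBasis ℂ W) (Fintype.card ι)

/-- `ρ_n = σ_n ∘ ρ`. -/
def rhoN {X : Type*} [TopologicalSpace X] {x₀ : X} (ρ : FundamentalGroup X x₀ →* SL2) (n : ℕ) :
    Representation ℂ (FundamentalGroup X x₀) (V n) :=
  (sigma n).comp ρ

end Twisted

/-! ### Manifolds with torus boundary and Dehn filling -/

section Manifold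

variable {ι : Type*} [Fintype ι] {m : ℕ}

open Classical in
/-- The triangulated space `|M|` (compact, since the complex is finite) is a connected orientable
`3`-manifold, and its boundary is the disjoint union of the tori `|T j|`. -/
structure IsManifoldWithTorusBoundary [LinearOrder ι] (M : PreAbstractSimplicialComplex ι)
    (T : Fin m → PreAbstractSimplicialComplex ι) : Prop where
  le : ∀ j, T j ≤ M
  disjoint : ∀ i j, i ≠ j → T i ⊓ T j = ⊥
  torus : ∀ j, Nonempty (realization (T j) ≃ₜ Circle × Circle)
  connected : ConnectedSpace (realization M)
  /-- Every point outside the tori has an open neighbourhood homeomorphic to `ℝ³`. -/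
  interior : ∀ x : realization M, (∀ j, (x : ι → ℝ) ∉ realization (T j)) →
    ∃ U : Set (realization M), IsOpen U ∧ x ∈ U ∧ Nonempty (U ≃ₜ EuclideanSpace ℝ (Fin 3))
  /-- Every point of the tori has an open neighbourhood homeomorphic to the closed half space, by a
  homeomorphism which takes the point to the bounding plane. -/
  boundary : ∀ x : realization M, (∃ j, (x : ι → ℝ) ∈ realization (T j)) →
    ∃ (U : Set (realization M)) (hx : x ∈ U) (e : U ≃ₜ EuclideanHalfSpace 3),
      IsOpen U ∧ (e ⟨x, hx⟩).1 0 = 0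
  /-- The `3`-simplices can be oriented coherently: with the signs `o` they form a chain whose
  boundary is zero on every triangle outside the tori. -/
  orientable : ∃ o : Finset ι → ℤ, (∀ s, o s = 1 ∨ o s = -1) ∧
    ∀ t ∈ M.faces, t.card = 3 → (∀ j, t ∉ (T j).faces) →
      ∑ v : ι, (if v ∉ t ∧ insert v t ∈ M.faces then
        (-1) ^ (t.filter (· < v)).card * o (insert v t) else 0) = 0

/-- A meridian `q` and a longitude `h` on a torus, given by a base point and a basis of the free
abelian group `π₁`, that is `π₁ = ⟨q, h | [q, h] = 1⟩`. -/
structure PeripheralSystem (T : PreAbstractSimplicialComplex ι) where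
  base : realization T
  q : FundamentalGroup (realization T) base
  h : FundamentalGroup (realization T) base
  bijective : Function.Bijective fun k : ℤ × ℤ => q ^ k.1 * h ^ k.2

/-- The closed unit disk. -/
abbrev Disk : Type := Metric.closedBall (0 : ℂ) 1

def Disk.zero : Disk := ⟨0, by simp⟩

def Disk.one : Disk := ⟨1, by simp⟩

/-- The inclusion of the unit circle `∂D²` in `D²`. -/
def Disk.ofCircle : C(Circle, Disk) :=
  ⟨fun w => ⟨(w : ℂ), by simp [Circle.norm_coe]⟩, by fun_prop⟩

/-- Dehn filling of `M` along the boundary tori `T j` with slopes `α j / β j` with respect to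
`(q_j, h_j)`: solid tori `S j ≅ D² × S¹`, disjoint from each other, which meet `M` exactly in
`T j = ∂ S j` and such that `∂D² × {1}` represents `q_j ^ α_j * h_j ^ β_j` (its orientation is
immaterial, because complex conjugation on `D²` reverses it). Such a curve is automatically
essential, and `α_j`, `β_j` are automatically coprime. -/
structure DehnFilling (M : PreAbstractSimplicialComplex ι)
    (T : Fin m → PreAbstractSimplicialComplex ι) (P : ∀ j, PeripheralSystem (T j))
    (α β : Fin m → ℤ) where
  S : Fin m → PreAbstractSimplicialComplex ι
  inter_eq : ∀ j, M ⊓ S j = T j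
  disjoint : ∀ i j, i ≠ j → S i ⊓ S j = ⊥
  chart : ∀ j, Disk × Circle ≃ₜ realization (S j)
  boundary_iff : ∀ j (z : Disk) (w : Circle),
    (chart j (z, w) : ι → ℝ) ∈ realization (T j) ↔ ‖(z : ℂ)‖ = 1
  base_eq : ∀ j, (chart j (Disk.one, 1) : ι → ℝ) = (P j).base
  slope : ∀ j, FundamentalGroup.fromPath (Path.Homotopic.Quotient.mk
      (circleLoop
        (⟨fun z => ⟨(chart j (Disk.ofCircle z, 1) : ι → ℝ), (boundary_iff j _ _).mpr (by
            exact Circle.norm_coe _)⟩, by fun_prop⟩ : C(Circle, realization (T j)))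
        (P j).base (by
          refine Subtype.ext ((congrArg (fun z => (chart j (z, 1) : ι → ℝ)) ?_).trans (base_eq j))
          exact Subtype.ext (by simp [Disk.ofCircle, Disk.one])))) =
    (P j).q ^ α j * (P j).h ^ β j

namespace DehnFilling

variable {M : PreAbstractSimplicialComplex ι} {T : Fin m → PreAbstractSimplicialComplex ι}
  {P : ∀ j, PeripheralSystem (T j)} {α β : Fin m → ℤ}

/-- The filled manifold `M(α₁/β₁, …, α_m/β_m) = M ∪ S 1 ∪ ⋯ ∪ S m`. -/
def total (F : DehnFilling M T P α β) : PreAbstractSimplicialComplex ι := M ⊔ ⨆ j, F.S j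

theorem le_total (F : DehnFilling M T P α β) : M ≤ F.total := le_sup_left

theorem S_le_total (F : DehnFilling M T P α β) (j : Fin m) : F.S j ≤ F.total :=
  le_trans (le_iSup F.S j) le_sup_right

/-- The core `{0} × S¹` of the `j`-th solid torus, as a based loop in the filled manifold. -/
def core (F : DehnFilling M T P α β) (j : Fin m) :
    FundamentalGroup (realization F.total)
      (incl (F.S_le_total j) (F.chart j (Disk.zero, 1))) :=
  FundamentalGroup.fromPath (Path.Homotopic.Quotient.mk
    (circleLoop
      ((incl (F.S_le_total j)).comp ⟨fun w => F.chart j (Disk.zero, w), by fun_prop⟩) _ rfl))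

end DehnFilling

end Manifold

end SurgeryTorsion

end

/-! Cutting along the boundary tori makes the torsion multiplicative. The chain complex of the
filled manifold is an extension of that of `M` by the relative complexes of the pairs `(S j, T j)`,
so `|Tor|` changes by the product of the torsions of these pairs with coefficients in `V (2N)`
(`DehnFilling.chainTorsion_total`).

On a solid torus the representation factors through the cyclic group generated by the core
(`exists_edge_gauge`). The image of the core has order `2λ`, so it is diagonalizable with
eigenvalues `z`, `z⁻¹`, where `z` is a primitive `2λ`-th root of unity, and it acts on `V (2N)` with
eigenvalues `z ^ (2k + 1 - 2N)`, `0 ≤ k < 2N` (`exists_eigenbasis`). Let `f m` be the torsion of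
`(S, T)` for the character which takes the core to `z ^ (2m + 1)`. The pair then contributes `∏ k <
2N, f (k - N)`. The function `f` has period `λ`, and its product over a period is `1 / 2`
(`exists_relTorsion`). The logarithm of the contribution is therefore `-(2N / λ) log 2 + O(1)`,
which disappears after division by `(2N) ^ 2` and gives `-(log 2) / λ` after division by `2N`.

The product over a period is found without computing the torsion of any single character. The `λ`
numbers `z ^ (2m + 1)` in a period are all the roots of `u ^ λ = -1`, so the sum of their characters
is the complexification of the lattice `ℤ[t] / (t ^ λ + 1)`. For a complex of lattices with finite
homology, `|Tor|` is the alternating product of the orders of the homology groups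
(`hasTorsion_of_lattice`). The solid torus has only `H₀ = ℤ[t] / (t ^ λ + 1, t - 1) = ℤ/2`, which
gives `1 / 2`. Its boundary has `H₀` and `H₁` of order `2`, which gives `1`. The quotient is `1 /
2`.

The triangulation of `S` is arbitrary and known only through the homeomorphism with `D² × S¹`, so
these homology groups need a topological argument. `LogSystem.exact` shows that the augmented
simplicial chains of the covering complex are exact: they are compared with chains of small finite
sequences of points in a convex set, which are exact by contraction. All comparison maps and
homotopies come from acyclic carriers (`exists_carried`). The finite homology groups then follow by
dividing the resulting resolution of `ℤ` by `t ^ λ + 1` and, for the torus, also by `s - 1`, where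
`s` is the second deck variable. -/

noncomputable section

/-! ### Chains of finite sequences, and acyclic carriers -/

namespace ListChain

variable {X Y A B : Type*}

/-- Integral chains of finite sequences of points. The empty sequence takes the place of the
augmentation. -/
abbrev Ch (X : Type*) := List X →₀ ℤ

/-- Prepend a point to every sequence. -/
def cone (x : X) : Ch X →ₗ[ℤ] Ch X := Finsupp.lmapDomain ℤ ℤ (List.cons x)

/-- The alternating sum of the sequences obtained by deleting one entry. -/
def bdList : List X → Ch X
  | [] => 0
  | x :: l => Finsupp.single l 1 - cone x (bdList l)

def lin (f : List A → Ch B) : Ch A →ₗ[ℤ] Ch B := Finsupp.linearCombination ℤ f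

def d : Ch X →ₗ[ℤ] Ch X := lin bdList

def mapL (f : X → Y) : Ch X →ₗ[ℤ] Ch Y := Finsupp.lmapDomain ℤ ℤ (List.map f)

abbrev Sup (S : Set (List X)) : Submodule ℤ (Ch X) := Finsupp.supported ℤ ℤ S

@[simp] theorem cone_single (x : X) (l : List X) (a : ℤ) :
    cone x (Finsupp.single l a) = Finsupp.single (x :: l) a := by
  simp [cone]

@[simp] theorem mapL_single (f : X → Y) (l : List X) (a : ℤ) :
    mapL f (Finsupp.single l a) = Finsupp.single (l.map f) a := by
  simp [mapL]

@[simp] theorem lin_single (f : List A → Ch B) (l : List A) (a : ℤ) :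
    lin f (Finsupp.single l a) = a • f l := by
  simp [lin]

theorem d_single (l : List X) (a : ℤ) : d (Finsupp.single l a) = a • bdList l := lin_single _ _ _

/-- There is no correction term in low degrees, because the empty sequence plays the augmentation.
Prepending a point is thus a contracting homotopy wherever it is allowed; most of the exactness
below comes from this. -/
theorem d_cone (x : X) (c : Ch X) : d (cone x c) = c - cone x (d c) := by
  induction c using Finsupp.induction_linear with
  | zero => simp
  | add f g hf hg => simp only [map_add, hf, hg]; abel
  | single l a => simp [d_single, bdList, smul_sub, map_smul]

theorem d_bdList (l : List X) : d (bdList l) = 0 := by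
  induction l with
  | nil => simp [bdList]
  | cons x l ih => simp [bdList, d_cone, ih, d_single]

theorem d_d (c : Ch X) : d (d c) = 0 := by
  induction c using Finsupp.induction_linear with
  | zero => simp
  | add f g hf hg => simp only [map_add, hf, hg, add_zero]
  | single l a => simp [d_single, d_bdList]

theorem mapL_cone (f : X → Y) (x : X) (c : Ch X) : mapL f (cone x c) = cone (f x) (mapL f c) := by
  induction c using Finsupp.induction_linear with
  | zero => simp
  | add f g hf hg => simp only [map_add, hf, hg]
  | single l a => simp

theorem mapL_bdList (f : X → Y) (l : List X) : mapL f (bdList l) = bdList (l.map f) := by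
  induction l with
  | nil => simp [bdList]
  | cons x l ih => simp [bdList, mapL_cone, ih]

theorem mapL_d (f : X → Y) (c : Ch X) : mapL f (d c) = d (mapL f c) := by
  induction c using Finsupp.induction_linear with
  | zero => simp
  | add f g hf hg => simp only [map_add, hf, hg]
  | single l a => simp [d_single, mapL_bdList]

/-! Supports -/

theorem sup_induction {S : Set (List X)} {p : Ch X → Prop} (h0 : p 0)
    (hadd : ∀ x y, p x → p y → p (x + y)) (hs : ∀ l ∈ S, ∀ a, p (Finsupp.single l a)) {x : Ch X}
    (hx : x ∈ Sup S) : p x := by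
  classical
  rw [Finsupp.mem_supported] at hx
  rw [← Finsupp.sum_single x, Finsupp.sum]
  refine Finset.sum_induction _ p hadd h0 fun l hl => hs l (hx hl) _

theorem single_mem {S : Set (List X)} {l : List X} (h : l ∈ S) (a : ℤ) :
    Finsupp.single l a ∈ Sup S := Finsupp.single_mem_supported _ _ h

theorem cone_mem {S S' : Set (List X)} {x : X} (h : ∀ l ∈ S, x :: l ∈ S') {c : Ch X}
    (hc : c ∈ Sup S) : cone x c ∈ Sup S' := by
  refine sup_induction (p := fun c => cone x c ∈ Sup S') (by simp) (fun a b ha hb => ?_)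
    (fun l hl a => ?_) hc
  · rw [map_add]; exact add_mem ha hb
  · rw [cone_single]; exact single_mem (h l hl) a

theorem mapL_mem {S : Set (List X)} {S' : Set (List Y)} {f : X → Y}
    (h : ∀ l ∈ S, l.map f ∈ S') {c : Ch X} (hc : c ∈ Sup S) : mapL f c ∈ Sup S' := by
  refine sup_induction (p := fun c => mapL f c ∈ Sup S') (by simp) (fun a b ha hb => ?_)
    (fun l hl a => ?_) hc
  · rw [map_add]; exact add_mem ha hb
  · rw [mapL_single]; exact single_mem (h l hl) a

theorem lin_mem {S : Set (List A)} {M : Submodule ℤ (Ch B)} {f : List A → Ch B}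
    (h : ∀ l ∈ S, f l ∈ M) {c : Ch A} (hc : c ∈ Sup S) : lin f c ∈ M := by
  refine sup_induction (p := fun c => lin f c ∈ M) (by simp) (fun a b ha hb => ?_)
    (fun l hl a => ?_) hc
  · rw [map_add]; exact add_mem ha hb
  · rw [lin_single]; exact Submodule.smul_mem _ _ (h l hl)

theorem linearMap_congr {S : Set (List A)} {M : Type*} [AddCommGroup M] {f g : Ch A →ₗ[ℤ] M}
    (h : ∀ l ∈ S, f (Finsupp.single l 1) = g (Finsupp.single l 1)) {c : Ch A} (hc : c ∈ Sup S) :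
    f c = g c := by
  refine sup_induction (p := fun c => f c = g c) (by simp) (fun a b ha hb => ?_)
    (fun l hl a => ?_) hc
  · simp [ha, hb]
  · have : Finsupp.single l a = a • Finsupp.single l (1 : ℤ) := by simp
    rw [this, map_smul, map_smul, h l hl]

theorem lin_congr {S : Set (List A)} {f g : List A → Ch B} (h : ∀ l ∈ S, f l = g l) {c : Ch A}
    (hc : c ∈ Sup S) : lin f c = lin g c :=
  linearMap_congr (fun l hl => by simp [h l hl]) hc

/-- Carriers need that the terms are sublists; the recursion on the length needs that exactly one
entry is lost. -/
theorem bdList_mem (l : List X) :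
    bdList l ∈ Sup {l' : List X | l'.Sublist l ∧ l'.length + 1 = l.length} := by
  induction l with
  | nil => simp [bdList]
  | cons x l ih =>
    refine sub_mem (single_mem (show _ ∧ _ from ⟨List.sublist_cons_self x l, by simp⟩) _) (cone_mem ?_ ih)
    rintro l' ⟨h1, h2⟩
    exact ⟨h1.cons_cons x, by simp [h2]⟩

theorem d_mem {S S' : Set (List X)} (h : ∀ l ∈ S, ∀ l', l'.Sublist l → l'.length + 1 = l.length →
    l' ∈ S') {c : Ch X} (hc : c ∈ Sup S) : d c ∈ Sup S' :=
  lin_mem (fun l hl => Finsupp.supported_mono (fun l' hl' => h l hl l' hl'.1 hl'.2)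
    (bdList_mem l)) hc

/-- The chains supported on `S` form an exact complex. -/
def Exact (S : Set (List X)) : Prop := ∀ x ∈ Sup S, d x = 0 → ∃ y ∈ Sup S, d y = x

theorem exact_of_cons {S : Set (List X)} (p : X) (h : ∀ l ∈ S, p :: l ∈ S) : Exact S := by
  intro x hx hdx
  exact ⟨cone p x, cone_mem h hx, by rw [d_cone, hdx]; simp⟩

-- The default `0` is harmless: `fill_spec` covers the cycles of an exact family, and nothing is
-- claimed elsewhere.
open Classical in
def fill (S : Set (List B)) (x : Ch B) : Ch B :=
  if h : ∃ y ∈ Sup S, d y = x then h.choose else 0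

theorem fill_spec {S : Set (List B)} (hS : Exact S) {x : Ch B} (hx : x ∈ Sup S) (hd : d x = 0) :
    fill S x ∈ Sup S ∧ d (fill S x) = x := by
  have h := hS x hx hd
  rw [fill, dif_pos h]
  exact h.choose_spec

/-- The recursion runs over a bound for the length, since the value at a sequence needs the values
at all its facets. By `carrierRec_eq` the bound does not matter. -/
def carrierRec (Φ : List A → Set (List B)) (c : List A → Ch B) (ε : ℤ) (e : Ch B) :
    ℕ → List A → Ch B
  | 0 => fun _ => e
  | n + 1 => fun l => if l.length ≤ n then carrierRec Φ c ε e n l else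
      fill (Φ l) (c l - ε • lin (carrierRec Φ c ε e n) (bdList l))

theorem carrierRec_eq (Φ : List A → Set (List B)) (c : List A → Ch B) (ε : ℤ) (e : Ch B) (n : ℕ)
    (l : List A) (h : l.length ≤ n) :
    carrierRec Φ c ε e n l = carrierRec Φ c ε e l.length l := by
  induction n with
  | zero => rw [Nat.le_zero.mp h]
  | succ n ih =>
    rcases Nat.lt_or_ge n l.length with h1 | h1
    · rw [le_antisymm h h1]
    · exact (if_pos h1).trans (ih h1)

/-- The method of acyclic carriers: chain maps (`ε = -1`, `c = 0`) and chain homotopies (`ε = 1`)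
into acyclic carriers exist. -/
theorem exists_carried (P : List A → Prop) (hP : ∀ l l' : List A, l'.Sublist l → P l → P l')
    (Φ : List A → Set (List B))
    (mono : ∀ l l' : List A, P l → l'.Sublist l → Φ l' ⊆ Φ l)
    (hex : ∀ l, l ≠ [] → P l → Exact (Φ l)) (c : List A → Ch B)
    (hc : ∀ l, P l → l ≠ [] → c l ∈ Sup (Φ l)) (ε : ℤ)
    (hdc : ∀ l, P l → l ≠ [] → d (c l) = ε • lin c (bdList l)) (e : Ch B)
    (he : e ∈ Sup (Φ [])) (hde : d e = c []) :
    ∃ h : List A → Ch B, h [] = e ∧ (∀ l, P l → h l ∈ Sup (Φ l)) ∧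
      ∀ l, P l → d (h l) = c l - ε • lin h (bdList l) := by
  set h : List A → Ch B := fun l => carrierRec Φ c ε e l.length l with hh
  have h0 : h [] = e := rfl
  have hstep : ∀ l : List A, l ≠ [] →
      h l = fill (Φ l) (c l - ε • lin h (bdList l)) := by
    intro l hl
    obtain ⟨n, hn⟩ : ∃ n, l.length = n + 1 :=
      ⟨l.length - 1, by have := List.length_pos_iff.mpr hl; omega⟩
    have h1 : lin (carrierRec Φ c ε e n) (bdList l) = lin h (bdList l) := by
      refine lin_congr (fun l' hl' => ?_) (bdList_mem l)
      exact carrierRec_eq Φ c ε e n l' (by have := hl'.2; omega)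
    rw [← h1]
    change carrierRec Φ c ε e l.length l = _
    rw [hn]
    exact if_neg (by omega)
  have key : ∀ n, ∀ l : List A, l.length = n → P l → h l ∈ Sup (Φ l) ∧
      d (h l) = c l - ε • lin h (bdList l) := by
    intro n
    induction n with
    | zero =>
      intro l hl _
      obtain rfl := List.length_eq_zero_iff.mp hl
      simp [h0, he, hde, bdList]
    | succ n ih =>
      intro l hl hPl
      have hne : l ≠ [] := by rintro rfl; simp at hl
      rw [hstep l hne]
      have hsub : ∀ l' ∈ {l' : List A | l'.Sublist l ∧ l'.length + 1 = l.length},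
          h l' ∈ Sup (Φ l') ∧ d (h l') = c l' - ε • lin h (bdList l') := fun l' hl' =>
        ih l' (by have := hl'.2; omega) (hP l l' hl'.1 hPl)
      refine fill_spec (hex l hne hPl) (sub_mem (hc l hPl hne) (Submodule.smul_mem _ _ ?_)) ?_
      · exact lin_mem (fun l' hl' => Finsupp.supported_mono (mono l l' hPl hl'.1)
          (hsub l' hl').1) (bdList_mem l)
      -- The chain to be filled is a cycle: the two terms in `c` cancel, and what remains is a
      -- multiple of `lin h (d (bdList l)) = 0`.
      · have h2 : d (lin h (bdList l)) = lin c (bdList l) - ε • lin h (d (bdList l)) := by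
          refine linearMap_congr (f := d ∘ₗ lin h) (g := lin c - ε • (lin h ∘ₗ d)) ?_ (bdList_mem l)
          intro l' hl'
          simp [(hsub l' hl').2, d_single]
        rw [map_sub, map_smul, h2, d_bdList, hdc l hPl hne]
        simp
  exact ⟨h, h0, fun l hl => (key _ l rfl hl).1, fun l hl => (key _ l rfl hl).2⟩

end ListChain

/-! ### Small sequences of points in a star convex set -/

namespace ListChain

variable {X Y A B : Type*}

/-- Contiguous maps are chain homotopic. -/
theorem exists_homotopy_of_contiguous {f g : A → B} {S : Set (List A)} {S' : Set (List B)}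
    (hS : ∀ l l' : List A, l'.Sublist l → l ∈ S → l' ∈ S)
    (hS' : ∀ l ∈ S, ∀ l' : List B, (∀ y ∈ l', ∃ z ∈ l, y = f z ∨ y = g z) → l' ∈ S')
    {x : Ch A} (hx : x ∈ Sup S) (hdx : d x = 0) :
    ∃ w ∈ Sup S', d w = mapL f x - mapL g x := by
  set c : List A → Ch B := fun l => Finsupp.single (l.map f) 1 - Finsupp.single (l.map g) 1
    with hcdef
  have hlc : lin c = mapL f - mapL g := by
    refine Finsupp.lhom_ext fun l a => ?_
    simp [hcdef, smul_sub]
  -- The carrier of `l` consists of all sequences in the images of its entries under `f` and `g`. It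
  -- is closed under prepending `f a` for an entry `a`, hence exact.
  obtain ⟨h, -, h1, h2⟩ := exists_carried (B := B) (· ∈ S) hS
    (fun l => {l' : List B | ∀ y ∈ l', ∃ z ∈ l, y = f z ∨ y = g z})
    (fun l l' _ hl l'' hl'' y hy => by
      obtain ⟨z, hz, h⟩ := hl'' y hy
      exact ⟨z, hl.subset hz, h⟩)
    (fun l hl _ => by
      obtain ⟨a, l, rfl⟩ := List.exists_cons_of_ne_nil hl
      refine exact_of_cons (f a) fun l' hl' y hy => ?_
      rcases List.mem_cons.mp hy with rfl | hy
      · exact ⟨a, by simp, Or.inl rfl⟩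
      · exact hl' y hy)
    c
    (fun l _ _ => sub_mem
      (single_mem (fun y hy => by
        obtain ⟨z, hz, rfl⟩ := List.mem_map.mp hy
        exact ⟨z, hz, Or.inl rfl⟩) _)
      (single_mem (fun y hy => by
        obtain ⟨z, hz, rfl⟩ := List.mem_map.mp hy
        exact ⟨z, hz, Or.inr rfl⟩) _))
    1
    (fun l _ _ => by
      rw [hlc]
      simp [hcdef, d_single, mapL_bdList])
    0 (by simp) (by simp [hcdef])
  refine ⟨lin h x, lin_mem (fun l hl => Finsupp.supported_mono (hS' l hl) (h1 l hl)) hx, ?_⟩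
  have : d (lin h x) = lin c x - lin h (d x) := by
    refine linearMap_congr (f := d ∘ₗ lin h) (g := lin c - lin h ∘ₗ d) (fun l hl => ?_) hx
    simp [h2 l hl, d_single]
  rw [this, hdx, hlc]
  simp

section Convex

variable {E : Type*} [NormedAddCommGroup E] [NormedSpace ℝ E]

/-- Sequences in `S` of mutual distance less than `δ`. -/
def smallIn (S : Set E) (δ : ℝ) : Set (List E) :=
  {l | (∀ x ∈ l, x ∈ S) ∧ ∀ x ∈ l, ∀ y ∈ l, dist x y < δ}

/-- A bound `ε < δ` for the mutual distances leaves room for a small move towards `p`, whose size is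
controlled by the bound `b`. -/
def boundedIn (S : Set E) (p : E) (ε b : ℝ) : Set (List E) :=
  {l | (∀ x ∈ l, x ∈ S) ∧ (∀ x ∈ l, dist x p ≤ b) ∧ ∀ x ∈ l, ∀ y ∈ l, dist x y ≤ ε}

theorem dist_lineMap_same {x y p : E} {s : ℝ} (h1 : s ≤ 1) :
    dist (AffineMap.lineMap x p s : E) (AffineMap.lineMap y p s) = (1 - s) * dist x y := by
  rw [dist_eq_norm, dist_eq_norm, AffineMap.lineMap_apply_module, AffineMap.lineMap_apply_module]
  rw [show (1 - s) • x + s • p - ((1 - s) • y + s • p) = (1 - s) • (x - y) by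
    rw [smul_sub]; abel, norm_smul, Real.norm_of_nonneg (by linarith)]

/-- Going the fraction `s` of the way to `p` displaces points by at most `s * b`, so a sequence and
its image together are still `δ`-small: the two maps are contiguous. -/
theorem contract_step {S : Set E} {p : E} (hS : StarConvex ℝ p S) {ε b s δ : ℝ}
    (h0 : 0 ≤ s) (h1 : s ≤ 1) (hδ : s * b + ε < δ) {x : Ch E}
    (hx : x ∈ Sup (boundedIn S p ε b)) (hdx : d x = 0) :
    ∃ w ∈ Sup (smallIn S δ), d w = x - mapL (fun y => AffineMap.lineMap y p s) x := by
  have hmem : ∀ y ∈ S, (AffineMap.lineMap y p s : E) ∈ S := fun y hy => by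
    rw [← AffineMap.lineMap_apply_one_sub]
    rw [AffineMap.lineMap_apply_module]
    exact hS hy (by linarith) (by linarith) (by ring)
  have := exists_homotopy_of_contiguous (f := id) (g := fun y : E => AffineMap.lineMap y p s)
    (S := boundedIn S p ε b) (S' := smallIn S δ) ?_ ?_ hx hdx
  · obtain ⟨w, hw, h⟩ := this
    refine ⟨w, hw, ?_⟩
    rw [h]
    congr 1
    simp [mapL]
  · rintro l l' hl ⟨h1, h2, h3⟩
    exact ⟨fun x hx => h1 x (hl.subset hx), fun x hx => h2 x (hl.subset hx),
      fun x hx y hy => h3 x (hl.subset hx) y (hl.subset hy)⟩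
  · rintro l ⟨h2, h3, h4⟩ l' hl'
    have key : ∀ z ∈ l, ∀ z' ∈ l, dist z (AffineMap.lineMap z' p s : E) < δ := fun z hz z' hz' => by
      have e1 : dist z' (AffineMap.lineMap z' p s : E) = s * dist z' p := by
        rw [dist_left_lineMap, Real.norm_of_nonneg h0]
      have e2 := dist_triangle z z' (AffineMap.lineMap z' p s : E)
      have e3 := h4 z hz z' hz'
      have e4 := mul_le_mul_of_nonneg_left (h3 z' hz') h0
      linarith
    constructor
    · intro y hy
      obtain ⟨z, hz, rfl | rfl⟩ := hl' y hy
      · exact h2 _ hz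
      · exact hmem z (h2 z hz)
    · intro y hy y' hy'
      obtain ⟨z, hz, rfl | rfl⟩ := hl' y hy <;> obtain ⟨z', hz', rfl | rfl⟩ := hl' y' hy'
      · have e1 := h4 _ hz _ hz'
        have hb : 0 ≤ b := dist_nonneg.trans (h3 _ hz)
        have := mul_nonneg h0 hb
        exact lt_of_le_of_lt e1 (by linarith)
      · exact key _ hz _ hz'
      · rw [dist_comm]; exact key _ hz' _ hz
      · rw [dist_lineMap_same h1]
        have := h4 _ hz _ hz'
        have := h3 _ hz
        have hb : 0 ≤ b := dist_nonneg.trans this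
        have := mul_nonneg h0 hb
        nlinarith [dist_nonneg (x := z) (y := z')]

/-- Every step shrinks the distances to `p` by the factor `1 - s` and does not increase the mutual
distances. After `n` steps the points are so close to `p` that a single jump to `p` is allowed. -/
theorem bounded_bounds {S : Set E} {p : E} (hp : p ∈ S) (hS : StarConvex ℝ p S) {ε b s δ : ℝ}
    (h0 : 0 ≤ s) (h1 : s ≤ 1) (hε : 0 ≤ ε) (hb : 0 ≤ b) (hδ : s * b + ε < δ) (n : ℕ) :
    ∀ b', b' ≤ b → (1 - s) ^ n * b' + ε < δ → ∀ x ∈ Sup (boundedIn S p ε b'), d x = 0 →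
      ∃ w ∈ Sup (smallIn S δ), d w = x := by
  induction n with
  | zero =>
    intro b' _ hb' x hx hdx
    -- The final jump: `s = 1` sends all points to `p`, and constant sequences are exact by
    -- prepending `p`.
    obtain ⟨w, hw, h⟩ := contract_step hS (s := 1) (δ := δ) zero_le_one le_rfl
      (by simpa using hb') hx hdx
    have h2 : mapL (fun y : E => AffineMap.lineMap y p (1 : ℝ)) x ∈
        Sup {l : List E | ∀ y ∈ l, y = p} :=
      mapL_mem (S := boundedIn S p ε b') (fun l _ => by
        intro y hy
        obtain ⟨z, -, rfl⟩ := List.mem_map.mp hy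
        simp) hx
    obtain ⟨w', hw', h'⟩ := exact_of_cons p (S := {l : List E | ∀ y ∈ l, y = p})
      (fun l hl y hy => by
        rcases List.mem_cons.mp hy with rfl | hy
        · rfl
        · exact hl y hy) _ h2 (by rw [← mapL_d, hdx, map_zero])
    refine ⟨w + w', add_mem hw (Finsupp.supported_mono (fun l hl => ?_) hw'), by
      rw [map_add, h, h']; abel⟩
    refine ⟨fun y hy => by rw [hl y hy]; exact hp, fun y hy z hz => ?_⟩
    rw [hl y hy, hl z hz, dist_self]
    have := mul_nonneg h0 hb
    linarith
  | succ n ih =>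
    intro b' hb'b hb' x hx hdx
    obtain ⟨w, hw, h⟩ := contract_step hS (s := s) (δ := δ) h0 h1
      (by nlinarith) hx hdx
    have hmem : mapL (fun y : E => AffineMap.lineMap y p s) x ∈
        Sup (boundedIn S p ε ((1 - s) * b')) := by
      refine mapL_mem (fun l hl => ?_) hx
      refine ⟨fun y hy => ?_, fun y hy => ?_, fun y hy y' hy' => ?_⟩
      · obtain ⟨z, hz, rfl⟩ := List.mem_map.mp hy
        rw [← AffineMap.lineMap_apply_one_sub, AffineMap.lineMap_apply_module]
        exact hS (hl.1 z hz) (by linarith) (by linarith) (by ring)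
      · obtain ⟨z, hz, rfl⟩ := List.mem_map.mp hy
        rw [dist_lineMap_right, Real.norm_of_nonneg (by linarith)]
        exact mul_le_mul_of_nonneg_left (hl.2.1 z hz) (by linarith)
      · obtain ⟨z, hz, rfl⟩ := List.mem_map.mp hy
        obtain ⟨z', hz', rfl⟩ := List.mem_map.mp hy'
        rw [dist_lineMap_same h1]
        have := hl.2.2 z hz z' hz'
        nlinarith [dist_nonneg (x := z) (y := z')]
    obtain ⟨w', hw', h'⟩ := ih ((1 - s) * b') (by nlinarith) (by rw [pow_succ] at hb'; linarith)
      _ hmem (by rw [← mapL_d, hdx, map_zero])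
    exact ⟨w + w', add_mem hw hw', by rw [map_add, h, h']; abel⟩

/-- The complex of `δ`-small sequences in a star convex set is exact. -/
theorem exact_smallIn {S : Set E} {p : E} (hp : p ∈ S) (hS : StarConvex ℝ p S) {δ : ℝ}
    (hδ : 0 < δ) : Exact (smallIn S δ) := by
  classical
  intro x hx hdx
  rw [Finsupp.mem_supported] at hx
  -- A chain involves finitely many sequences, so its mutual distances have a maximum `ε < δ`. The
  -- elements `0` keep the sets nonempty.
  have hex : ∀ F : Finset (List E), (↑F ⊆ smallIn S δ) → ∃ ε b : ℝ, 0 ≤ ε ∧ 0 ≤ b ∧ ε < δ ∧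
      ∀ l ∈ F, l ∈ boundedIn S p ε b := by
    intro F hF
    set D : Finset ℝ := insert 0 (F.biUnion fun l =>
      (l.toFinset ×ˢ l.toFinset).image fun q => dist q.1 q.2) with hD
    set D' : Finset ℝ := insert 0 (F.biUnion fun l => l.toFinset.image fun q => dist q p) with hD'
    have hDne : D.Nonempty := Finset.insert_nonempty _ _
    have hDne' : D'.Nonempty := Finset.insert_nonempty _ _
    refine ⟨D.max' hDne, D'.max' hDne', D.le_max' _ (Finset.mem_insert_self _ _),
      D'.le_max' _ (Finset.mem_insert_self _ _), ?_, fun l hl => ⟨(hF hl).1, fun y hy => ?_,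
        fun y hy z hz => ?_⟩⟩
    · rw [Finset.max'_lt_iff]
      intro y hy
      simp only [hD, Finset.mem_insert, Finset.mem_biUnion, Finset.mem_image, Finset.mem_product,
        List.mem_toFinset] at hy
      rcases hy with rfl | ⟨l, hl, q, ⟨h1, h2⟩, rfl⟩
      · exact hδ
      · exact (hF hl).2 _ h1 _ h2
    · refine D'.le_max' _ ?_
      simp only [hD', Finset.mem_insert, Finset.mem_biUnion, Finset.mem_image, List.mem_toFinset]
      exact Or.inr ⟨l, hl, y, hy, rfl⟩
    · refine D.le_max' _ ?_
      simp only [hD, Finset.mem_insert, Finset.mem_biUnion, Finset.mem_image, Finset.mem_product,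
        List.mem_toFinset]
      exact Or.inr ⟨l, hl, (y, z), ⟨hy, hz⟩, rfl⟩
  obtain ⟨ε, b, hε, hb, hεδ, hF⟩ := hex x.support hx
  -- The step size is fixed once and for all; finitely many steps then suffice, as `(1 - s) ^ n * b`
  -- tends to `0`.
  obtain ⟨s, hs0, hs1, hs⟩ : ∃ s : ℝ, 0 < s ∧ s ≤ 1 ∧ s * b + ε < δ := by
    refine ⟨(δ - ε) / (δ - ε + b + 1), by apply div_pos <;> linarith, ?_, ?_⟩
    · rw [div_le_one (by linarith)]; linarith
    · have h1 : (δ - ε) / (δ - ε + b + 1) * b < δ - ε := by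
        rw [div_mul_eq_mul_div, div_lt_iff₀ (by linarith)]
        nlinarith
      linarith
  have hlim : Tendsto (fun n : ℕ => (1 - s) ^ n * b + ε) atTop (𝓝 (0 * b + ε)) :=
    ((tendsto_pow_atTop_nhds_zero_of_lt_one (by linarith) (by linarith)).mul_const b).add_const ε
  obtain ⟨n, hn⟩ := (hlim.eventually_lt_const (by linarith : 0 * b + ε < δ)).exists
  exact bounded_bounds hp hS hs0.le hs1 hε hb hs n b le_rfl hn x
    ((Finsupp.mem_supported _ _).mpr fun l hl => hF l hl) hdx

end Convex

end ListChain

/-! ### Closed stars, and logarithms of maps to a torus -/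

namespace SurgeryTorsion

open ListChain

variable {ι : Type*} [Fintype ι]

/-- The closed simplex with vertex set `σ`. -/
def cell (σ : Finset ι) : Set (ι → ℝ) := {y | y ∈ stdSimplex ℝ ι ∧ ∀ v, v ∉ σ → y v = 0}

theorem convex_cell (σ : Finset ι) : Convex ℝ (cell σ) := by
  intro x hx y hy a b ha hb hab
  refine ⟨convex_stdSimplex ℝ ι hx.1 hy.1 ha hb hab, fun v hv => ?_⟩
  simp [hx.2 v hv, hy.2 v hv]

theorem isCompact_cell (σ : Finset ι) : IsCompact (cell σ) := by
  have : cell σ = stdSimplex ℝ ι ∩ ⋂ v ∈ {v | v ∉ σ}, {y : ι → ℝ | y v = 0} := by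
    ext y; simp [cell]
  rw [this]
  refine (isCompact_stdSimplex ℝ ι).inter_right (isClosed_biInter fun v _ => ?_)
  exact isClosed_eq (continuous_apply v) continuous_const

theorem cell_mono {σ τ : Finset ι} (h : σ ⊆ τ) : cell σ ⊆ cell τ :=
  fun _ hy => ⟨hy.1, fun v hv => hy.2 v fun h' => hv (h h')⟩

theorem not_mem_cell_empty (y : ι → ℝ) : y ∉ cell (∅ : Finset ι) := by
  intro h
  have h1 := h.1.2
  rw [Finset.sum_eq_zero fun v _ => h.2 v (Finset.notMem_empty v)] at h1
  exact zero_ne_one h1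

theorem single_mem_cell [DecidableEq ι] {σ : Finset ι} {v : ι} (hv : v ∈ σ) :
    (Pi.single v 1 : ι → ℝ) ∈ cell σ :=
  ⟨single_mem_stdSimplex ℝ v, fun w hw => Pi.single_eq_of_ne (fun h => hw (by rwa [h])) 1⟩

theorem cell_subset_realization {K : PreAbstractSimplicialComplex ι} {σ : Finset ι}
    (hσ : σ ∈ K.faces) : cell σ ⊆ realization K :=
  fun _ hy => mem_realization_of_support hy.1 hσ hy.2

theorem mem_cell_support {y : ι → ℝ} (hy : y ∈ stdSimplex ℝ ι) :
    y ∈ cell (Finset.univ.filter fun v => y v ≠ 0) :=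
  ⟨hy, fun v hv => by simpa using hv⟩

/-- Such a star is compact and consists of segments issuing from `v`: a map to a circle has a
logarithm on it, and this logarithm is uniformly continuous. -/
def closedStar (K : PreAbstractSimplicialComplex ι) (v : ι) : Set (ι → ℝ) :=
  ⋃ σ ∈ {σ | σ ∈ K.faces ∧ v ∈ σ}, cell σ

theorem mem_closedStar {K : PreAbstractSimplicialComplex ι} {v : ι} {y : ι → ℝ} :
    y ∈ closedStar K v ↔ ∃ σ ∈ K.faces, v ∈ σ ∧ y ∈ cell σ := by
  simp [closedStar, and_assoc]

theorem isCompact_closedStar (K : PreAbstractSimplicialComplex ι) (v : ι) :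
    IsCompact (closedStar K v) :=
  (Set.toFinite _).isCompact_biUnion fun _ _ => isCompact_cell _

theorem closedStar_subset (K : PreAbstractSimplicialComplex ι) (v : ι) :
    closedStar K v ⊆ realization K := fun _ hy => by
  obtain ⟨σ, h1, -, h3⟩ := mem_closedStar.mp hy
  exact cell_subset_realization h1 h3

theorem isCompact_realization (K : PreAbstractSimplicialComplex ι) :
    IsCompact (realization K) := by
  have : realization K = ⋃ σ ∈ K.faces, cell σ := by
    ext y
    simp only [Set.mem_iUnion, exists_prop]
    exact ⟨fun h => ⟨_, h.2, mem_cell_support h.1⟩, fun ⟨σ, h1, h2⟩ =>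
      cell_subset_realization h1 h2⟩
  rw [this]
  exact (Set.toFinite _).isCompact_biUnion fun _ _ => isCompact_cell _

variable {κ : Type*}

/-- The translation vector of a deck transformation of `(κ → ℝ) → (κ → Circle)`. -/
def per (n : κ → ℤ) : κ → ℝ := fun i => 2 * Real.pi * n i

theorem per_add (n m : κ → ℤ) : per (n + m) = per n + per m := by
  ext i; simp [per, mul_add]

theorem per_injective : Function.Injective (per : (κ → ℤ) → κ → ℝ) := by
  intro n m h
  ext i
  have := congrFun h i
  simp only [per] at this
  have h2 := mul_left_cancel₀ (by positivity : (2 * Real.pi) ≠ 0) this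
  exact_mod_cast h2

theorem exists_per {s t : κ → ℝ} (h : ∀ i, Circle.exp (s i) = Circle.exp (t i)) :
    ∃ n : κ → ℤ, s = t + per n := by
  choose n hn using fun i => Circle.exp_eq_exp.mp (h i)
  refine ⟨n, funext fun i => ?_⟩
  rw [hn i]
  simp [per]
  ring

/-- Distinct periods are at least `2 * π` apart. The bound `2` is enough for the use below, where
the difference is a sum of two terms of norm less than `1`. -/
theorem per_eq_of_norm_lt [Fintype κ] {n m : κ → ℤ} (h : ‖per n - per m‖ < 2) : n = m := by
  ext i
  have h1 := (norm_le_pi_norm (per n - per m) i).trans_lt h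
  simp only [Pi.sub_apply, per, Real.norm_eq_abs] at h1
  rw [← mul_sub, abs_mul, abs_of_pos (by positivity : 0 < 2 * Real.pi)] at h1
  have h2 : |((n i - m i : ℤ) : ℝ)| < 1 := by
    push_cast
    nlinarith [Real.pi_gt_three, abs_nonneg ((n i : ℝ) - m i)]
  have h3 : |n i - m i| < 1 := by exact_mod_cast h2
  have := Int.abs_lt_one_iff.mp h3
  omega

/-- A choice of continuous logarithms of the map `c` to a torus on all closed stars of vertices. -/
structure LogSystem (K : PreAbstractSimplicialComplex ι) (c : (ι → ℝ) → κ → Circle) where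
  g : ι → (ι → ℝ) → κ → ℝ
  cont : ∀ v, ContinuousOn (g v) (closedStar K v)
  exp_eq : ∀ v, ∀ y ∈ closedStar K v, ∀ i, Circle.exp (g v y i) = c y i

/-- The difference of the logarithms at `a` and at `b`, as a multiple of `2π`. -/
def hol [DecidableEq ι] (g : ι → (ι → ℝ) → κ → ℝ) (a b : ι) : κ → ℤ := fun i =>
  round ((g a (Pi.single b 1) i - g b (Pi.single b 1) i) / (2 * Real.pi))

@[simp] theorem hol_self [DecidableEq ι] (g : ι → (ι → ℝ) → κ → ℝ) (a : ι) : hol g a a = 0 := by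
  ext i; simp [hol]

theorem eq_of_int_valued {E : Type*} [TopologicalSpace E] {S : Set E} (hS : IsPreconnected S)
    {f : E → ℝ} (hf : ContinuousOn f S) (hi : ∀ x ∈ S, ∃ n : ℤ, f x = n) {x y : E} (hx : x ∈ S)
    (hy : y ∈ S) : f x = f y := by
  exact hS.constant_of_mapsTo Int.isClosedEmbedding_coe_real.isEmbedding.isDiscrete_range hf
    (fun x hx => (hi x hx).imp fun n hn => hn.symm) hx hy

variable {K : PreAbstractSimplicialComplex ι} {c : (ι → ℝ) → κ → Circle}

/-- Two logarithms of one map differ by a continuous function with values in `2 * π * ℤ`, which is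
constant on the connected cell. Its value is read off at the vertex `b`, where the `round` in `hol`
is exact. -/
theorem LogSystem.hol_spec [DecidableEq ι] (G : LogSystem K c) {σ : Finset ι} (hσ : σ ∈ K.faces)
    {a b : ι} (ha : a ∈ σ) (hb : b ∈ σ) {y : ι → ℝ} (hy : y ∈ cell σ) :
    G.g a y = G.g b y + per (hol G.g a b) := by
  have hsub : ∀ v ∈ σ, cell σ ⊆ closedStar K v := fun v hv y hy =>
    mem_closedStar.mpr ⟨σ, hσ, hv, hy⟩
  ext i
  have hint : ∀ y ∈ cell σ, ∃ n : ℤ, (G.g a y i - G.g b y i) / (2 * Real.pi) = n := by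
    intro y hy
    obtain ⟨n, hn⟩ := exists_per (s := G.g a y) (t := G.g b y) fun i => by
      rw [G.exp_eq a y (hsub a ha hy), G.exp_eq b y (hsub b hb hy)]
    refine ⟨n i, ?_⟩
    have := congrFun hn i
    simp only [Pi.add_apply, per] at this
    rw [this]
    field_simp
    ring
  have h1 := eq_of_int_valued (convex_cell σ).isPreconnected
    (f := fun y => (G.g a y i - G.g b y i) / (2 * Real.pi))
    ((((continuousOn_pi.mp (G.cont a) i).mono (hsub a ha)).sub
      ((continuousOn_pi.mp (G.cont b) i).mono (hsub b hb))).div_const _) hint hy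
      (single_mem_cell hb)
  obtain ⟨n, hn⟩ := hint _ (single_mem_cell hb)
  have h2 : hol G.g a b i = n := by simp only [hol]; rw [hn]; simp
  simp only [Pi.add_apply, per, h2]
  have h3 : (G.g a y i - G.g b y i) / (2 * Real.pi) = n := by rw [h1]; exact hn
  rw [div_eq_iff (by positivity)] at h3
  linarith

theorem LogSystem.exists_modulus [Fintype κ] (G : LogSystem K c) {ε : ℝ} (hε : 0 < ε) : ∃ η > 0, ∀ v,
    ∀ y ∈ closedStar K v, ∀ y' ∈ closedStar K v, dist y y' < η → dist (G.g v y) (G.g v y') < ε := by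
  have h : ∀ v, ∃ η > 0, ∀ y ∈ closedStar K v, ∀ y' ∈ closedStar K v, dist y y' < η →
      dist (G.g v y) (G.g v y') < ε := fun v => by
    have := (isCompact_closedStar K v).uniformContinuousOn_of_continuous (G.cont v)
    exact Metric.uniformContinuousOn_iff.mp this ε hε
  choose η hη h using h
  rcases isEmpty_or_nonempty ι with hι | hι
  · exact ⟨1, one_pos, fun v => (hι.false v).elim⟩
  · refine ⟨Finset.univ.inf' Finset.univ_nonempty η, ?_, fun v y hy y' hy' hd => ?_⟩
    · rw [gt_iff_lt, Finset.lt_inf'_iff]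
      exact fun v _ => hη v
    · exact h v y hy y' hy' (hd.trans_le (Finset.inf'_le _ (Finset.mem_univ v)))

end SurgeryTorsion

namespace ListChain

/-- Exactness of the complex of strictly increasing sequences in a finite set. -/
theorem exact_of_min {J : Type*} (rk : J → J → Prop) (S : Set (List J)) (a : J)
    (hcons : ∀ l ∈ S, a ∉ l → a :: l ∈ S) (hhead : ∀ l ∈ S, a ∈ l → l.head? = some a)
    (hpw : ∀ l ∈ S, l.Pairwise rk) (hirr : ¬ rk a a) : Exact S := by
  classical
  -- The cone at the minimum `a`, put equal to zero on sequences that already begin with `a`, so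
  -- that sequences stay strictly increasing.
  set f : List J → Ch J := fun l => if l.head? = some a then 0 else Finsupp.single (a :: l) 1
    with hf
  have hfcone : ∀ c : Ch J, lin f (cone a c) = 0 := fun c => by
    induction c using Finsupp.induction_linear with
    | zero => simp
    | add f g hf hg => simp only [map_add, hf, hg, add_zero]
    | single l b => simp [hf]
  have hnot : ∀ l : List J, a ∉ l → f l = Finsupp.single (a :: l) 1 := fun l hl => by
    rw [hf]
    refine if_neg fun h => hl (List.mem_of_mem_head? h)
  intro x hx hdx
  refine ⟨lin f x, lin_mem (fun l hl => ?_) hx, ?_⟩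
  · rw [hf]
    dsimp only
    split_ifs with h
    · exact zero_mem _
    · exact single_mem (hcons l hl fun h' => h (hhead l hl h')) _
  · have : d (lin f x) = x - lin f (d x) := by
      refine linearMap_congr (f := d ∘ₗ lin f) (g := LinearMap.id - lin f ∘ₗ d)
        (fun l hl => ?_) hx
      simp only [LinearMap.comp_apply, LinearMap.sub_apply, LinearMap.id_apply, lin_single,
        one_smul, d_single]
      by_cases ha : a ∈ l
      -- Of the facets of `a :: l'` only `l'` is not killed by `f`, and prepending `a` to it gives
      -- back `a :: l'`.
      · obtain ⟨l', rfl⟩ := List.head?_eq_some_iff.mp (hhead l hl ha)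
        have h' : a ∉ l' := fun h => hirr ((List.pairwise_cons.mp (hpw _ hl)).1 a h)
        have h0 : f (a :: l') = 0 := if_pos (by simp)
        simp [h0, bdList, hfcone, hnot l' h']
      · rw [hnot l ha, d_single, one_smul, bdList]
        congr 1
        refine linearMap_congr (f := cone a) (g := lin f) (fun l' hl' => ?_) (bdList_mem l)
        simp [hnot l' fun h => ha (hl'.1.subset h)]
    rw [this, hdx, map_zero, sub_zero]

end ListChain

/-! ### The covering complex and its comparison with small sequences -/

namespace SurgeryTorsion

open ListChain

variable {ι : Type*} [Fintype ι] [LinearOrder ι] {κ : Type*}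
variable {K : PreAbstractSimplicialComplex ι} {c : (ι → ℝ) → κ → Circle}

def verts (l : List (ι × (κ → ℤ))) : Finset ι := (l.map Prod.fst).toFinset

/-- The sequences of vertices of the simplices of the covering complex. -/
def LogSystem.good (G : LogSystem K c) : Set (List (ι × (κ → ℤ))) :=
  {l | l.Pairwise (fun p q => p.1 < q.1) ∧ (l ≠ [] → verts l ∈ K.faces) ∧
    ∀ p ∈ l, ∀ q ∈ l, q.2 = p.2 + hol G.g p.1 q.1}

theorem mem_verts {l : List (ι × (κ → ℤ))} {v : ι} : v ∈ verts l ↔ ∃ p ∈ l, p.1 = v := by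
  simp [verts]

theorem verts_mono {l l' : List (ι × (κ → ℤ))} (h : l' ⊆ l) : verts l' ⊆ verts l := fun v hv => by
  obtain ⟨p, hp, rfl⟩ := mem_verts.mp hv
  exact mem_verts.mpr ⟨p, h hp, rfl⟩

theorem verts_nonempty {l : List (ι × (κ → ℤ))} (h : l ≠ []) : (verts l).Nonempty := by
  obtain ⟨a, l, rfl⟩ := List.exists_cons_of_ne_nil h
  exact ⟨a.1, mem_verts.mpr ⟨a, by simp, rfl⟩⟩

theorem LogSystem.good_sublist (G : LogSystem K c) {l l' : List (ι × (κ → ℤ))}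
    (h : l'.Sublist l) (hl : l ∈ G.good) : l' ∈ G.good := by
  refine ⟨hl.1.sublist h, fun hne => ?_, fun p hp q hq => hl.2.2 p (h.subset hp) q (h.subset hq)⟩
  refine mem_faces_of_subset (hl.2.1 ?_) (verts_mono h.subset) (verts_nonempty hne)
  rintro rfl
  exact hne (List.sublist_nil.mp h)

/-- The simplices of the covering complex with vertices in a finite set of vertices of one simplex
form an exact complex. -/
theorem LogSystem.exact_good (G : LogSystem K c) (V : Finset (ι × (κ → ℤ))) (hV : V.Nonempty)
    (hface : V.image Prod.fst ∈ K.faces) (hcomp : ∀ p ∈ V, ∀ q ∈ V, q.2 = p.2 + hol G.g p.1 q.1) :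
    Exact {l | l ∈ G.good ∧ ∀ p ∈ l, p ∈ V} := by
  obtain ⟨a, haV, hmin⟩ := V.exists_min_image Prod.fst hV
  -- Labels are determined by the vertices once one of them is known, so the least vertex occurs
  -- with one label only.
  have hinj : ∀ p ∈ V, p.1 ≤ a.1 → p = a := fun p hp h => by
    have h1 := le_antisymm h (hmin p hp)
    refine Prod.ext h1 ?_
    have := hcomp a haV p hp
    rwa [h1, hol_self, add_zero] at this
  refine exact_of_min (fun p q => p.1 < q.1) _ a ?_ ?_ (fun l hl => hl.1.1) (lt_irrefl _)
  · rintro l ⟨hl, hlV⟩ ha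
    have hall : ∀ p ∈ a :: l, p ∈ V := fun p hp => by
      rcases List.mem_cons.mp hp with rfl | hp
      · exact haV
      · exact hlV p hp
    refine ⟨⟨List.pairwise_cons.mpr ⟨fun p hp => ?_, hl.1⟩, fun _ => ?_,
      fun p hp q hq => hcomp p (hall p hp) q (hall q hq)⟩, hall⟩
    · by_contra h
      exact ha (hinj p (hlV p hp) (not_lt.mp h) ▸ hp)
    · refine mem_faces_of_subset hface (fun v hv => ?_) (verts_nonempty (by simp))
      obtain ⟨p, hp, rfl⟩ := mem_verts.mp hv
      exact Finset.mem_image_of_mem _ (hall p hp)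
  · rintro l ⟨hl, hlV⟩ ha
    cases l with
    | nil => simp at ha
    | cons b l =>
      rcases List.mem_cons.mp ha with rfl | h
      · rfl
      · have := (List.pairwise_cons.mp hl.1).1 a h
        rw [hinj b (hlV b (by simp)) this.le]
        rfl

/-- The covering space of `|K|` on which `c` has a logarithm. -/
def coverSet (K : PreAbstractSimplicialComplex ι) (c : (ι → ℝ) → κ → Circle) :
    Set ((ι → ℝ) × (κ → ℝ)) :=
  {x | x.1 ∈ realization K ∧ ∀ i, Circle.exp (x.2 i) = c x.1 i}

/-- The closed simplex of the covering space with the vertices `l`. -/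
def LogSystem.cover_cell (G : LogSystem K c) (l : List (ι × (κ → ℤ))) :
    Set ((ι → ℝ) × (κ → ℝ)) :=
  {x | x.1 ∈ cell (verts l) ∧ ∀ p ∈ l, x.2 = G.g p.1 x.1 + per p.2}

/-- Compatible labels make all vertices of `l` prescribe the same lift of a point, so for nonempty
`l` the cell of the covering space is a section over the convex cell below it. -/
theorem LogSystem.lift_mem_cover_cell (G : LogSystem K c) {l : List (ι × (κ → ℤ))}
    (hl : l ∈ G.good) {p : ι × (κ → ℤ)} (hp : p ∈ l) {y : ι → ℝ} (hy : y ∈ cell (verts l)) :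
    (y, G.g p.1 y + per p.2) ∈ G.cover_cell l := by
  refine ⟨hy, fun q hq => ?_⟩
  have hne : l ≠ [] := by rintro rfl; simp at hp
  rw [G.hol_spec (hl.2.1 hne) (mem_verts.mpr ⟨p, hp, rfl⟩) (mem_verts.mpr ⟨q, hq, rfl⟩) hy,
    hl.2.2 p hp q hq, per_add]
  ring

theorem LogSystem.cover_cell_mono (G : LogSystem K c) {l l' : List (ι × (κ → ℤ))}
    (hl : l ∈ G.good) (h : l' ⊆ l) : G.cover_cell l' ⊆ G.cover_cell l := by
  rintro ⟨y, s⟩ ⟨h1, h2⟩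
  rcases l' with _ | ⟨p, l'⟩
  · exact (not_mem_cell_empty y h1).elim
  · have h3 : s = G.g p.1 y + per p.2 := h2 p (by simp)
    rw [h3]
    exact G.lift_mem_cover_cell hl (h (by simp)) (cell_mono (verts_mono h) h1)

theorem LogSystem.cover_cell_subset (G : LogSystem K c) {l : List (ι × (κ → ℤ))}
    (hl : l ∈ G.good) : G.cover_cell l ⊆ coverSet K c := by
  rintro ⟨y, s⟩ ⟨h1, h2⟩
  rcases l with _ | ⟨p, l⟩
  · exact (not_mem_cell_empty y h1).elim
  · have hf := hl.2.1 (by simp)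
    refine ⟨cell_subset_realization hf h1, fun i => ?_⟩
    have h3 : s = G.g p.1 y + per p.2 := h2 p (by simp)
    rw [← G.exp_eq p.1 y (mem_closedStar.mpr ⟨_, hf, mem_verts.mpr ⟨p, by simp, rfl⟩, h1⟩) i]
    simp only [h3, Pi.add_apply, per, Circle.exp_add]
    rw [mul_comm (2 * Real.pi), Circle.exp_int_mul_two_pi, mul_one]

/-- Existence of a chain map to small sequences of points in the cells. -/
theorem LogSystem.exists_toSmall [Fintype κ] (G : LogSystem K c) {η : ℝ} (hη : 0 < η) :
    ∃ ψ : List (ι × (κ → ℤ)) → Ch ((ι → ℝ) × (κ → ℝ)), ψ [] = Finsupp.single [] 1 ∧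
      (∀ l ∈ G.good, ψ l ∈ Sup {l' | (∀ x ∈ l', x ∈ G.cover_cell l) ∧
        ∀ x ∈ l', ∀ y ∈ l', dist x.1 y.1 < η}) ∧
      ∀ l ∈ G.good, d (ψ l) = lin ψ (bdList l) := by
  obtain ⟨ψ, h0, h1, h2⟩ := exists_carried (B := (ι → ℝ) × (κ → ℝ)) (· ∈ G.good)
    (fun l l' h hl => G.good_sublist h hl)
    (fun l => {l' | (∀ x ∈ l', x ∈ G.cover_cell l) ∧ ∀ x ∈ l', ∀ y ∈ l', dist x.1 y.1 < η})
    (fun l l' hl h l'' hl'' => ⟨fun x hx => G.cover_cell_mono hl h.subset (hl''.1 x hx), hl''.2⟩)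
    (fun l hne hl => by
      obtain ⟨p, hp⟩ := List.exists_mem_of_ne_nil l hne
      intro x hx hdx
      have hpv : p.1 ∈ verts l := mem_verts.mpr ⟨p, hp, rfl⟩
      -- Project to the convex cell, fill there at the scale `η`, and lift back with the logarithm
      -- at `p`.
      obtain ⟨w, hw, hdw⟩ := exact_smallIn (single_mem_cell hpv)
        ((convex_cell (verts l)).starConvex (single_mem_cell hpv)) hη (mapL Prod.fst x)
        (mapL_mem (fun l' hl' => by
          refine ⟨fun y hy => ?_, fun y hy y' hy' => ?_⟩
          · obtain ⟨z, hz, rfl⟩ := List.mem_map.mp hy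
            exact (hl'.1 z hz).1
          · obtain ⟨z, hz, rfl⟩ := List.mem_map.mp hy
            obtain ⟨z', hz', rfl⟩ := List.mem_map.mp hy'
            exact hl'.2 z hz z' hz') hx)
        (by rw [← mapL_d, hdx, map_zero])
      refine ⟨mapL (fun y => (y, G.g p.1 y + per p.2)) w, mapL_mem (fun l' hl' => ?_) hw, ?_⟩
      · refine ⟨fun y hy => ?_, fun y hy y' hy' => ?_⟩
        · obtain ⟨z, hz, rfl⟩ := List.mem_map.mp hy
          exact G.lift_mem_cover_cell hl hp (hl'.1 z hz)
        · obtain ⟨z, hz, rfl⟩ := List.mem_map.mp hy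
          obtain ⟨z', hz', rfl⟩ := List.mem_map.mp hy'
          exact hl'.2 z hz z' hz'
      · rw [← mapL_d, hdw]
        refine linearMap_congr (f := mapL (fun y => (y, G.g p.1 y + per p.2)) ∘ₗ mapL Prod.fst)
          (g := LinearMap.id) (fun l' hl' => ?_) hx
        simp only [LinearMap.comp_apply, mapL_single, List.map_map, LinearMap.id_apply]
        congr 1
        refine (List.map_congr_left fun z hz => ?_).trans (List.map_id _)
        exact Prod.ext rfl ((hl'.1 z hz).2 p hp).symm)
    0 (fun l _ _ => zero_mem _) (-1) (fun l _ _ => by simp [lin]) (Finsupp.single [] 1)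
    (single_mem (by simp) _) (by simp [d_single, bdList])
  exact ⟨ψ, h0, h1, fun l hl => by simp [h2 l hl]⟩

/-- A vertex of the simplex of the covering space which contains a given point. -/
theorem LogSystem.exists_vertex (G : LogSystem K c) {x : (ι → ℝ) × (κ → ℝ)}
    (hx : x ∈ coverSet K c) : ∃ p : ι × (κ → ℤ), 1 ≤ Fintype.card ι * x.1 p.1 ∧
      x.2 = G.g p.1 x.1 + per p.2 := by
  obtain ⟨hsum, hface⟩ := hx.1
  have hne : (Finset.univ : Finset ι).Nonempty := by
    by_contra h
    have h1 := hsum.2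
    rw [Finset.not_nonempty_iff_eq_empty.mp h] at h1
    simp at h1
  -- The largest barycentric coordinate is at least `1 / card ι`. This quantitative form guarantees
  -- that the vertex also belongs to the supports of all nearby points.
  obtain ⟨v, -, hv⟩ := Finset.exists_max_image Finset.univ x.1 hne
  have h1 : 1 ≤ Fintype.card ι * x.1 v := by
    rw [← hsum.2]
    refine (Finset.sum_le_card_nsmul _ _ (x.1 v) fun w hw => hv w hw).trans ?_
    simp
  have hv0 : x.1 v ≠ 0 := by
    intro h; rw [h] at h1; norm_num at h1
  obtain ⟨n, hn⟩ := exists_per (s := x.2) (t := G.g v x.1) fun i => by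
    rw [hx.2 i, G.exp_eq v x.1 (mem_closedStar.mpr ⟨_, hface, by simpa using hv0,
      mem_cell_support hsum⟩)]
  exact ⟨(v, n), h1, hn⟩

/-- If the covering space of `|K|` is dominated by a convex set, then the chain complex of the
covering complex is exact. -/
theorem LogSystem.exact [Fintype κ] {E : Type*} [NormedAddCommGroup E] [NormedSpace ℝ E] (G : LogSystem K c)
    (X : Set E) (hX : Convex ℝ X) (hXne : X.Nonempty)
    (P : E → (ι → ℝ) × (κ → ℝ)) (hP : UniformContinuousOn P X) (hPX : Set.MapsTo P X (coverSet K c))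
    (Q : (ι → ℝ) × (κ → ℝ) → E) (hQ : UniformContinuousOn Q (coverSet K c))
    (hQX : Set.MapsTo Q (coverSet K c) X) (hPQ : ∀ x ∈ coverSet K c, P (Q x) = x) :
    Exact G.good := by
  classical
  have hvx : ∀ x : (ι → ℝ) × (κ → ℝ), ∃ p : ι × (κ → ℤ), x ∈ coverSet K c →
      1 ≤ Fintype.card ι * x.1 p.1 ∧ x.2 = G.g p.1 x.1 + per p.2 := fun x => by
    by_cases hx : x ∈ coverSet K c
    · exact (G.exists_vertex hx).imp fun p h _ => h
    · obtain ⟨x₀, hx₀⟩ := hXne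
      exact ⟨(G.exists_vertex (hPX hx₀)).choose, fun h => (hx h).elim⟩
  choose vt hvt using hvx
  have hcard : 0 < (Fintype.card ι : ℝ) := by
    obtain ⟨x₀, hx₀⟩ := hXne
    have := (hvt _ (hPX hx₀)).1
    by_contra h
    have h0 : (Fintype.card ι : ℝ) = 0 := le_antisymm (not_lt.mp h) (Nat.cast_nonneg _)
    rw [h0] at this
    norm_num at this
  obtain ⟨η₁, hη₁, hmod₁⟩ := G.exists_modulus one_pos
  -- the scale at which vertices of nearby points span a simplex
  obtain ⟨δ, hδ, hPδ⟩ := Metric.uniformContinuousOn_iff.mp hP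
    (min (1 / (Fintype.card ι : ℝ)) (min η₁ 1)) (by positivity)
  have hnear : ∀ x ∈ X, ∀ x' ∈ X, dist x x' < δ →
      (P x).1 (vt (P x')).1 ≠ 0 ∧ (vt (P x')).2 = (vt (P x)).2 + hol G.g (vt (P x)).1
        (vt (P x')).1 := by
    -- A coordinate that is at least `1 / card ι` at `P x'` cannot vanish at a point closer than `1
    -- / card ι`.
    have hpos : ∀ x ∈ X, ∀ x' ∈ X, dist x x' < δ → (P x).1 (vt (P x')).1 ≠ 0 := by
      intro x hx x' hx' hd h0
      have h1 := (hPδ x hx x' hx' hd).trans_le (min_le_left _ _)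
      have h2 := (hvt _ (hPX hx')).1
      have h3 : dist ((P x).1 (vt (P x')).1) ((P x').1 (vt (P x')).1) < 1 / Fintype.card ι :=
        (dist_le_pi_dist _ _ _).trans_lt ((le_max_left _ _).trans_lt h1)
      rw [h0, Real.dist_eq, zero_sub, abs_neg] at h3
      have h4 := (le_abs_self _).trans_lt h3
      rw [lt_div_iff₀ hcard] at h4
      linarith
    intro x hx x' hx' hd
    refine ⟨hpos x hx x' hx' hd, ?_⟩
    obtain ⟨⟨hs, hf⟩, -⟩ := hPX hx
    obtain ⟨⟨hs', hf'⟩, -⟩ := hPX hx'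
    have hself : ∀ z ∈ X, (P z).1 (vt (P z)).1 ≠ 0 := fun z hz => hpos z hz z hz (by simpa using hδ)
    have e1 := (hvt _ (hPX hx)).2
    have e2 := (hvt _ (hPX hx')).2
    have e3 := G.hol_spec hf (a := (vt (P x)).1) (b := (vt (P x')).1)
      (by simpa using hself x hx) (by simpa using hpos x hx x' hx' hd) (mem_cell_support hs)
    have hlt := hPδ x hx x' hx' hd
    have e4 : dist (P x).2 (P x').2 < 1 := (le_max_right _ _).trans_lt
      (hlt.trans_le ((min_le_right _ _).trans (min_le_right _ _)))
    have e5 : dist (P x).1 (P x').1 < η₁ := (le_max_left _ _).trans_lt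
      (hlt.trans_le ((min_le_right _ _).trans (min_le_left _ _)))
    have e6 := hmod₁ (vt (P x')).1 (P x).1
      (mem_closedStar.mpr ⟨_, hf, by simpa using hpos x hx x' hx' hd, mem_cell_support hs⟩) (P x').1
      (mem_closedStar.mpr ⟨_, hf', by simpa using hself x' hx', mem_cell_support hs'⟩) e5
    symm
    -- The discrepancy of the labels is the difference of two displacements, one in the torus
    -- coordinate and one of a logarithm, each of norm less than `1`.
    apply per_eq_of_norm_lt
    rw [per_add]
    have e7 : per (vt (P x)).2 + per (hol G.g (vt (P x)).1 (vt (P x')).1) - per (vt (P x')).2 =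
        ((P x).2 - (P x').2) - (G.g (vt (P x')).1 (P x).1 - G.g (vt (P x')).1 (P x').1) := by
      rw [e1, e3]
      nth_rewrite 1 [e2]
      abel
    rw [e7]
    rw [dist_eq_norm] at e4 e6
    linarith [norm_sub_le ((P x).2 - (P x').2)
      (G.g (vt (P x')).1 (P x).1 - G.g (vt (P x')).1 (P x').1)]
  -- the scale at which simplices are subdivided
  obtain ⟨δ₁, hδ₁, hQδ⟩ := Metric.uniformContinuousOn_iff.mp hQ δ hδ
  obtain ⟨η₂, hη₂, hmod₂⟩ := G.exists_modulus hδ₁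
  obtain ⟨ψ, hψ0, hψ1, hψ2⟩ := G.exists_toSmall (lt_min hη₂ hδ₁)
  have hψX : ∀ l ∈ G.good, mapL Q (ψ l) ∈ Sup {l' | l' ∈ smallIn X δ ∧
      ∀ y ∈ l', ∃ x ∈ G.cover_cell l, y = Q x} := by
    intro l hl
    refine mapL_mem (fun l' hl' => ?_) (hψ1 l hl)
    refine ⟨⟨fun y hy => ?_, fun y hy y' hy' => ?_⟩, fun y hy => ?_⟩
    · obtain ⟨z, hz, rfl⟩ := List.mem_map.mp hy
      exact hQX (G.cover_cell_subset hl (hl'.1 z hz))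
    · obtain ⟨z, hz, rfl⟩ := List.mem_map.mp hy
      obtain ⟨z', hz', rfl⟩ := List.mem_map.mp hy'
      have hc := hl'.1 z hz
      have hc' := hl'.1 z' hz'
      have hd := hl'.2 z hz z' hz'
      refine hQδ z (G.cover_cell_subset hl hc) z' (G.cover_cell_subset hl hc') ?_
      rcases l with _ | ⟨p, l⟩
      · exact (not_mem_cell_empty _ hc.1).elim
      · have hf := hl.2.1 (by simp)
        have hp : p.1 ∈ verts (p :: l) := mem_verts.mpr ⟨p, by simp, rfl⟩
        refine max_lt (hd.trans_le (min_le_right _ _)) ?_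
        rw [hc.2 p (by simp), hc'.2 p (by simp), dist_add_right]
        exact hmod₂ p.1 _ (mem_closedStar.mpr ⟨_, hf, hp, hc.1⟩) _
          (mem_closedStar.mpr ⟨_, hf, hp, hc'.1⟩) (hd.trans_le (min_le_left _ _))
    · obtain ⟨z, hz, rfl⟩ := List.mem_map.mp hy
      exact ⟨z, hl'.1 z hz, rfl⟩
  -- the chain map from small sequences
  obtain ⟨φ, hφ0, hφ1, hφ2⟩ := exists_carried (B := ι × (κ → ℤ)) (· ∈ smallIn X δ)
    (fun l l' h hl => ⟨fun x hx => hl.1 x (h.subset hx),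
      fun x hx y hy => hl.2 x (h.subset hx) y (h.subset hy)⟩)
    (fun l => {l' | l' ∈ G.good ∧ ∀ p ∈ l', p ∈ l.toFinset.image (fun x => vt (P x))})
    (fun l l' hl h l'' hl'' => ⟨hl''.1, fun p hp => by
      have := hl''.2 p hp
      simp only [Finset.mem_image, List.mem_toFinset] at this ⊢
      obtain ⟨x, hx, h1⟩ := this
      exact ⟨x, h.subset hx, h1⟩⟩)
    (fun l hne hl => by
      obtain ⟨x, hx⟩ := List.exists_mem_of_ne_nil l hne
      have hne' : (l.toFinset.image fun x => vt (P x)).Nonempty :=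
        ⟨_, Finset.mem_image_of_mem _ (List.mem_toFinset.mpr hx)⟩
      refine G.exact_good _ hne' ?_ ?_
      · refine mem_faces_of_subset (hPX (hl.1 x hx)).1.2 (fun v hv => ?_) (hne'.image _)
        simp only [Finset.mem_image, List.mem_toFinset] at hv
        obtain ⟨-, ⟨x', hx', rfl⟩, rfl⟩ := hv
        simpa using (hnear x (hl.1 x hx) x' (hl.1 x' hx') (hl.2 x hx x' hx')).1
      · intro p hp q hq
        simp only [Finset.mem_image, List.mem_toFinset] at hp hq
        obtain ⟨x, hx, rfl⟩ := hp
        obtain ⟨x', hx', rfl⟩ := hq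
        exact (hnear x (hl.1 x hx) x' (hl.1 x' hx') (hl.2 x hx x' hx')).2)
    0 (fun l _ _ => zero_mem _) (-1) (fun l _ _ => by simp [lin]) (Finsupp.single [] 1)
    (single_mem (by simp [LogSystem.good]) _) (by simp [d_single, bdList])
  have hdφ : ∀ x ∈ Sup (smallIn X δ), d (lin φ x) = lin φ (d x) := fun x hx => by
    refine linearMap_congr (f := d ∘ₗ lin φ) (g := lin φ ∘ₗ d) (fun l hl => ?_) hx
    simp [hφ2 l hl, d_single]
  have hdψ : ∀ x ∈ Sup G.good, d (lin ψ x) = lin ψ (d x) := fun x hx => by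
    refine linearMap_congr (f := d ∘ₗ lin ψ) (g := lin ψ ∘ₗ d) (fun l hl => ?_) hx
    simp [hψ2 l hl, d_single]
  have hψX' : ∀ x ∈ Sup G.good, mapL Q (lin ψ x) ∈ Sup (smallIn X δ) := fun x hx => by
    refine sup_induction (p := fun x => mapL Q (lin ψ x) ∈ Sup (smallIn X δ)) (by simp)
      (fun a b ha hb => ?_) (fun l hl a => ?_) hx
    · rw [map_add, map_add]; exact add_mem ha hb
    · rw [lin_single, map_smul]
      exact Submodule.smul_mem _ _ (Finsupp.supported_mono (fun _ h => h.1) (hψX l hl))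
  -- The difference of the round trip through small sequences and the identity; it is null-homotopic
  -- because both are carried by the faces of `l`.
  set cc : List (ι × (κ → ℤ)) → Ch (ι × (κ → ℤ)) := fun l =>
    lin φ (mapL Q (ψ l)) - Finsupp.single l 1 with hcc
  have hlcc : ∀ x, lin cc x = lin φ (mapL Q (lin ψ x)) - x := fun x => by
    induction x using Finsupp.induction_linear with
    | zero => simp
    | add f g hf hg => simp only [map_add, hf, hg]; abel
    | single l a => simp [hcc, smul_sub]
  obtain ⟨h, hh0, hh1, hh2⟩ := exists_carried (B := ι × (κ → ℤ)) (· ∈ G.good)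
    (fun l l' h hl => G.good_sublist h hl) (fun l => {l' | l' ∈ G.good ∧ ∀ p ∈ l', p ∈ l.toFinset})
    (fun l l' hl h l'' hl'' => ⟨hl''.1, fun p hp => by
      have := hl''.2 p hp
      rw [List.mem_toFinset] at this ⊢
      exact h.subset this⟩)
    (fun l hne hl => by
      refine G.exact_good l.toFinset (List.toFinset_nonempty_iff l |>.mpr hne) ?_ ?_
      · convert hl.2.1 hne using 1
        ext v
        simp [verts]
      · intro p hp q hq
        exact hl.2.2 p (List.mem_toFinset.mp hp) q (List.mem_toFinset.mp hq))
    cc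
    (fun l hl _ => by
      refine sub_mem (lin_mem (fun l' hl' => ?_) (hψX l hl)) (single_mem (And.intro hl (by simp)) _)
      refine Finsupp.supported_mono (fun l'' hl'' => And.intro hl''.1 fun p hp => ?_) (hφ1 l' hl'.1)
      have := hl''.2 p hp
      simp only [Finset.mem_image, List.mem_toFinset] at this ⊢
      obtain ⟨y, hy, rfl⟩ := this
      obtain ⟨x, hx, rfl⟩ := hl'.2 y hy
      -- As `P (Q x) = x` lies in the covering cell of `l`, the vertex attached to it is a vertex of
      -- `l`, with the same label.
      have hxc := G.cover_cell_subset hl hx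
      rw [hPQ x hxc]
      obtain ⟨h1, h2⟩ := hvt x hxc
      have h3 : (vt x).1 ∈ verts l := by
        by_contra h
        rw [hx.1.2 _ h] at h1
        norm_num at h1
      obtain ⟨q, hq, hq1⟩ := mem_verts.mp h3
      have h4 := hx.2 q hq
      rw [h2, hq1] at h4
      have h5 : (vt x).2 = q.2 := per_injective (add_left_cancel h4)
      rwa [show vt x = q from Prod.ext hq1.symm h5])
    1
    (fun l hl _ => by
      rw [one_smul, hlcc, hcc]
      simp only [map_sub, d_single, one_smul]
      congr 1
      rw [hdφ _ (Finsupp.supported_mono (fun _ h => h.1) (hψX l hl)), ← mapL_d, hψ2 l hl])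
    0 (zero_mem _) (by simp [hcc, hψ0, hφ0])
  intro z hz hdz
  obtain ⟨x₀, hx₀⟩ := hXne
  obtain ⟨w, hw, hdw⟩ := exact_smallIn hx₀ (hX.starConvex hx₀) hδ (mapL Q (lin ψ z)) (hψX' z hz)
    (by rw [← mapL_d, hdψ z hz, hdz, map_zero, map_zero])
  -- The image of `z` among the small sequences bounds `w`. Mapping `w` back fills the round trip of
  -- `z`, and the homotopy corrects this to `z`.
  refine ⟨lin φ w - lin h z, sub_mem (lin_mem (fun l hl => ?_) hw) (lin_mem (fun l hl => ?_) hz), ?_⟩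
  · exact Finsupp.supported_mono (fun _ h => h.1) (hφ1 l hl)
  · exact Finsupp.supported_mono (fun _ h => h.1) (hh1 l hl)
  · have e1 : d (lin h z) = lin cc z - lin h (d z) := by
      refine linearMap_congr (f := d ∘ₗ lin h) (g := lin cc - lin h ∘ₗ d) (fun l hl => ?_) hz
      simp [hh2 l hl, d_single]
    rw [map_sub, hdφ w hw, hdw, e1, hdz, hlcc]
    simp

end SurgeryTorsion

/-! ### Chains with transported coefficients, and the covering complex in these terms -/

namespace SurgeryTorsion

open ListChain

section Boundary

variable {ι : Type*} [LinearOrder ι]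

/-- The `i`-dimensional simplices in a set of simplices. -/
abbrev RFace (A : Set (Finset ι)) (i : ℕ) : Type _ := {s : Finset ι // s ∈ A ∧ s.card = i + 1}

theorem RFace.nonempty {A : Set (Finset ι)} {i : ℕ} (τ : RFace A i) : τ.1.Nonempty := by
  rw [← Finset.card_pos, τ.2.2]; omega

/-- The first vertex. -/
def RFace.first {A : Set (Finset ι)} {i : ℕ} (τ : RFace A i) : ι := τ.1.min' τ.nonempty

theorem RFace.first_mem {A : Set (Finset ι)} {i : ℕ} (τ : RFace A i) : τ.first ∈ τ.1 :=
  Finset.min'_mem _ _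

def RFace.cons {A : Set (Finset ι)} {i : ℕ} (τ : RFace A i) (v : ι)
    (h : v ∉ τ.1 ∧ insert v τ.1 ∈ A) : RFace A (i + 1) :=
  ⟨insert v τ.1, h.2, by rw [Finset.card_insert_of_notMem h.1, τ.2.2]⟩

def RFace.erase {A : Set (Finset ι)} {i : ℕ} (σ : RFace A (i + 1)) (v : ι)
    (h : v ∈ σ.1 ∧ σ.1.erase v ∈ A) : RFace A i :=
  ⟨σ.1.erase v, h.2, by rw [Finset.card_erase_of_mem h.1, σ.2.2]; rfl⟩

variable {k W : Type*} [CommRing k] [AddCommGroup W] [Module k W]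

open Classical in
/-- The boundary map of the chains on a set of simplices with coefficients transported along the
edges by `U`. -/
def bd [Fintype ι] (A : Set (Finset ι)) (U : ι → ι → W →ₗ[k] W) (i : ℕ) :
    (RFace A (i + 1) → W) →ₗ[k] (RFace A i → W) :=
  LinearMap.pi fun τ => ∑ v : ι,
    if h : v ∉ τ.1 ∧ insert v τ.1 ∈ A then
      (-1 : k) ^ (τ.1.filter (· < v)).card •
        (U (τ.cons v h).first τ.first ∘ₗ LinearMap.proj (τ.cons v h))
    else 0

variable [Fintype ι]

open Classical in
theorem bd_apply (A : Set (Finset ι)) (U : ι → ι → W →ₗ[k] W) (i : ℕ) (w : RFace A (i + 1) → W)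
    (τ : RFace A i) : bd A U i w τ = ∑ v : ι, if h : v ∉ τ.1 ∧ insert v τ.1 ∈ A then
      (-1 : k) ^ (τ.1.filter (· < v)).card • U (τ.cons v h).first τ.first (w (τ.cons v h))
    else 0 := by
  simp only [bd, LinearMap.pi_apply, LinearMap.sum_apply]
  refine Finset.sum_congr rfl fun v _ => ?_
  split_ifs <;> simp

-- The transposed form of `bd_apply`, organized by deleted vertices, is the one that matches
-- `bdList`. The signs agree because `v` is not less than itself.
open Classical in
theorem bd_single (A : Set (Finset ι)) (U : ι → ι → W →ₗ[k] W) (i : ℕ) (σ : RFace A (i + 1))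
    (x : W) : bd A U i (Pi.single σ x) = ∑ v : ι, if h : v ∈ σ.1 ∧ σ.1.erase v ∈ A then
      (-1 : k) ^ (σ.1.filter (· < v)).card •
        Pi.single (σ.erase v h) (U σ.first (σ.erase v h).first x) else 0 := by
  ext τ
  rw [bd_apply, Finset.sum_apply]
  refine Finset.sum_congr rfl fun v _ => ?_
  by_cases h : v ∉ τ.1 ∧ insert v τ.1 = σ.1
  · have h1 : insert v τ.1 ∈ A := h.2 ▸ σ.2.1
    have h2 : v ∈ σ.1 := h.2 ▸ Finset.mem_insert_self _ _
    have h3 : σ.1.erase v = τ.1 := by rw [← h.2, Finset.erase_insert h.1]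
    have e1 : τ.cons v ⟨h.1, h1⟩ = σ := Subtype.ext h.2
    have e2 : σ.erase v ⟨h2, h3 ▸ τ.2.1⟩ = τ := Subtype.ext h3
    rw [dif_pos ⟨h.1, h1⟩, dif_pos ⟨h2, h3 ▸ τ.2.1⟩, e1, e2]
    simp only [Pi.smul_apply, Pi.single_eq_same]
    congr 3
    rw [← h.2, Finset.filter_insert, if_neg (lt_irrefl v)]
  · have e1 : (if h : v ∉ τ.1 ∧ insert v τ.1 ∈ A then
        (-1 : k) ^ (τ.1.filter (· < v)).card • U (τ.cons v h).first τ.first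
          ((Pi.single σ x : RFace A (i + 1) → W) (τ.cons v h)) else 0) = 0 := by
      split_ifs with h1
      · rw [Pi.single_eq_of_ne fun h2 => h ⟨h1.1, congrArg Subtype.val h2⟩, map_zero, smul_zero]
      · rfl
    rw [e1]
    split_ifs with h1
    · rw [Pi.smul_apply, Pi.single_eq_of_ne, smul_zero]
      rintro rfl
      exact h ⟨Finset.notMem_erase v σ.1, Finset.insert_erase h1.1⟩
    · rfl

end Boundary

section Bridge

variable {ι : Type*} [LinearOrder ι]

/-- Sorting puts a new least element in front, so the other terms become cones and their sign
exponents grow by one, as in the recursion for `bdList`. -/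
theorem bdList_sort {J : Type*} (f : ι → J) (σ : Finset ι) :
    bdList ((σ.sort (· ≤ ·)).map f) = ∑ v ∈ σ, (-1 : ℤ) ^ (σ.filter (· < v)).card •
      Finsupp.single (((σ.erase v).sort (· ≤ ·)).map f) 1 := by
  induction σ using Finset.induction_on_min with
  | empty => simp [bdList]
  | insert a t ha ih =>
    have hat : a ∉ t := fun h => lt_irrefl _ (ha a h)
    have hsort : ∀ s ⊆ t, (insert a s).sort (· ≤ ·) = a :: s.sort (· ≤ ·) := fun s hs =>
      Finset.sort_insert (· ≤ ·) (fun b hb => (ha b (hs hb)).le) fun h => hat (hs h)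
    rw [hsort t subset_rfl, List.map_cons, bdList, ih, Finset.sum_insert hat,
      Finset.erase_insert hat]
    have h0 : (insert a t).filter (· < a) = ∅ := by
      refine Finset.filter_eq_empty_iff.mpr fun b hb => ?_
      rcases Finset.mem_insert.mp hb with rfl | hb
      · exact lt_irrefl _
      · exact (ha b hb).not_gt
    rw [h0, Finset.card_empty, pow_zero, one_smul, sub_eq_add_neg, map_sum, ← Finset.sum_neg_distrib]
    congr 1
    refine Finset.sum_congr rfl fun v hv => ?_
    have h1 : (insert a t).erase v = insert a (t.erase v) :=
      Finset.erase_insert_of_ne (ha v hv).ne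
    have h2 : (insert a t).filter (· < v) = insert a (t.filter (· < v)) := by
      rw [Finset.filter_insert, if_pos (ha v hv)]
    rw [h1, h2, hsort _ (Finset.erase_subset _ _), Finset.card_insert_of_notMem
      (fun h => hat (Finset.mem_filter.mp h).1), pow_succ]
    simp

variable [Fintype ι] {κ : Type*}
variable {K : PreAbstractSimplicialComplex ι} {c : (ι → ℝ) → κ → Circle}

/-- The differences of the three logarithms at one point telescope: holonomy is a cocycle on every
simplex. -/
theorem LogSystem.hol_add (G : LogSystem K c) {σ : Finset ι} (hσ : σ ∈ K.faces)
    {a b e : ι} (ha : a ∈ σ) (hb : b ∈ σ) (he : e ∈ σ) :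
    hol G.g a b + hol G.g b e = hol G.g a e := by
  have hy := single_mem_cell ha
  have h1 := G.hol_spec hσ ha hb hy
  have h2 := G.hol_spec hσ hb he hy
  have h3 := G.hol_spec hσ ha he hy
  apply per_injective
  rw [per_add]
  rw [h1, h2, add_assoc] at h3
  rw [add_comm]
  exact add_left_cancel h3

/-- The vertices of the lift of `σ` with the label `n` at the first vertex. -/
def LogSystem.liftList (G : LogSystem K c) {i : ℕ} (σ : RFace K.faces i) (n : κ → ℤ) :
    List (ι × (κ → ℤ)) :=
  (σ.1.sort (· ≤ ·)).map fun v => (v, n + hol G.g σ.first v)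

theorem LogSystem.mem_liftList (G : LogSystem K c) {i : ℕ} {σ : RFace K.faces i} {n : κ → ℤ}
    {p : ι × (κ → ℤ)} : p ∈ G.liftList σ n ↔ p.1 ∈ σ.1 ∧ p.2 = n + hol G.g σ.first p.1 := by
  simp only [liftList, List.mem_map, Finset.mem_sort]
  constructor
  · rintro ⟨v, hv, rfl⟩; exact ⟨hv, rfl⟩
  · rintro ⟨h1, h2⟩; exact ⟨p.1, h1, Prod.ext rfl h2.symm⟩

theorem LogSystem.length_liftList (G : LogSystem K c) {i : ℕ} (σ : RFace K.faces i) (n : κ → ℤ) :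
    (G.liftList σ n).length = i + 1 := by
  simp [liftList, σ.2.2]

theorem LogSystem.verts_liftList (G : LogSystem K c) {i : ℕ} (σ : RFace K.faces i) (n : κ → ℤ) :
    verts (G.liftList σ n) = σ.1 := by
  ext v
  rw [mem_verts]
  constructor
  · rintro ⟨p, hp, rfl⟩; exact (G.mem_liftList.mp hp).1
  · intro hv; exact ⟨(v, n + hol G.g σ.first v), G.mem_liftList.mpr ⟨hv, rfl⟩, rfl⟩

theorem LogSystem.liftList_good (G : LogSystem K c) {i : ℕ} (σ : RFace K.faces i) (n : κ → ℤ) :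
    G.liftList σ n ∈ G.good := by
  refine ⟨?_, fun _ => ?_, fun p hp q hq => ?_⟩
  · rw [liftList, List.pairwise_map]
    exact (Finset.sortedLT_sort σ.1).pairwise
  · rw [G.verts_liftList]; exact σ.2.1
  · rw [G.mem_liftList] at hp hq
    rw [hp.2, hq.2, add_assoc, G.hol_add σ.2.1 σ.first_mem hp.1 hq.1]

theorem LogSystem.liftList_injective (G : LogSystem K c) {i : ℕ} {σ τ : RFace K.faces i}
    {n m : κ → ℤ} (h : G.liftList σ n = G.liftList τ m) : σ = τ ∧ n = m := by
  have h1 : σ = τ := Subtype.ext (by rw [← G.verts_liftList σ n, h, G.verts_liftList])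
  subst h1
  refine ⟨rfl, ?_⟩
  have h2 : (σ.first, n + hol G.g σ.first σ.first) ∈ G.liftList σ m :=
    h ▸ G.mem_liftList.mpr ⟨σ.first_mem, rfl⟩
  have h3 := (G.mem_liftList.mp h2).2
  simpa using h3

theorem LogSystem.exists_liftList (G : LogSystem K c) {i : ℕ} {l : List (ι × (κ → ℤ))}
    (hl : l ∈ G.good) (hlen : l.length = i + 1) :
    ∃ (σ : RFace K.faces i) (n : κ → ℤ), l = G.liftList σ n := by
  have hne : l ≠ [] := by rintro rfl; simp at hlen
  have hmap : (l.map Prod.fst).Pairwise (· < ·) := List.pairwise_map.mpr hl.1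
  have hnd : (l.map Prod.fst).Nodup := hmap.imp fun h => h.ne
  let σ : RFace K.faces i := ⟨verts l, hl.2.1 hne, by
    rw [verts, List.toFinset_card_of_nodup hnd, List.length_map, hlen]⟩
  obtain ⟨p, hp, hp1⟩ := mem_verts.mp σ.first_mem
  refine ⟨σ, p.2, ?_⟩
  have hs : σ.1.sort (· ≤ ·) = l.map Prod.fst := by
    refine (List.toFinset_sort (· ≤ ·) hnd).mpr ?_
    exact hmap.imp fun h => h.le
  rw [liftList, hs, List.map_map]
  refine (List.map_id l).symm.trans (List.map_congr_left fun q hq => ?_)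
  exact Prod.ext rfl (by rw [← hp1]; exact hl.2.2 p hp q hq)

/-- Translation of the coefficients along the edges. -/
def holShift (g : ι → (ι → ℝ) → κ → ℝ) (a b : ι) :
    ((κ → ℤ) →₀ ℤ) →ₗ[ℤ] ((κ → ℤ) →₀ ℤ) :=
  Finsupp.lmapDomain ℤ ℤ fun n => n + hol g a b

open Classical in
/-- The chains of `K` with coefficients in the group ring, as chains of the covering complex. -/
def LogSystem.toList (G : LogSystem K c) (i : ℕ) :
    (RFace K.faces i → ((κ → ℤ) →₀ ℤ)) →ₗ[ℤ] Ch (ι × (κ → ℤ)) :=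
  ∑ σ : RFace K.faces i, Finsupp.lmapDomain ℤ ℤ (G.liftList σ) ∘ₗ LinearMap.proj σ

open Classical in
theorem LogSystem.toList_single (G : LogSystem K c) {i : ℕ} (σ : RFace K.faces i)
    (x : (κ → ℤ) →₀ ℤ) :
    G.toList i (Pi.single σ x) = Finsupp.lmapDomain ℤ ℤ (G.liftList σ) x := by
  simp only [toList, LinearMap.sum_apply, LinearMap.comp_apply, LinearMap.proj_apply]
  rw [Finset.sum_eq_single σ]
  · rw [Pi.single_eq_same]
  · intro τ _ h
    rw [Pi.single_eq_of_ne h, map_zero]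
  · simp

theorem LogSystem.toList_apply_liftList (G : LogSystem K c) {i : ℕ}
    (w : RFace K.faces i → ((κ → ℤ) →₀ ℤ)) (σ : RFace K.faces i) (n : κ → ℤ) :
    G.toList i w (G.liftList σ n) = w σ n := by
  classical
  simp only [toList, LinearMap.sum_apply, LinearMap.comp_apply, LinearMap.proj_apply,
    Finsupp.lmapDomain_apply, Finsupp.finsetSum_apply]
  rw [Finset.sum_eq_single σ]
  · exact Finsupp.mapDomain_apply (fun _ _ h => (G.liftList_injective h).2) _ _
  · intro τ _ h
    refine Finsupp.mapDomain_of_notMem_range _ _ ?_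
    rintro ⟨m, hm⟩
    exact h (G.liftList_injective hm).1
  · simp

theorem LogSystem.toList_injective (G : LogSystem K c) (i : ℕ) :
    Function.Injective (G.toList i) := by
  intro w w' h
  ext σ n
  rw [← G.toList_apply_liftList, h, G.toList_apply_liftList]

theorem LogSystem.toList_mem (G : LogSystem K c) {i : ℕ}
    (w : RFace K.faces i → ((κ → ℤ) →₀ ℤ)) : G.toList i w ∈ Sup G.good := by
  classical
  simp only [toList, LinearMap.sum_apply, LinearMap.comp_apply, LinearMap.proj_apply]
  refine sum_mem fun σ _ => ?_
  generalize w σ = x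
  induction x using Finsupp.induction_linear with
  | zero => simp
  | add f g hf hg => rw [map_add]; exact add_mem hf hg
  | single n a =>
    rw [Finsupp.lmapDomain_apply, Finsupp.mapDomain_single]
    exact single_mem (G.liftList_good σ n) a

/-- A lift is labelled at its first vertex. The facet opposite to the first vertex has another first
vertex, so its label changes by the holonomy, which is what `holShift` records. -/
theorem LogSystem.d_toList (G : LogSystem K c) (i : ℕ)
    (w : RFace K.faces (i + 1) → ((κ → ℤ) →₀ ℤ)) :
    d (G.toList (i + 1) w) = G.toList i (bd K.faces (holShift G.g) i w) := by
  classical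
  suffices h : d ∘ₗ G.toList (i + 1) = G.toList i ∘ₗ bd K.faces (holShift G.g) i by
    exact LinearMap.congr_fun h w
  refine LinearMap.pi_ext' fun σ => Finsupp.lhom_ext fun n a => ?_
  simp only [LinearMap.comp_apply, LinearMap.single_apply, toList_single, bd_single, map_sum,
    Finsupp.lmapDomain_apply, Finsupp.mapDomain_single, d_single]
  rw [LogSystem.liftList, bdList_sort, Finset.smul_sum, ← Finset.sum_subset
    (Finset.subset_univ σ.1)]
  · refine Finset.sum_congr rfl fun v hv => ?_
    have herase : σ.1.erase v ∈ K.faces := by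
      refine mem_faces_of_subset σ.2.1 (Finset.erase_subset _ _) ?_
      rw [← Finset.card_pos, Finset.card_erase_of_mem hv, σ.2.2]
      omega
    rw [dif_pos ⟨hv, herase⟩, map_smul, toList_single]
    simp only [holShift, Finsupp.lmapDomain_apply, Finsupp.mapDomain_single]
    have h1 : ((σ.1.erase v).sort (· ≤ ·)).map (fun v => (v, n + hol G.g σ.first v)) =
        G.liftList (σ.erase v ⟨hv, herase⟩)
          (n + hol G.g σ.first (σ.erase v ⟨hv, herase⟩).first) := by
      refine List.map_congr_left fun u hu => Prod.ext rfl ?_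
      have hu' : u ∈ σ.1.erase v := (Finset.mem_sort _).mp hu
      rw [add_assoc, G.hol_add σ.2.1 σ.first_mem
        (Finset.mem_of_mem_erase (RFace.first_mem (σ.erase v ⟨hv, herase⟩)))
        (Finset.mem_of_mem_erase hu')]
    rw [h1, smul_comm]
    simp
  · intro v _ hv
    rw [dif_neg fun h => hv h.1, map_zero]

open Classical in
/-- The sum of the coefficients of a `0`-chain. -/
def aug (K : PreAbstractSimplicialComplex ι) (κ : Type*) :
    (RFace K.faces 0 → ((κ → ℤ) →₀ ℤ)) →ₗ[ℤ] ℤ :=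
  ∑ σ : RFace K.faces 0, Finsupp.linearCombination ℤ (fun _ => (1 : ℤ)) ∘ₗ LinearMap.proj σ

theorem LogSystem.d_toList_zero (G : LogSystem K c)
    (w : RFace K.faces 0 → ((κ → ℤ) →₀ ℤ)) :
    d (G.toList 0 w) = Finsupp.single [] (aug K κ w) := by
  classical
  simp only [toList, aug, LinearMap.sum_apply, LinearMap.comp_apply, LinearMap.proj_apply, map_sum]
  rw [Finsupp.single_finsetSum]
  refine Finset.sum_congr rfl fun σ _ => ?_
  generalize w σ = x
  induction x using Finsupp.induction_linear with
  | zero => simp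
  | add f g hf hg => simp only [map_add, hf, hg, Finsupp.single_add]
  | single n a =>
    rw [Finsupp.lmapDomain_apply, Finsupp.mapDomain_single, d_single]
    obtain ⟨p, hp⟩ := List.length_eq_one_iff.mp (G.length_liftList σ n)
    rw [hp]
    simp [bdList]

theorem LogSystem.aug_bd (G : LogSystem K c) (w : RFace K.faces 1 → ((κ → ℤ) →₀ ℤ)) :
    aug K κ (bd K.faces (holShift G.g) 0 w) = 0 := by
  have h := G.d_toList_zero (bd K.faces (holShift G.g) 0 w)
  rw [← G.d_toList, d_d] at h
  exact (Finsupp.single_eq_zero.mp h.symm)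

/-- A filling given by exactness may mix sequences of different lengths. Only those of length `i +
2` are kept; the others have boundaries of lengths other than `i + 1` and contribute nothing. -/
theorem LogSystem.exists_bd_of_toList (G : LogSystem K c) (hG : Exact G.good) (i : ℕ)
    (w : RFace K.faces i → ((κ → ℤ) →₀ ℤ)) (hw : d (G.toList i w) = 0) :
    ∃ w', bd K.faces (holShift G.g) i w' = w := by
  classical
  obtain ⟨y, hy, hdy⟩ := hG _ (G.toList_mem w) hw
  set w' : RFace K.faces (i + 1) → ((κ → ℤ) →₀ ℤ) := fun σ =>
    Finsupp.comapDomain (G.liftList σ) y (fun _ _ _ _ h => (G.liftList_injective h).2) with hw'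
  refine ⟨w', G.toList_injective i ?_⟩
  rw [← G.d_toList]
  have hval : ∀ l : List (ι × (κ → ℤ)), l.length = i + 2 → G.toList (i + 1) w' l = y l := by
    intro l hl
    by_cases hlg : l ∈ G.good
    · obtain ⟨σ, n, rfl⟩ := G.exists_liftList hlg hl
      rw [G.toList_apply_liftList]
      rfl
    · rw [(Finsupp.mem_supported' ℤ _).mp hy l hlg,
        (Finsupp.mem_supported' ℤ _).mp (G.toList_mem w') l hlg]
  have hdiff : ∀ j (w : RFace K.faces j → ((κ → ℤ) →₀ ℤ)),
      G.toList j w ∈ Sup {l | l.length = j + 1} := by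
    intro j w
    simp only [toList, LinearMap.sum_apply, LinearMap.comp_apply, LinearMap.proj_apply]
    refine sum_mem fun σ _ => ?_
    generalize w σ = x
    induction x using Finsupp.induction_linear with
    | zero => simp
    | add f g hf hg => rw [map_add]; exact add_mem hf hg
    | single n a =>
      rw [Finsupp.lmapDomain_apply, Finsupp.mapDomain_single]
      exact single_mem (G.length_liftList σ n) a
  have e1 : d (y - G.toList (i + 1) w') ∈ Sup {l : List (ι × (κ → ℤ)) | l.length ≠ i + 1} := by
    refine d_mem (S := {l | l.length ≠ i + 2}) (fun l hl l' _ h2 => ?_) ?_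
    · have hl' : l.length ≠ i + 2 := hl
      change l'.length ≠ i + 1
      omega
    · rw [Finsupp.mem_supported']
      intro l hl
      rw [Finsupp.sub_apply, hval l (not_not.mp hl), sub_self]
  have e2 : d (y - G.toList (i + 1) w') ∈ Sup {l : List (ι × (κ → ℤ)) | l.length = i + 1} := by
    rw [map_sub, hdy]
    refine sub_mem (hdiff i w) (d_mem (fun l hl l' _ h2 => ?_) (hdiff (i + 1) w'))
    have hl' : l.length = i + 1 + 1 := hl
    change l'.length = i + 1
    omega
  have e3 : d (y - G.toList (i + 1) w') = 0 := by
    ext l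
    by_cases h : l.length = i + 1
    · exact (Finsupp.mem_supported' ℤ _).mp e1 l (not_not.mpr h)
    · exact (Finsupp.mem_supported' ℤ _).mp e2 l h
  rw [map_sub, hdy, sub_eq_zero] at e3
  exact e3.symm

end Bridge

end SurgeryTorsion

/-! ### Exactness for the product of a compact convex set and a torus -/

namespace SurgeryTorsion

open ListChain

variable {ι : Type*} [Fintype ι] {K : PreAbstractSimplicialComplex ι} {κ : Type*}

theorem lipschitzWith_circleExp : LipschitzWith 1 (fun t : ℝ => Circle.exp t) := by
  refine LipschitzWith.of_dist_le_mul fun s t => ?_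
  have h0 : dist (Circle.exp s) (Circle.exp t) = ‖(Circle.exp s : ℂ) - Circle.exp t‖ :=
    dist_eq_norm (Circle.exp s : ℂ) (Circle.exp t)
  rw [h0, NNReal.coe_one, one_mul]
  simp only [Circle.coe_exp]
  have h1 : Complex.exp (s * Complex.I) - Complex.exp (t * Complex.I) =
      Complex.exp (t * Complex.I) * (Complex.exp (Complex.I * ((s - t : ℝ) : ℂ)) - 1) := by
    rw [mul_sub, ← Complex.exp_add, mul_one]
    congr 2
    push_cast
    ring
  rw [h1, norm_mul, Complex.norm_exp_ofReal_mul_I, one_mul]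
  exact Real.norm_exp_I_mul_ofReal_sub_one_le

/-- A map to the circle has a continuous logarithm on every closed star. -/
theorem exists_log_closedStar [DecidableEq ι] {c : (ι → ℝ) → Circle}
    (hc : ContinuousOn c (realization K)) (v : ι) : ∃ g : (ι → ℝ) → ℝ,
      ContinuousOn g (closedStar K v) ∧ ∀ y ∈ closedStar K v, Circle.exp (g y) = c y := by
  classical
  have hmem : ∀ y ∈ closedStar K v, ∀ t ∈ Set.Icc (0 : ℝ) 1,
      AffineMap.lineMap (Pi.single v 1 : ι → ℝ) y t ∈ closedStar K v := by
    intro y hy t ht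
    obtain ⟨σ, h1, h2, h3⟩ := mem_closedStar.mp hy
    refine mem_closedStar.mpr ⟨σ, h1, h2, (convex_cell σ).segment_subset (single_mem_cell h2) h3 ?_⟩
    rw [segment_eq_image_lineMap]
    exact ⟨t, ht, rfl⟩
  -- The segments from `v` form a homotopy that starts at a constant map. Lifting it along
  -- `Circle.exp` and taking the end gives the logarithm; its value off the star is irrelevant.
  let H : C(unitInterval × closedStar K v, Circle) :=
    ⟨fun x => c (AffineMap.lineMap (Pi.single v 1 : ι → ℝ) (x.2 : ι → ℝ) (x.1 : ℝ)), by
      refine (hc.mono (closedStar_subset K v)).comp_continuous (by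
        simp only [AffineMap.lineMap_apply_module]; fun_prop) fun x =>
        hmem x.2 x.2.2 x.1 x.1.2⟩
  obtain ⟨θ, hθ⟩ := Circle.exp_surjective (c (Pi.single v 1))
  have h0 : ∀ a, H (0, a) = Circle.exp ((ContinuousMap.const (closedStar K v) θ) a) := fun a => by
    simp [H, hθ]
  let F := Circle.isCoveringMap_exp.liftHomotopy H (ContinuousMap.const _ θ) h0
  refine ⟨fun y => if h : y ∈ closedStar K v then F (1, ⟨y, h⟩) else 0, ?_, fun y hy => ?_⟩
  · rw [continuousOn_iff_continuous_domRestrict]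
    have : (closedStar K v).domRestrict (fun y => if h : y ∈ closedStar K v then F (1, ⟨y, h⟩) else 0) =
        fun y => F (1, y) := by
      ext y
      exact dif_pos y.2
    rw [this]
    fun_prop
  · have h1 : (fun y => if h : y ∈ closedStar K v then F (1, ⟨y, h⟩) else 0) y = F (1, ⟨y, hy⟩) :=
      dif_pos hy
    rw [h1]
    have := congrFun (Circle.isCoveringMap_exp.liftHomotopy_lifts H (ContinuousMap.const _ θ) h0)
      (1, ⟨y, hy⟩)
    simp only [Function.comp_apply] at this
    rw [show Circle.exp (F (1, ⟨y, hy⟩)) = _ from this]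
    simp [H]

/-- The chain complex of the covering complex of a triangulation of the product of a compact convex
set and a torus is exact. -/
theorem LogSystem.exact_of_product [LinearOrder ι] [Fintype κ] {c : (ι → ℝ) → κ → Circle}
    (G : LogSystem K c) {E : Type*} [NormedAddCommGroup E] [NormedSpace ℝ E] {C : Set E}
    (hC : Convex ℝ C) (hCc : IsCompact C) (hCne : C.Nonempty)
    (r : C × (κ → Circle) → realization K) (hr : Continuous r)
    (q : realization K → C) (hq : Continuous q)
    (hrq : ∀ y : realization K, r (q y, c y) = y) (hcr : ∀ x, c (r x) = x.2) :
    Exact G.good := by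
  classical
  have : CompactSpace C := isCompact_iff_compactSpace.mp hCc
  have : CompactSpace (realization K) := isCompact_iff_compactSpace.mp (isCompact_realization K)
  obtain ⟨z₀, hz₀⟩ := hCne
  let ex : (κ → ℝ) → κ → Circle := fun s i => Circle.exp (s i)
  have hex : UniformContinuous ex := uniformContinuous_pi.mpr fun i =>
    lipschitzWith_circleExp.uniformContinuous.comp (Pi.uniformContinuous_proj _ i)
  -- The convex set `C × ℝ^κ` covers `C` times the torus. Both maps leave the coordinate in `ℝ^κ`
  -- alone, so compactness of `C` and of `|K|` makes them uniformly continuous although `X` is not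
  -- compact.
  let X : Set (E × (κ → ℝ)) := {x | x.1 ∈ C}
  let P : E × (κ → ℝ) → (ι → ℝ) × (κ → ℝ) := fun x =>
    if h : x.1 ∈ C then ((r (⟨x.1, h⟩, ex x.2) : ι → ℝ), x.2) else 0
  let Q : (ι → ℝ) × (κ → ℝ) → E × (κ → ℝ) := fun x =>
    if h : x.1 ∈ realization K then ((q ⟨x.1, h⟩ : E), x.2) else 0
  refine G.exact X ?_ ⟨(z₀, 0), hz₀⟩ P ?_ ?_ Q ?_ ?_ ?_
  · intro x hx y hy a b ha hb hab
    exact hC hx hy ha hb hab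
  · rw [uniformContinuousOn_iff_restrict]
    have hP : X.domRestrict P = fun x => ((r (⟨x.1.1, x.2⟩, ex x.1.2) : ι → ℝ), x.1.2) := by
      ext x : 1
      exact dif_pos x.2
    rw [hP]
    refine UniformContinuous.prodMk ?_ (uniformContinuous_snd.comp uniformContinuous_subtype_val)
    refine uniformContinuous_subtype_val.comp
      ((CompactSpace.uniformContinuous_of_continuous hr).comp (UniformContinuous.prodMk ?_ ?_))
    · exact UniformContinuous.subtype_mk
        (uniformContinuous_fst.comp uniformContinuous_subtype_val) _
    · exact hex.comp (uniformContinuous_snd.comp uniformContinuous_subtype_val)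
  · intro x hx
    have hP : P x = ((r (⟨x.1, hx⟩, ex x.2) : ι → ℝ), x.2) := dif_pos hx
    rw [hP]
    exact ⟨(r _).2, fun i => by simp only [hcr]; rfl⟩
  · rw [uniformContinuousOn_iff_restrict]
    have hQ : (coverSet K c).domRestrict Q = fun x => ((q ⟨x.1.1, x.2.1⟩ : E), x.1.2) := by
      ext x : 1
      exact dif_pos x.2.1
    rw [hQ]
    refine UniformContinuous.prodMk ?_ (uniformContinuous_snd.comp uniformContinuous_subtype_val)
    refine uniformContinuous_subtype_val.comp
      ((CompactSpace.uniformContinuous_of_continuous hq).comp ?_)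
    exact UniformContinuous.subtype_mk (uniformContinuous_fst.comp uniformContinuous_subtype_val) _
  · intro x hx
    have hQ : Q x = ((q ⟨x.1, hx.1⟩ : E), x.2) := dif_pos hx.1
    change (Q x).1 ∈ C
    rw [hQ]
    exact (q _).2
  · intro x hx
    have hQ : Q x = ((q ⟨x.1, hx.1⟩ : E), x.2) := dif_pos hx.1
    have hP : P (Q x) = ((r (q ⟨x.1, hx.1⟩, ex x.2) : ι → ℝ), x.2) := by
      rw [hQ]
      exact dif_pos (q ⟨x.1, hx.1⟩).2
    have he : ex x.2 = c x.1 := funext hx.2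
    rw [hP, he]
    exact Prod.ext (congrArg Subtype.val (hrq ⟨x.1, hx.1⟩)) rfl

end SurgeryTorsion

/-! ### Resolutions, quotients by an injective endomorphism, and orders of homology groups -/

namespace SurgeryTorsion

section Resolution

/-- The complex `(C, d)` together with `ε` is a resolution of `N`. -/
structure Resolves {C : ℕ → Type*} [∀ i, AddCommGroup (C i)] {N : Type*} [AddCommGroup N]
    (d : ∀ i, C (i + 1) →ₗ[ℤ] C i) (ε : C 0 →ₗ[ℤ] N) : Prop where
  surj : Function.Surjective ε
  comp : ∀ w, ε (d 0 w) = 0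
  exact_zero : ∀ w, ε w = 0 → ∃ w', d 0 w' = w
  exact_succ : ∀ i w, d i w = 0 → ∃ w', d (i + 1) w' = w
  d_d : ∀ i w, d i (d (i + 1) w) = 0

variable {C D : ℕ → Type*} [∀ i, AddCommGroup (C i)] [∀ i, AddCommGroup (D i)]
variable {N N' : Type*} [AddCommGroup N] [AddCommGroup N']
variable {d : ∀ i, C (i + 1) →ₗ[ℤ] C i} {d' : ∀ i, D (i + 1) →ₗ[ℤ] D i}
variable {ε : C 0 →ₗ[ℤ] N}

theorem Resolves.of_equiv (h : Resolves d ε) (e : ∀ i, C i ≃ₗ[ℤ] D i)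
    (he : ∀ i w, e i (d i w) = d' i (e (i + 1) w)) (ε' : D 0 →ₗ[ℤ] N)
    (hε : ∀ w, ε' (e 0 w) = ε w) : Resolves d' ε' where
  surj n := by
    obtain ⟨w, hw⟩ := h.surj n
    exact ⟨e 0 w, by rw [hε, hw]⟩
  comp w := by
    obtain ⟨w, rfl⟩ := (e 1).surjective w
    rw [← he, hε, h.comp]
  exact_zero w hw := by
    obtain ⟨w, rfl⟩ := (e 0).surjective w
    obtain ⟨w', hw'⟩ := h.exact_zero w (by rwa [hε] at hw)
    exact ⟨e 1 w', by rw [← he, hw']⟩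
  exact_succ i w hw := by
    obtain ⟨w, rfl⟩ := (e (i + 1)).surjective w
    rw [← he, LinearEquiv.map_eq_zero_iff] at hw
    obtain ⟨w', hw'⟩ := h.exact_succ i w hw
    exact ⟨e (i + 2) w', by rw [← he, hw']⟩
  d_d i w := by
    obtain ⟨w, rfl⟩ := (e (i + 2)).surjective w
    rw [← he, ← he, h.d_d, map_zero]

/-- A quotient complex `D = C / x C` by an injective endomorphism. -/
structure IsQuotientBy (d : ∀ i, C (i + 1) →ₗ[ℤ] C i) (d' : ∀ i, D (i + 1) →ₗ[ℤ] D i)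
    (x : ∀ i, C i →ₗ[ℤ] C i) (p : ∀ i, C i →ₗ[ℤ] D i) : Prop where
  comm : ∀ i w, x i (d i w) = d i (x (i + 1) w)
  map : ∀ i w, p i (d i w) = d' i (p (i + 1) w)
  inj : ∀ i w, x i w = 0 → w = 0
  surj : ∀ i, Function.Surjective (p i)
  zero : ∀ i w, p i (x i w) = 0
  ker : ∀ i w, p i w = 0 → ∃ w', x i w' = w

variable {x : ∀ i, C i →ₗ[ℤ] C i} {p : ∀ i, C i →ₗ[ℤ] D i}

theorem IsQuotientBy.eq_of_eq (hq : IsQuotientBy d d' x p) {i : ℕ} {w w' : C i}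
    (h : x i w = x i w') : w = w' := by
  rw [← sub_eq_zero]
  exact hq.inj i _ (by rw [map_sub, h, sub_self])

/-- This is the long exact sequence of `0 → C → C → D → 0`: the endomorphism `xN` induced on `N` is
injective, so only its cokernel survives, in degree `0`. -/
theorem IsQuotientBy.resolves (h : Resolves d ε) (hq : IsQuotientBy d d' x p)
    (ε' : D 0 →ₗ[ℤ] N') (ν : N →ₗ[ℤ] N') (hν : Function.Surjective ν) (xN : N →ₗ[ℤ] N)
    (hker : ∀ n, ν n = 0 → ∃ m, xN m = n) (hxN : ∀ n, xN n = 0 → n = 0)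
    (hε' : ∀ w, ε' (p 0 w) = ν (ε w)) (hεx : ∀ w, ε (x 0 w) = xN (ε w)) : Resolves d' ε' where
  surj n := by
    obtain ⟨m, rfl⟩ := hν n
    obtain ⟨w, rfl⟩ := h.surj m
    exact ⟨p 0 w, hε' w⟩
  comp w := by
    obtain ⟨w, rfl⟩ := hq.surj 1 w
    rw [← hq.map, hε', h.comp, map_zero]
  exact_zero w hw := by
    obtain ⟨w, rfl⟩ := hq.surj 0 w
    rw [hε'] at hw
    obtain ⟨m, hm⟩ := hker _ hw
    obtain ⟨y, rfl⟩ := h.surj m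
    obtain ⟨z, hz⟩ := h.exact_zero (w - x 0 y) (by rw [map_sub, hεx, hm, sub_self])
    exact ⟨p 1 z, by rw [← hq.map, hz, map_sub, hq.zero, sub_zero]⟩
  exact_succ i w hw := by
    obtain ⟨w, rfl⟩ := hq.surj (i + 1) w
    rw [← hq.map] at hw
    obtain ⟨y, hy⟩ := hq.ker i _ hw
    have hy' : ∃ z, d i z = y := by
      cases i with
      | zero =>
        refine h.exact_zero y (hxN _ ?_)
        rw [← hεx, hy, h.comp]
      | succ i =>
        refine h.exact_succ i y (hq.inj _ _ ?_)
        rw [hq.comm, hy]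
        exact h.d_d i w
    obtain ⟨z, rfl⟩ := hy'
    obtain ⟨u, hu⟩ := h.exact_succ i (w - x (i + 1) z) (by rw [map_sub, ← hq.comm, hy, sub_self])
    exact ⟨p (i + 2) u, by rw [← hq.map, hu, map_sub, hq.zero, sub_zero]⟩
  d_d i w := by
    obtain ⟨w, rfl⟩ := hq.surj (i + 2) w
    rw [← hq.map, ← hq.map, h.d_d, map_zero]

/-- The class in `ℤ/2` is given by a relation rather than a map because it is computed from choices
of lifts. -/
theorem xor_zmod_two {G : Type*} [AddCommGroup G] (H Z : AddSubgroup G) (f : G → ZMod 2 → Prop)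
    (hf : ∀ b ∈ Z, ∃ n, f b n) (h1 : ∃ a ∈ Z, f a 1)
    (hadd : ∀ a b n m, f a n → f b m → f (a + b) (n + m)) (hH : ∀ b n, f b n → (b ∈ H ↔ n = 0)) :
    H.relIndex Z = 2 := by
  rw [AddSubgroup.relIndex_eq_two_iff]
  obtain ⟨a, ha, ha1⟩ := h1
  refine ⟨a, ha, fun b hb => ?_⟩
  obtain ⟨n, hn⟩ := hf b hb
  rw [hH _ _ (hadd _ _ _ _ hn ha1), hH _ _ hn, xor_def]
  have key : ∀ n : ZMod 2, (n + 1 = 0 ∧ ¬ n = 0) ∨ (n = 0 ∧ ¬ n + 1 = 0) := by decide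
  exact key n

theorem Resolves.index_zero {ε : C 0 →ₗ[ℤ] ZMod 2} (h : Resolves d ε) :
    (LinearMap.range (d 0)).toAddSubgroup.relIndex ⊤ = 2 := by
  refine xor_zmod_two _ _ (fun w n => ε w = n) (fun w _ => ⟨_, rfl⟩) ?_ ?_ ?_
  · obtain ⟨a, ha⟩ := h.surj 1
    exact ⟨a, trivial, ha⟩
  · rintro a b _ _ rfl rfl
    exact map_add _ _ _
  · rintro b _ rfl
    constructor
    · rintro ⟨w, rfl⟩
      exact h.comp w
    · intro hb
      exact h.exact_zero b hb

theorem Resolves.index_succ (h : Resolves d ε) (i : ℕ) :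
    (LinearMap.range (d (i + 1))).toAddSubgroup.relIndex (LinearMap.ker (d i)).toAddSubgroup =
      1 := by
  rw [AddSubgroup.relIndex_eq_one]
  intro w hw
  exact h.exact_succ i w hw

/-- The homology of the quotient by an endomorphism which acts as zero on `N`. -/
theorem IsQuotientBy.index_zero {ε : C 0 →ₗ[ℤ] ZMod 2} (h : Resolves d ε)
    (hq : IsQuotientBy d d' x p) (hεx : ∀ w, ε (x 0 w) = 0) :
    (LinearMap.range (d' 0)).toAddSubgroup.relIndex ⊤ = 2 := by
  refine xor_zmod_two _ _ (fun w n => ∃ y, p 0 y = w ∧ ε y = n) (fun w _ => ?_) ?_ ?_ ?_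
  · obtain ⟨y, hy⟩ := hq.surj 0 w
    exact ⟨_, y, hy, rfl⟩
  · obtain ⟨a, ha⟩ := h.surj 1
    exact ⟨_, trivial, a, rfl, ha⟩
  · rintro a b _ _ ⟨y, rfl, rfl⟩ ⟨z, rfl, rfl⟩
    exact ⟨y + z, map_add _ _ _, map_add _ _ _⟩
  · rintro _ _ ⟨y, rfl, rfl⟩
    constructor
    · rintro ⟨w, hw⟩
      obtain ⟨w, rfl⟩ := hq.surj 1 w
      rw [← hq.map, ← sub_eq_zero, ← map_sub] at hw
      obtain ⟨z, hz⟩ := hq.ker 0 _ hw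
      have h1 := hεx z
      rwa [hz, map_sub, h.comp, zero_sub, neg_eq_zero] at h1
    · intro hy
      obtain ⟨w, rfl⟩ := h.exact_zero y hy
      exact ⟨p 1 w, (hq.map 0 w).symm⟩

/-- The class of a cycle is its image under the connecting map: lift it to `z`, write `d z = x y`
and take `ε y`. Every class occurs, since `ε (x y) = 0` makes every `x y` a boundary. -/
theorem IsQuotientBy.index_one {ε : C 0 →ₗ[ℤ] ZMod 2} (h : Resolves d ε)
    (hq : IsQuotientBy d d' x p) (hεx : ∀ w, ε (x 0 w) = 0) :
    (LinearMap.range (d' 1)).toAddSubgroup.relIndex (LinearMap.ker (d' 0)).toAddSubgroup = 2 := by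
  refine xor_zmod_two _ _ (fun w n => ∃ z y, p 1 z = w ∧ d 0 z = x 0 y ∧ ε y = n)
    (fun w hw => ?_) ?_ ?_ ?_
  · obtain ⟨z, rfl⟩ := hq.surj 1 w
    have hw' : d' 0 (p 1 z) = 0 := hw
    rw [← hq.map] at hw'
    obtain ⟨y, hy⟩ := hq.ker 0 _ hw'
    exact ⟨_, z, y, rfl, hy.symm, rfl⟩
  · obtain ⟨y, hy⟩ := h.surj 1
    obtain ⟨z, hz⟩ := h.exact_zero _ (hεx y)
    refine ⟨p 1 z, ?_, z, y, rfl, hz, hy⟩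
    change d' 0 (p 1 z) = 0
    rw [← hq.map, hz, hq.zero]
  · rintro a b _ _ ⟨z, y, rfl, h1, rfl⟩ ⟨z', y', rfl, h1', rfl⟩
    exact ⟨z + z', y + y', map_add _ _ _, by rw [map_add, map_add, h1, h1'], map_add _ _ _⟩
  · rintro _ _ ⟨z, y, rfl, h1, rfl⟩
    constructor
    · rintro ⟨w, hw⟩
      obtain ⟨w, rfl⟩ := hq.surj 2 w
      rw [← hq.map, ← sub_eq_zero, ← map_sub] at hw
      obtain ⟨u, hu⟩ := hq.ker 1 _ hw
      have h2 : x 0 y = x 0 (d 0 (-u)) := by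
        rw [hq.comm, map_neg, hu, neg_sub, map_sub, h.d_d, sub_zero, h1]
      rw [hq.eq_of_eq h2, h.comp]
    · intro hy
      obtain ⟨w, rfl⟩ := h.exact_zero y hy
      obtain ⟨u, hu⟩ := h.exact_succ 0 (z - x 1 w) (by rw [map_sub, ← hq.comm, h1, sub_self])
      exact ⟨p 2 u, by rw [← hq.map, hu, map_sub, hq.zero, sub_zero]⟩

theorem IsQuotientBy.index_succ (h : Resolves d ε) (hq : IsQuotientBy d d' x p) (i : ℕ) :
    (LinearMap.range (d' (i + 2))).toAddSubgroup.relIndex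
      (LinearMap.ker (d' (i + 1))).toAddSubgroup = 1 := by
  rw [AddSubgroup.relIndex_eq_one]
  intro w hw
  obtain ⟨w, rfl⟩ := hq.surj (i + 2) w
  have hw' : d' (i + 1) (p (i + 2) w) = 0 := hw
  rw [← hq.map] at hw'
  obtain ⟨y, hy⟩ := hq.ker (i + 1) _ hw'
  obtain ⟨z, rfl⟩ := h.exact_succ i y (hq.inj _ _ (by rw [hq.comm, hy, h.d_d]))
  obtain ⟨u, hu⟩ := h.exact_succ (i + 1) (w - x (i + 2) z)
    (by rw [map_sub, ← hq.comm, hy, sub_self])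
  exact ⟨p (i + 3) u, by rw [← hq.map, hu, map_sub, hq.zero, sub_zero]⟩

theorem IsQuotientBy.d_d (h : Resolves d ε) (hq : IsQuotientBy d d' x p) (i : ℕ) (w : D (i + 2)) :
    d' i (d' (i + 1) w) = 0 := by
  obtain ⟨w, rfl⟩ := hq.surj (i + 2) w
  rw [← hq.map, ← hq.map, h.d_d, map_zero]

end Resolution

end SurgeryTorsion

/-! ### Coefficients in the group ring and in the lattice `ℤ[t] / (t ^ λ + 1)` -/

namespace SurgeryTorsion

open ListChain

section Coefficients

variable {ι : Type*} [LinearOrder ι] [Fintype ι] {k : Type*} [CommRing k]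
variable {W W' : Type*} [AddCommGroup W] [Module k W] [AddCommGroup W'] [Module k W']

theorem bd_map (A : Set (Finset ι)) (U : ι → ι → W →ₗ[k] W) (U' : ι → ι → W' →ₗ[k] W')
    (π : W →ₗ[k] W') (h : ∀ a b w, π (U a b w) = U' a b (π w)) (i : ℕ) (w : RFace A (i + 1) → W) :
    π.compLeft (RFace A i) (bd A U i w) = bd A U' i (π.compLeft (RFace A (i + 1)) w) := by
  classical
  ext τ
  rw [bd_apply]
  simp only [LinearMap.compLeft_apply, Function.comp_apply, bd_apply, map_sum]
  refine Finset.sum_congr rfl fun v _ => ?_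
  split_ifs with hv
  · rw [map_smul, h]
  · exact map_zero _

theorem isQuotientBy_bd (A : Set (Finset ι)) {W W' : Type*} [AddCommGroup W] [AddCommGroup W']
    {U : ι → ι → W →ₗ[ℤ] W} {U' : ι → ι → W' →ₗ[ℤ] W'}
    {π : W →ₗ[ℤ] W'} (h : ∀ a b w, π (U a b w) = U' a b (π w)) {x : W →ₗ[ℤ] W}
    (hx : ∀ a b w, x (U a b w) = U a b (x w)) (hinj : ∀ w, x w = 0 → w = 0)
    (hsurj : Function.Surjective π) (hzero : ∀ w, π (x w) = 0)
    (hker : ∀ w, π w = 0 → ∃ w', x w' = w) :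
    IsQuotientBy (C := fun i => RFace A i → W) (D := fun i => RFace A i → W') (bd A U) (bd A U')
      (fun i => x.compLeft (RFace A i)) (fun i => π.compLeft (RFace A i)) where
  comm i w := bd_map A U U x hx i w
  map i w := bd_map A U U' π h i w
  inj i w hw := funext fun σ => hinj _ (congrFun hw σ)
  surj i w := by
    choose f hf using fun σ => hsurj (w σ)
    exact ⟨f, funext hf⟩
  zero i w := funext fun σ => hzero (w σ)
  ker i w hw := by
    choose f hf using fun σ => hker (w σ) (congrFun hw σ)
    exact ⟨f, funext hf⟩

open Classical in
/-- The sum of the coefficients of a `0`-chain, mapped by `ν`. -/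
def total (A : Set (Finset ι)) (ν : W →ₗ[k] W') : (RFace A 0 → W) →ₗ[k] W' :=
  ∑ σ : RFace A 0, ν ∘ₗ LinearMap.proj σ

theorem total_compLeft {W'' : Type*} [AddCommGroup W''] [Module k W''] (A : Set (Finset ι))
    (π : W →ₗ[k] W') (ν : W' →ₗ[k] W'') (w : RFace A 0 → W) :
    total A ν (π.compLeft (RFace A 0) w) = total A (ν ∘ₗ π) w := by
  simp [total]

theorem comp_total {W'' : Type*} [AddCommGroup W''] [Module k W''] (A : Set (Finset ι))
    (π : W →ₗ[k] W') (ν : W' →ₗ[k] W'') (w : RFace A 0 → W) :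
    ν (total A π w) = total A (ν ∘ₗ π) w := by
  simp [total]

end Coefficients

/-- The sum of the values. -/
def sumZ (α : Type*) {M : Type*} [AddCommGroup M] : (α →₀ M) →ₗ[ℤ] M :=
  Finsupp.lsum ℤ fun _ => LinearMap.id

@[simp] theorem sumZ_single {α M : Type*} [AddCommGroup M] (a : α) (m : M) :
    sumZ α (Finsupp.single a m) = m := by
  simp [sumZ]

section Resolution

variable {ι : Type*} [LinearOrder ι] [Fintype ι] {κ : Type*}
variable {K : PreAbstractSimplicialComplex ι} {c : (ι → ℝ) → κ → Circle}

/-- Chains with coefficients in the group ring of the deck group are the chains of the covering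
complex, whose augmented complex is exact by `hG`. -/
theorem LogSystem.resolves (G : LogSystem K c) (hG : Exact G.good)
    (hne : (realization K).Nonempty) :
    Resolves (C := fun i => RFace K.faces i → ((κ → ℤ) →₀ ℤ)) (bd K.faces (holShift G.g))
      (total K.faces (sumZ (κ → ℤ))) := by
  classical
  have haug : total K.faces (sumZ (κ → ℤ)) = aug K κ := by
    rw [total, aug]
    congr! 3
    refine Finsupp.lhom_ext fun n a => ?_
    simp [sumZ]
  rw [haug]
  constructor
  · intro n
    obtain ⟨y, hy⟩ := hne
    obtain ⟨v, hv⟩ := (K.isRelLowerSet_faces hy.2).1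
    let σ : RFace K.faces 0 := ⟨{v}, vertex_mem hy.2 hv, by simp⟩
    refine ⟨Pi.single σ (Finsupp.single 0 n), ?_⟩
    rw [aug, LinearMap.sum_apply, Finset.sum_eq_single σ]
    · simp
    · intro τ _ h
      simp [Pi.single_eq_of_ne h]
    · simp
  · exact G.aug_bd
  · intro w hw
    exact G.exists_bd_of_toList hG 0 w (by rw [G.d_toList_zero, hw, Finsupp.single_zero])
  · intro i w hw
    exact G.exists_bd_of_toList hG (i + 1) w (by rw [G.d_toList, hw, map_zero])
  · intro i w
    apply G.toList_injective
    rw [← G.d_toList, ← G.d_toList, d_d, map_zero]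

end Resolution

section Lattice

/-- Translation of finitely supported functions on `ℤ`. -/
def sh {M : Type*} [AddCommGroup M] (m : ℤ) : (ℤ →₀ M) →ₗ[ℤ] (ℤ →₀ M) :=
  Finsupp.lmapDomain M ℤ fun n => n + m

@[simp] theorem sh_single {M : Type*} [AddCommGroup M] (m n : ℤ) (a : M) :
    sh m (Finsupp.single n a) = Finsupp.single (n + m) a := by
  simp [sh]

theorem sh_sh {M : Type*} [AddCommGroup M] (m n : ℤ) (f : ℤ →₀ M) :
    sh m (sh n f) = sh n (sh m f) := by
  induction f using Finsupp.induction_linear with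
  | zero => simp
  | add f g hf hg => simp only [map_add, hf, hg]
  | single k a => simp only [sh_single]; congr 1; ring

theorem sh_apply {M : Type*} [AddCommGroup M] (m : ℤ) (f : ℤ →₀ M) (n : ℤ) :
    sh m f (n + m) = f n :=
  Finsupp.mapDomain_apply (add_left_injective m) f n

/-- A nonzero value would recur along an infinite arithmetic progression, against the finite
support. -/
theorem eq_zero_of_periodic {M : Type*} [AddCommGroup M] (f : ℤ →₀ M) (m : ℤ) (hm : m ≠ 0)
    (h : ∀ n, f n ≠ 0 → f (n + m) ≠ 0) : f = 0 := by
  by_contra hf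
  obtain ⟨n, hn⟩ := Finsupp.ne_iff.mp hf
  have h1 : ∀ j : ℕ, f (n + j * m) ≠ 0 := fun j => by
    induction j with
    | zero => simpa using hn
    | succ j ih =>
      have := h _ ih
      rwa [show n + ((j + 1 : ℕ) : ℤ) * m = n + j * m + m by push_cast; ring]
  have hinj : Function.Injective fun j : ℕ => n + (j : ℤ) * m := fun i j hij => by
    have : (i : ℤ) * m = j * m := add_left_cancel hij
    exact_mod_cast mul_right_cancel₀ hm this
  exact Set.infinite_range_of_injective hinj
    (f.support.finite_toSet.subset (by rintro _ ⟨j, rfl⟩; simpa using h1 j))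

variable (lam : ℕ) [NeZero lam]

/-- Multiplication by `t ^ λ + 1` on Laurent polynomials. -/
def mulX : (ℤ →₀ ℤ) →ₗ[ℤ] (ℤ →₀ ℤ) := sh (lam : ℤ) + LinearMap.id

theorem mulX_inj (f : ℤ →₀ ℤ) (hf : mulX lam f = 0) : f = 0 := by
  have hl : (lam : ℤ) ≠ 0 := by exact_mod_cast NeZero.ne lam
  refine eq_zero_of_periodic f lam hl fun n hn h => hn ?_
  have h1 := DFunLike.congr_fun hf (n + lam)
  simp only [mulX, LinearMap.add_apply, LinearMap.id_apply, Finsupp.add_apply, Finsupp.zero_apply,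
    sh_apply, h, add_zero] at h1
  exact h1

/-- The lattice `ℤ[t] / (t ^ λ + 1)` in the basis of the powers of `t`. -/
abbrev Lat := Fin lam → ℤ

def residue (n : ℤ) : Fin lam :=
  ⟨(n % lam).toNat, by
    have h : (0 : ℤ) < lam := by exact_mod_cast Nat.pos_of_ne_zero (NeZero.ne lam)
    have := Int.emod_lt_of_pos n h
    have := Int.emod_nonneg n h.ne'
    omega⟩

theorem residue_coe (n : ℤ) : ((residue lam n : ℕ) : ℤ) = n % lam := by
  have h : (lam : ℤ) ≠ 0 := by exact_mod_cast NeZero.ne lam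
  exact Int.toNat_of_nonneg (Int.emod_nonneg n h)

/-- The relation `t ^ λ = -1` turns `t ^ n` into `(-1) ^ (n / λ) * t ^ (n % λ)`; the division rounds
down, so this is also right for negative `n`. -/
def toLat : (ℤ →₀ ℤ) →ₗ[ℤ] Lat lam :=
  Finsupp.linearCombination ℤ fun n : ℤ =>
    ((n / (lam : ℤ)).negOnePow : ℤ) • (Pi.single (residue lam n) 1 : Lat lam)

def ofLat : Lat lam →ₗ[ℤ] (ℤ →₀ ℤ) :=
  ∑ r : Fin lam, Finsupp.lsingle ((r : ℕ) : ℤ) ∘ₗ LinearMap.proj r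

theorem ofLat_single (r : Fin lam) (a : ℤ) :
    ofLat lam (Pi.single r a) = Finsupp.single ((r : ℕ) : ℤ) a := by
  rw [ofLat, LinearMap.sum_apply, Finset.sum_eq_single r]
  · simp
  · intro s _ h
    simp [Pi.single_eq_of_ne h]
  · simp

theorem toLat_single (n : ℤ) (a : ℤ) : toLat lam (Finsupp.single n a) =
    a • ((n / (lam : ℤ)).negOnePow : ℤ) • (Pi.single (residue lam n) 1 : Lat lam) := by
  simp only [toLat, Finsupp.linearCombination_single]

theorem toLat_mulX (f : ℤ →₀ ℤ) : toLat lam (mulX lam f) = 0 := by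
  have hl : (lam : ℤ) ≠ 0 := by exact_mod_cast NeZero.ne lam
  induction f using Finsupp.induction_linear with
  | zero => simp
  | add f g hf hg => simp only [map_add, hf, hg, add_zero]
  | single n a =>
    simp only [mulX, LinearMap.add_apply, sh_single, LinearMap.id_apply, map_add, toLat_single]
    have h1 : residue lam (n + lam) = residue lam n := by
      ext
      have := residue_coe lam (n + lam)
      rw [Int.add_emod_right, ← residue_coe lam n] at this
      exact_mod_cast this
    rw [h1, Int.add_ediv_of_dvd_right dvd_rfl, Int.ediv_self hl, Int.negOnePow_succ]
    simp

theorem toLat_ofLat (l : Lat lam) : toLat lam (ofLat lam l) = l := by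
  have hl : (0 : ℤ) < lam := by exact_mod_cast Nat.pos_of_ne_zero (NeZero.ne lam)
  suffices h : toLat lam ∘ₗ ofLat lam = LinearMap.id from LinearMap.congr_fun h l
  refine LinearMap.pi_ext fun r a => ?_
  have h1 : ((r : ℕ) : ℤ) / lam = 0 := Int.ediv_eq_zero_of_lt (by positivity) (by exact_mod_cast r.2)
  have h2 : residue lam ((r : ℕ) : ℤ) = r := by
    ext
    have := residue_coe lam ((r : ℕ) : ℤ)
    rw [Int.emod_eq_of_lt (by positivity) (by exact_mod_cast r.2)] at this
    exact_mod_cast this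
  rw [LinearMap.comp_apply, ofLat_single, toLat_single, h1, h2]
  simp [← Pi.single_smul]

/-- Because the signs alternate, two consecutive differences add up to a multiple of `t ^ λ + 1`.
This carries the induction in both directions. -/
theorem single_sub_mem_range (r n : ℤ) : Finsupp.single (r + n * lam) (1 : ℤ) -
    Finsupp.single r (n.negOnePow : ℤ) ∈ LinearMap.range (mulX lam) := by
  have hstep : ∀ n : ℤ, (Finsupp.single (r + (n + 1) * lam) (1 : ℤ) -
      Finsupp.single r ((n + 1).negOnePow : ℤ)) + (Finsupp.single (r + n * lam) (1 : ℤ) -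
      Finsupp.single r (n.negOnePow : ℤ)) ∈ LinearMap.range (mulX lam) := fun n => by
    refine ⟨Finsupp.single (r + n * lam) 1, ?_⟩
    simp only [mulX, LinearMap.add_apply, sh_single, LinearMap.id_apply, Int.negOnePow_succ]
    rw [show r + n * lam + (lam : ℤ) = r + (n + 1) * lam by ring]
    simp
  induction n using Int.induction_on with
  | zero => simp
  | succ i ih => exact (Submodule.add_mem_iff_left _ ih).mp (hstep i)
  | pred i ih =>
    have := hstep (-i - 1)
    rw [sub_add_cancel] at this
    exact (Submodule.add_mem_iff_right _ ih).mp this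

theorem sub_ofLat_mem_range (f : ℤ →₀ ℤ) :
    f - ofLat lam (toLat lam f) ∈ LinearMap.range (mulX lam) := by
  induction f using Finsupp.induction_linear with
  | zero => simp
  | add f g hf hg =>
    have := add_mem hf hg
    rwa [sub_add_sub_comm, ← map_add, ← map_add] at this
  | single n a =>
    have h := single_sub_mem_range lam (n % lam) (n / lam)
    rw [mul_comm, Int.emod_add_mul_ediv] at h
    have := Submodule.smul_mem _ a h
    rw [toLat_single, map_smul, map_smul, ofLat_single, residue_coe]
    rw [smul_sub] at this
    simpa using this

theorem toLat_ker (f : ℤ →₀ ℤ) (hf : toLat lam f = 0) : ∃ h, mulX lam h = f := by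
  have := sub_ofLat_mem_range lam f
  rwa [hf, map_zero, sub_zero] at this

/-- Multiplication by `t ^ m` on the lattice. -/
def latShift (m : ℤ) : Lat lam →ₗ[ℤ] Lat lam := toLat lam ∘ₗ sh m ∘ₗ ofLat lam

theorem mulX_sh (m : ℤ) (f : ℤ →₀ ℤ) : mulX lam (sh m f) = sh m (mulX lam f) := by
  simp only [mulX, LinearMap.add_apply, LinearMap.id_apply, map_add]
  rw [sh_sh]

theorem toLat_sh (m : ℤ) (f : ℤ →₀ ℤ) : toLat lam (sh m f) = latShift lam m (toLat lam f) := by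
  obtain ⟨h, hh⟩ := sub_ofLat_mem_range lam f
  have : f = mulX lam h + ofLat lam (toLat lam f) := by rw [hh]; abel
  conv_lhs => rw [this]
  rw [map_add, map_add, ← mulX_sh, toLat_mulX, zero_add]
  rfl

/-- Reduction modulo `2` and `t = 1`. -/
def latTotal : Lat lam →ₗ[ℤ] ZMod 2 :=
  ∑ r : Fin lam, (Int.castAddHom (ZMod 2)).toIntLinearMap ∘ₗ LinearMap.proj r

theorem latTotal_single (r : Fin lam) (a : ℤ) : latTotal lam (Pi.single r a) = (a : ZMod 2) := by
  rw [latTotal, LinearMap.sum_apply, Finset.sum_eq_single r]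
  · simp
  · intro s _ h
    simp [Pi.single_eq_of_ne h]
  · simp

theorem latTotal_toLat (f : ℤ →₀ ℤ) :
    latTotal lam (toLat lam f) = (Int.castAddHom (ZMod 2)).toIntLinearMap (sumZ ℤ f) := by
  induction f using Finsupp.induction_linear with
  | zero => simp
  | add f g hf hg => simp only [map_add, hf, hg]
  | single n a =>
    rw [toLat_single, map_smul, map_smul, latTotal_single, sumZ_single]
    rcases Int.units_eq_one_or (n / (lam : ℤ)).negOnePow with h | h <;> rw [h] <;> simp

/-- Evaluation at `u`. -/
def evalAt (u : ℂ) : (ℤ →₀ ℤ) →ₗ[ℤ] ℂ := Finsupp.linearCombination ℤ fun n : ℤ => u ^ n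

theorem evalAt_sh {u : ℂ} (hu : u ≠ 0) (m : ℤ) (f : ℤ →₀ ℤ) :
    evalAt u (sh m f) = u ^ m * evalAt u f := by
  induction f using Finsupp.induction_linear with
  | zero => simp
  | add f g hf hg => simp only [map_add, hf, hg, mul_add]
  | single n a => simp [evalAt, zpow_add₀ hu]; ring

/-- Multiples of `t ^ λ + 1` vanish at `u`, so the evaluation factors through the lattice. -/
theorem evalAt_ofLat_toLat {u : ℂ} (hu : u ^ lam = -1) (f : ℤ →₀ ℤ) :
    evalAt u (ofLat lam (toLat lam f)) = evalAt u f := by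
  have h0 : u ≠ 0 := by
    rintro rfl
    rw [zero_pow (NeZero.ne lam)] at hu
    norm_num at hu
  obtain ⟨h, hh⟩ := sub_ofLat_mem_range lam f
  have h1 : evalAt u (mulX lam h) = 0 := by
    simp only [mulX, LinearMap.add_apply, map_add, LinearMap.id_apply, evalAt_sh h0, zpow_natCast,
      hu]
    ring
  rw [hh, map_sub, sub_eq_zero] at h1
  exact h1.symm

theorem evalAt_latShift {u : ℂ} (hu : u ^ lam = -1) (m : ℤ) (l : Lat lam) :
    evalAt u (ofLat lam (latShift lam m l)) = u ^ m * evalAt u (ofLat lam l) := by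
  have h0 : u ≠ 0 := by
    rintro rfl
    rw [zero_pow (NeZero.ne lam)] at hu
    norm_num at hu
  rw [latShift, LinearMap.comp_apply, evalAt_ofLat_toLat lam hu, LinearMap.comp_apply, evalAt_sh h0]

end Lattice

end SurgeryTorsion

/-! ### Orders of the homology of the solid torus and of its boundary -/

namespace SurgeryTorsion

open ListChain

/-- The cycles of a complex. -/
def cyc {C : ℕ → Type*} [∀ i, AddCommGroup (C i)] (d : ∀ i, C (i + 1) →ₗ[ℤ] C i) :
    ∀ i, AddSubgroup (C i)
  | 0 => ⊤
  | i + 1 => (LinearMap.ker (d i)).toAddSubgroup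

/-- The order of the homology group in degree `i` (`0` if it is infinite). -/
def homIndex {C : ℕ → Type*} [∀ i, AddCommGroup (C i)] (d : ∀ i, C (i + 1) →ₗ[ℤ] C i) (i : ℕ) : ℕ :=
  (LinearMap.range (d i)).toAddSubgroup.relIndex (cyc d i)

theorem IsQuotientBy.homIndex_eq {C D : ℕ → Type*} [∀ i, AddCommGroup (C i)]
    [∀ i, AddCommGroup (D i)] {d : ∀ i, C (i + 1) →ₗ[ℤ] C i} {d' : ∀ i, D (i + 1) →ₗ[ℤ] D i}
    {x : ∀ i, C i →ₗ[ℤ] C i} {p : ∀ i, C i →ₗ[ℤ] D i} {ε : C 0 →ₗ[ℤ] ZMod 2} (h : Resolves d ε)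
    (hq : IsQuotientBy d d' x p) (hεx : ∀ w, ε (x 0 w) = 0) (i : ℕ) :
    homIndex d' i = if i ≤ 1 then 2 else 1 := by
  rcases i with _ | _ | i
  · exact hq.index_zero h hεx
  · exact hq.index_one h hεx
  · exact hq.index_succ h i

variable {ι : Type*} [LinearOrder ι] [Fintype ι] {K : PreAbstractSimplicialComplex ι}
variable (lam : ℕ) [NeZero lam]

theorem zmod_two_ker (n : ℤ) (h : (Int.castAddHom (ZMod 2)).toIntLinearMap n = 0) :
    ∃ m, (2 • LinearMap.id : ℤ →ₗ[ℤ] ℤ) m = n := by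
  have h' : ((n : ℤ) : ZMod 2) = 0 := h
  obtain ⟨m, rfl⟩ := (ZMod.intCast_zmod_eq_zero_iff_dvd n 2).mp h'
  exact ⟨m, by simp⟩

theorem sumZ_mulX (f : ℤ →₀ ℤ) : sumZ ℤ (mulX lam f) = 2 * sumZ ℤ f := by
  induction f using Finsupp.induction_linear with
  | zero => simp
  | add f g hf hg => simp only [map_add, hf, hg, mul_add]
  | single n a => simp [mulX, two_mul]

/-- On the resolved module `ℤ`, where `t = 1`, the element `t ^ λ + 1` acts as the injective map
`2`. Dividing by it turns the resolution of `ℤ` into one of `ℤ/2`. -/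
theorem LogSystem.resolves_lat {c : (ι → ℝ) → Unit → Circle} (G : LogSystem K c)
    (hG : Exact G.good) (hne : (realization K).Nonempty) :
    Resolves (C := fun i => RFace K.faces i → Lat lam)
      (bd K.faces fun a b => latShift lam (hol G.g a b ())) (total K.faces (latTotal lam)) := by
  let e : ((Unit → ℤ) →₀ ℤ) ≃ₗ[ℤ] (ℤ →₀ ℤ) := Finsupp.domLCongr (Equiv.funUnique Unit ℤ)
  have he : ∀ n a, e (Finsupp.single n a) = Finsupp.single (n ()) a := fun n a => by
    simp [e]
  have h1 : Resolves (C := fun i => RFace K.faces i → (ℤ →₀ ℤ))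
      (bd K.faces fun a b => sh (hol G.g a b ())) (total K.faces (sumZ ℤ)) := by
    refine (G.resolves hG hne).of_equiv (D := fun i => RFace K.faces i → (ℤ →₀ ℤ))
      (fun i => LinearEquiv.piCongrRight fun _ => e)
      (fun i w => bd_map K.faces _ _ e.toLinearMap (fun a b w => ?_) i w) _ fun w => ?_
    · suffices h : e.toLinearMap ∘ₗ holShift G.g a b = sh (hol G.g a b ()) ∘ₗ e.toLinearMap from
        LinearMap.congr_fun h w
      refine Finsupp.lhom_ext fun n a => ?_
      simp [holShift, he]
    · have h2 := total_compLeft K.faces e.toLinearMap (sumZ ℤ) w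
      have h3 : sumZ ℤ ∘ₗ e.toLinearMap = sumZ (Unit → ℤ) := by
        refine Finsupp.lhom_ext fun n a => ?_
        simp [he]
      rw [h3] at h2
      exact h2
  refine IsQuotientBy.resolves h1 (isQuotientBy_bd K.faces (π := toLat lam) (x := mulX lam)
    (fun a b w => toLat_sh lam _ w) (fun a b w => mulX_sh lam _ w) (mulX_inj lam)
    (fun l => ⟨ofLat lam l, toLat_ofLat lam l⟩) (toLat_mulX lam) (toLat_ker lam))
    _ (Int.castAddHom (ZMod 2)).toIntLinearMap (ZMod.intCast_surjective)
    (2 • LinearMap.id) zmod_two_ker (fun n hn => by simpa using hn) (fun w => ?_) (fun w => ?_)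
  · rw [total_compLeft, comp_total]
    congr 2
    ext1 f
    exact LinearMap.ext fun a => latTotal_toLat lam _
  · rw [total_compLeft]
    have : sumZ ℤ ∘ₗ mulX lam = (2 • LinearMap.id) ∘ₗ sumZ ℤ :=
      LinearMap.ext fun f => by simp [sumZ_mulX]
    rw [this, ← comp_total]

theorem LogSystem.homIndex_of_circle {c : (ι → ℝ) → Unit → Circle} (G : LogSystem K c)
    (hG : Exact G.good) (hne : (realization K).Nonempty) (i : ℕ) :
    homIndex (C := fun i => RFace K.faces i → Lat lam)
      (bd K.faces fun a b => latShift lam (hol G.g a b ())) i = if i = 0 then 2 else 1 := by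
  have h := G.resolves_lat lam hG hne
  rcases i with _ | i
  · exact h.index_zero
  · exact h.index_succ i

/-- Coefficientwise application of a linear map. -/
abbrev mapZ {M N : Type*} [AddCommGroup M] [AddCommGroup N] (f : M →ₗ[ℤ] N) :
    (ℤ →₀ M) →ₗ[ℤ] (ℤ →₀ N) := Finsupp.mapRange.linearMap f

theorem mapZ_ker {M N : Type*} [AddCommGroup M] [AddCommGroup N] {x : M →ₗ[ℤ] M} {f : M →ₗ[ℤ] N}
    (hinj : ∀ w, x w = 0 → w = 0) (hker : ∀ w, f w = 0 → ∃ w', x w' = w) (w : ℤ →₀ M)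
    (hw : mapZ f w = 0) : ∃ w', mapZ x w' = w := by
  classical
  let inv : M → M := fun m => if h : ∃ m', x m' = m then h.choose else 0
  have hinv : ∀ m, f m = 0 → x (inv m) = m := fun m hm => by
    have h := hker m hm
    simp only [inv, dif_pos h]
    exact h.choose_spec
  -- Injectivity of `x` forces `inv 0 = 0`, so the support stays finite.
  refine ⟨w.mapRange inv (hinj _ (hinv 0 (map_zero f))), ?_⟩
  ext1 n
  exact hinv _ (DFunLike.congr_fun hw n)

theorem sh_mapZ {M N : Type*} [AddCommGroup M] [AddCommGroup N] (f : M →ₗ[ℤ] N) (m : ℤ)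
    (w : ℤ →₀ M) : mapZ f (sh m w) = sh m (mapZ f w) := by
  induction w using Finsupp.induction_linear with
  | zero => simp
  | add f g hf hg => simp only [map_add, hf, hg]
  | single n a => simp

/-- Only the variable of coordinate `1` is reduced modulo `t ^ λ + 1`. That of coordinate `0`
remains free and is the outer variable after currying. -/
theorem LogSystem.resolves_torus {c : (ι → ℝ) → Fin 2 → Circle} (G : LogSystem K c)
    (hG : Exact G.good) (hne : (realization K).Nonempty) :
    Resolves (C := fun i => RFace K.faces i → (ℤ →₀ Lat lam))
      (bd K.faces fun a b => mapZ (latShift lam (hol G.g a b 1)) ∘ₗ sh (hol G.g a b 0))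
      (total K.faces (latTotal lam ∘ₗ sumZ ℤ)) := by
  let e : ((Fin 2 → ℤ) →₀ ℤ) ≃ₗ[ℤ] (ℤ →₀ ℤ →₀ ℤ) :=
    (Finsupp.domLCongr (finTwoArrowEquiv ℤ)).trans (Finsupp.curryLinearEquiv ℤ)
  have he : ∀ n a, e (Finsupp.single n a) = Finsupp.single (n 0) (Finsupp.single (n 1) a) :=
    fun n a => by
      simp [e, Finsupp.curryLinearEquiv, Finsupp.curry_single]
  have h1 : Resolves (C := fun i => RFace K.faces i → (ℤ →₀ ℤ →₀ ℤ))
      (bd K.faces fun a b => mapZ (sh (hol G.g a b 1)) ∘ₗ sh (hol G.g a b 0))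
      (total K.faces (sumZ ℤ ∘ₗ sumZ ℤ)) := by
    refine (G.resolves hG hne).of_equiv (D := fun i => RFace K.faces i → (ℤ →₀ ℤ →₀ ℤ))
      (fun i => LinearEquiv.piCongrRight fun _ => e)
      (fun i w => bd_map K.faces _ _ e.toLinearMap (fun a b w => ?_) i w) _ fun w => ?_
    · suffices h : e.toLinearMap ∘ₗ holShift G.g a b =
          (mapZ (sh (hol G.g a b 1)) ∘ₗ sh (hol G.g a b 0)) ∘ₗ e.toLinearMap from
        LinearMap.congr_fun h w
      refine Finsupp.lhom_ext fun n a => ?_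
      simp [holShift, he]
    · have h2 := total_compLeft K.faces e.toLinearMap (sumZ ℤ ∘ₗ sumZ ℤ) w
      have h3 : (sumZ ℤ ∘ₗ sumZ ℤ) ∘ₗ e.toLinearMap = sumZ (Fin 2 → ℤ) := by
        refine Finsupp.lhom_ext fun n a => ?_
        simp [he]
      rw [h3] at h2
      exact h2
  refine IsQuotientBy.resolves h1 (isQuotientBy_bd K.faces (π := mapZ (toLat lam))
    (x := mapZ (mulX lam)) (fun a b w => ?_) (fun a b w => ?_) (fun w hw => ?_)
    (fun w => ⟨mapZ (ofLat lam) w, ?_⟩) (fun w => ?_) (mapZ_ker (mulX_inj lam) (toLat_ker lam)))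
    _ (Int.castAddHom (ZMod 2)).toIntLinearMap (ZMod.intCast_surjective)
    (2 • LinearMap.id) zmod_two_ker (fun n hn => by simpa using hn) (fun w => ?_) (fun w => ?_)
  · simp only [LinearMap.comp_apply]
    rw [← sh_mapZ]
    ext1 n
    exact toLat_sh lam _ _
  · simp only [LinearMap.comp_apply]
    rw [← sh_mapZ]
    ext1 n
    exact mulX_sh lam _ _
  · ext1 n
    exact mulX_inj lam _ (DFunLike.congr_fun hw n)
  · ext1 n
    exact toLat_ofLat lam _
  · ext1 n
    exact toLat_mulX lam _
  · rw [total_compLeft, comp_total]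
    congr 2
    refine Finsupp.lhom_ext fun n a => ?_
    simp only [LinearMap.comp_apply, Finsupp.mapRange.linearMap_apply, Finsupp.mapRange_single,
      sumZ_single]
    exact latTotal_toLat lam a
  · rw [total_compLeft]
    have : (sumZ ℤ ∘ₗ sumZ ℤ) ∘ₗ mapZ (mulX lam) = (2 • LinearMap.id) ∘ₗ (sumZ ℤ ∘ₗ sumZ ℤ) := by
      refine Finsupp.lhom_ext fun n a => ?_
      simp [sumZ_mulX]
    rw [this, ← comp_total]

theorem sh_sub_inj {M : Type*} [AddCommGroup M] (w : ℤ →₀ M)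
    (hw : (sh 1 - LinearMap.id : (ℤ →₀ M) →ₗ[ℤ] ℤ →₀ M) w = 0) : w = 0 := by
  refine eq_zero_of_periodic w 1 one_ne_zero fun n hn h' => hn ?_
  have h1 := DFunLike.congr_fun hw (n + 1)
  simp only [LinearMap.sub_apply, LinearMap.id_apply, Finsupp.sub_apply, sh_apply, h', sub_zero,
    Finsupp.zero_apply] at h1
  exact h1

theorem sumZ_sh {M : Type*} [AddCommGroup M] (m : ℤ) (w : ℤ →₀ M) :
    sumZ ℤ (sh m w) = sumZ ℤ w := by
  induction w using Finsupp.induction_linear with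
  | zero => simp
  | add f g hf hg => simp only [map_add, hf, hg]
  | single n a => simp

/-- Moving a coefficient by one place changes the function by an element of the image, so modulo the
image everything can be collected at `0`. -/
theorem sumZ_ker {M : Type*} [AddCommGroup M] (w : ℤ →₀ M) (hw : sumZ ℤ w = 0) :
    ∃ w', (sh 1 - LinearMap.id : (ℤ →₀ M) →ₗ[ℤ] ℤ →₀ M) w' = w := by
  have key : ∀ w : ℤ →₀ M, w - Finsupp.single 0 (sumZ ℤ w) ∈
      LinearMap.range (sh 1 - LinearMap.id : (ℤ →₀ M) →ₗ[ℤ] _) := by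
    intro w
    induction w using Finsupp.induction_linear with
    | zero => simp
    | add f g hf hg =>
      have := add_mem hf hg
      rwa [sub_add_sub_comm, ← Finsupp.single_add, ← map_add] at this
    | single n a =>
      rw [sumZ_single]
      have hstep : ∀ n : ℤ, (Finsupp.single (n + 1) a - Finsupp.single 0 a) -
          (Finsupp.single n a - Finsupp.single 0 a) ∈
          LinearMap.range (sh 1 - LinearMap.id : (ℤ →₀ M) →ₗ[ℤ] _) := fun n =>
        ⟨Finsupp.single n a, by simp⟩
      induction n using Int.induction_on with
      | zero => simp
      | succ i ih => exact (Submodule.sub_mem_iff_left _ ih).mp (hstep i)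
      | pred i ih =>
        have := hstep (-i - 1)
        rw [sub_add_cancel] at this
        exact (Submodule.sub_mem_iff_right _ ih).mp this
  have := key w
  rwa [hw, Finsupp.single_zero, sub_zero] at this

theorem sumZ_mapZ {M N : Type*} [AddCommGroup M] [AddCommGroup N] (f : M →ₗ[ℤ] N) (w : ℤ →₀ M) :
    sumZ ℤ (mapZ f w) = f (sumZ ℤ w) := by
  induction w using Finsupp.induction_linear with
  | zero => simp
  | add f g hf hg => simp only [map_add, hf, hg]
  | single n a => simp

/-- The coefficients wanted on the torus ignore coordinate `0`, so its variable is put equal to `1`.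
Dividing by `s - 1`, which acts as zero on `ℤ/2`, leaves a group of order `2` in each of the degrees
`0` and `1`. -/
theorem LogSystem.isQuotientBy_torus (g : ι → (ι → ℝ) → Fin 2 → ℝ) (A : Set (Finset ι)) :
    IsQuotientBy (C := fun i => RFace A i → (ℤ →₀ Lat lam)) (D := fun i => RFace A i → Lat lam)
      (bd A fun a b => mapZ (latShift lam (hol g a b 1)) ∘ₗ sh (hol g a b 0))
      (bd A fun a b => latShift lam (hol g a b 1))
      (fun i => (sh 1 - LinearMap.id : (ℤ →₀ Lat lam) →ₗ[ℤ] _).compLeft (RFace A i))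
      (fun i => (sumZ ℤ).compLeft (RFace A i)) := by
  refine isQuotientBy_bd A (fun a b w => ?_) (fun a b w => ?_) sh_sub_inj
    (fun w => ⟨Finsupp.single 0 w, by simp⟩) (fun w => ?_) sumZ_ker
  · rw [LinearMap.comp_apply, sumZ_mapZ, sumZ_sh]
  · simp only [LinearMap.comp_apply, LinearMap.sub_apply, LinearMap.id_apply, map_sub]
    rw [sh_sh (hol g a b 0) 1, sh_mapZ _ 1]
  · rw [LinearMap.sub_apply, map_sub, sumZ_sh, LinearMap.id_apply, sub_self]

theorem total_sh_sub (A : Set (Finset ι)) (w : RFace A 0 → (ℤ →₀ Lat lam)) :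
    total A (latTotal lam ∘ₗ sumZ ℤ)
      ((sh 1 - LinearMap.id : (ℤ →₀ Lat lam) →ₗ[ℤ] _).compLeft (RFace A 0) w) = 0 := by
  rw [total_compLeft]
  have : (latTotal lam ∘ₗ sumZ ℤ) ∘ₗ (sh 1 - LinearMap.id) = 0 := LinearMap.ext fun w => by
    rw [LinearMap.comp_apply, LinearMap.comp_apply, LinearMap.sub_apply, map_sub, sumZ_sh,
      LinearMap.id_apply, sub_self, map_zero, LinearMap.zero_apply]
  rw [this]
  simp [total]

theorem LogSystem.homIndex_of_torus {c : (ι → ℝ) → Fin 2 → Circle} (G : LogSystem K c)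
    (hG : Exact G.good) (hne : (realization K).Nonempty) (i : ℕ) :
    homIndex (C := fun i => RFace K.faces i → Lat lam)
      (bd K.faces fun a b => latShift lam (hol G.g a b 1)) i = if i ≤ 1 then 2 else 1 := by
  exact IsQuotientBy.homIndex_eq
    (C := fun i => RFace K.faces i → (ℤ →₀ Lat lam)) (D := fun i => RFace K.faces i → Lat lam)
    (G.resolves_torus lam hG hne) (LogSystem.isQuotientBy_torus lam G.g K.faces)
    (total_sh_sub lam K.faces) i

theorem LogSystem.d_d_of_circle {c : (ι → ℝ) → Unit → Circle} (G : LogSystem K c)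
    (hG : Exact G.good) (hne : (realization K).Nonempty) (i : ℕ)
    (w : RFace K.faces (i + 2) → Lat lam) :
    bd K.faces (fun a b => latShift lam (hol G.g a b ())) i
      (bd K.faces (fun a b => latShift lam (hol G.g a b ())) (i + 1) w) = 0 :=
  (G.resolves_lat lam hG hne).d_d i w

theorem LogSystem.d_d_of_torus {c : (ι → ℝ) → Fin 2 → Circle} (G : LogSystem K c)
    (hG : Exact G.good) (hne : (realization K).Nonempty) (i : ℕ)
    (w : RFace K.faces (i + 2) → Lat lam) :
    bd K.faces (fun a b => latShift lam (hol G.g a b 1)) i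
      (bd K.faces (fun a b => latShift lam (hol G.g a b 1)) (i + 1) w) = 0 :=
  (LogSystem.isQuotientBy_torus lam G.g K.faces).d_d (G.resolves_torus lam hG hne) i w

end SurgeryTorsion

/-! ### Torsion of based complexes: existence, and uniqueness up to sign -/

namespace SurgeryTorsion

open Module

section Families

variable {C : ℕ → Type*} [∀ i, AddCommGroup (C i)] [∀ i, Module ℂ (C i)]
variable {κ : ℕ → Type*} [∀ i, Fintype (κ i)] [∀ i, DecidableEq (κ i)]

theorem norm_det_comp {M ι κ : Type*} [AddCommGroup M] [Module ℂ M] [Fintype κ] [DecidableEq κ]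
    (c : Basis κ ℂ M) (F : ι → M) (e e' : κ ≃ ι) : ‖c.det (F ∘ e)‖ = ‖c.det (F ∘ e')‖ := by
  have h : F ∘ e' = (F ∘ e) ∘ (e'.trans e.symm) := by ext k; simp
  rw [h, c.det.map_perm]
  rcases Int.units_eq_one_or (Equiv.Perm.sign (e'.trans e.symm)) with h | h <;> rw [h] <;> simp

/-- The family `∂ b̃_{i+1} ∪ b̃_i`. -/
def fam {k : Type*} [CommRing k] {C : ℕ → Type*} [∀ i, AddCommGroup (C i)] [∀ i, Module k (C i)]
    {I : ℕ → Type*} (d : ∀ i, C (i + 1) →ₗ[k] C i) (b : ∀ i, I i → C i) (i : ℕ) :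
    I (i + 1) ⊕ I i → C i :=
  Sum.elim (fun l => d i (b (i + 1) l)) (b i)

/-- The boundaries lie in the kernel of `d`, while `d` is injective on the span of `b`, so the two
halves meet trivially. The ring is general because this is used over `ℂ` and over `ℤ`. -/
theorem linearIndependent_fam {k : Type*} [CommRing k] {C : ℕ → Type*} [∀ i, AddCommGroup (C i)]
    [∀ i, Module k (C i)] {I : ℕ → Type*} {d : ∀ i, C (i + 1) →ₗ[k] C i} {b : ∀ i, I i → C i}
    (h0 : IsEmpty (I 0)) (hdd : ∀ i x, d i (d (i + 1) x) = 0)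
    (hli : ∀ i, LinearIndependent k fun l => d i (b (i + 1) l)) (i : ℕ) :
    LinearIndependent k (fam d b i) := by
  cases i with
  | zero =>
    refine (hli 0).sum_type (linearIndependent_empty_type (v := b 0)) ?_
    rw [Set.range_eq_empty (b 0), Submodule.span_empty]
    exact disjoint_bot_right
  | succ i =>
    have h1 : LinearIndependent k (d i ∘ b (i + 1)) := hli i
    refine (hli (i + 1)).sum_type (h1.of_comp _) ?_
    refine ((Submodule.range_ker_disjoint h1).mono_right ?_).symm
    rw [Submodule.span_le]
    rintro _ ⟨l, rfl⟩
    exact hdd i _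

/-- A family with nonzero determinants and `∂ ∂ = 0` proves acyclicity. -/
theorem acyclic_of_det_ne_zero {d : ∀ i, C (i + 1) →ₗ[ℂ] C i} {c : ∀ i, Basis (κ i) ℂ (C i)}
    {I : ℕ → Type*} {b : ∀ i, I i → C i} (e : ∀ i, κ i ≃ I (i + 1) ⊕ I i) (h0 : IsEmpty (I 0))
    (hdd : ∀ i x, d i (d (i + 1) x) = 0) (hdet : ∀ i, (c i).det (fam d b i ∘ e i) ≠ 0) :
    Acyclic d ∧ ∀ i, LinearIndependent ℂ (fun l => d i (b (i + 1) l)) ∧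
      Submodule.span ℂ (Set.range fun l => d i (b (i + 1) l)) = LinearMap.range (d i) := by
  have hb : ∀ i, LinearIndependent ℂ (fam d b i) ∧
      Submodule.span ℂ (Set.range (fam d b i)) = ⊤ := fun i => by
    have := (c i).is_basis_iff_det.mpr (isUnit_iff_ne_zero.mpr (hdet i))
    rw [EquivLike.range_comp] at this
    exact ⟨(linearIndependent_equiv (e i)).mp this.1, this.2⟩
  have hli : ∀ i, LinearIndependent ℂ (fun l => d i (b (i + 1) l)) := fun i =>
    (hb i).1.comp Sum.inl Sum.inl_injective
  have hle : ∀ i, Submodule.span ℂ (Set.range fun l => d i (b (i + 1) l)) ≤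
      LinearMap.range (d i) := fun i => by
    rw [Submodule.span_le]
    rintro _ ⟨l, rfl⟩
    exact ⟨_, rfl⟩
  have hspan : ∀ i, Submodule.span ℂ (Set.range fun l => d i (b (i + 1) l)) =
      LinearMap.range (d i) := fun i => by
    refine le_antisymm (hle i) ?_
    rw [LinearMap.range_eq_map, ← (hb (i + 1)).2, Submodule.map_span_le]
    rintro _ ⟨l | l, rfl⟩
    · simp only [fam, Sum.elim_inl, hdd, Submodule.zero_mem]
    · exact Submodule.subset_span ⟨l, rfl⟩
  refine ⟨⟨?_, fun i => le_antisymm ?_ ?_⟩, fun i => ⟨hli i, hspan i⟩⟩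
  · rw [← LinearMap.range_eq_top, ← hspan, ← (hb 0).2, fam, Set.Sum.elim_range,
      Set.range_eq_empty (b 0), Set.union_empty]
  · rintro _ ⟨x, rfl⟩
    exact hdd i x
  · intro x hx
    have hx' : x ∈ Submodule.span ℂ (Set.range (fam d b (i + 1))) := by
      rw [(hb (i + 1)).2]; trivial
    rw [fam, Set.Sum.elim_range, Submodule.span_union, Submodule.mem_sup] at hx'
    obtain ⟨y, hy, z, hz, rfl⟩ := hx'
    rw [hspan] at hy
    obtain ⟨y, rfl⟩ := hy
    have hz' : z ∈ LinearMap.ker (d i) := by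
      rw [LinearMap.mem_ker, map_add, hdd, zero_add] at hx
      exact hx
    have h1 : LinearIndependent ℂ (d i ∘ b (i + 1)) := hli i
    rw [Submodule.disjoint_def.mp (Submodule.range_ker_disjoint h1) z hz hz', add_zero]
    exact ⟨y, rfl⟩

end Families

section HasTorsion

variable {C : ℕ → Type*} [∀ i, AddCommGroup (C i)] [∀ i, Module ℂ (C i)]
variable {κ : ℕ → Type*} [∀ i, Fintype (κ i)] [∀ i, DecidableEq (κ i)]

/-- The complex is acyclic and `t` is the absolute value of a value of its torsion. -/
def HasTorsion (d : ∀ i, C (i + 1) →ₗ[ℂ] C i) (c : ∀ i, Basis (κ i) ℂ (C i)) (n : ℕ) (t : ℝ) :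
    Prop :=
  Acyclic d ∧ ∃ τ, IsTorsion d c n τ ∧ ‖τ‖ = t

variable {d : ∀ i, C (i + 1) →ₗ[ℂ] C i} {c : ∀ i, Basis (κ i) ℂ (C i)} {n : ℕ} {t t' : ℝ}

theorem HasTorsion.of_families {I : ℕ → Type*} [∀ i, Fintype (I i)] (b : ∀ i, I i → C i)
    (e : ∀ i, κ i ≃ I (i + 1) ⊕ I i) (h0 : IsEmpty (I 0))
    (hdd : ∀ i x, d i (d (i + 1) x) = 0) (hdet : ∀ i, (c i).det (fam d b i ∘ e i) ≠ 0) :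
    HasTorsion d c n (∏ i ∈ Finset.range n,
      ‖(c i).det (fam d b i ∘ e i)‖ ^ ((-1 : ℤ) ^ (i + 1))) := by
  obtain ⟨h1, h2⟩ := acyclic_of_det_ne_zero e h0 hdd hdet
  have key : ∀ i, (fun k => Sum.elim
      (fun l => d i ((b (i + 1) ∘ (Fintype.equivFin (I (i + 1))).symm) l))
      (b i ∘ (Fintype.equivFin (I i)).symm)
      (((e i).trans (Equiv.sumCongr (Fintype.equivFin _) (Fintype.equivFin _))) k)) =
      fam d b i ∘ e i := fun i => by
    ext k
    rcases h : e i k with l | l <;> simp [fam, h]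
  refine ⟨h1, _, ⟨fun i => Fintype.card (I i), fun i => b i ∘ (Fintype.equivFin (I i)).symm,
    fun i => (e i).trans (Equiv.sumCongr (Fintype.equivFin _) (Fintype.equivFin _)),
    Fintype.card_eq_zero, fun i => ⟨?_, ?_⟩, rfl⟩, ?_⟩
  · exact (h2 i).1.comp _ (Fintype.equivFin (I (i + 1))).symm.injective
  · rw [← (h2 i).2]
    exact congrArg _ (EquivLike.range_comp (fun l => d i (b (i + 1) l))
      (Fintype.equivFin (I (i + 1))).symm)
  · rw [norm_prod]
    refine Finset.prod_congr rfl fun i _ => ?_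
    rw [norm_zpow, key]

theorem Acyclic.d_d (h : Acyclic d) (i : ℕ) (x : C (i + 2)) : d i (d (i + 1) x) = 0 := by
  have : d (i + 1) x ∈ LinearMap.ker (d i) := h.2 i ▸ ⟨x, rfl⟩
  exact this

theorem det_ne_zero_of_linearIndependent {M κ : Type*} [AddCommGroup M] [Module ℂ M] [Fintype κ]
    [DecidableEq κ] (c : Basis κ ℂ M) {F : κ → M} (h : LinearIndependent ℂ F) : c.det F ≠ 0 := by
  have := Module.Finite.of_basis c
  refine (c.is_basis_iff_det.mp ⟨h, ?_⟩).ne_zero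
  exact h.span_eq_top_of_card_eq_finrank' (finrank_eq_card_basis c).symm

theorem det_ne_zero_of_isTorsion (h : Acyclic d) {r : ℕ → ℕ} {b : ∀ i, Fin (r i) → C i}
    {e : ∀ i, κ i ≃ Fin (r (i + 1)) ⊕ Fin (r i)} (h0 : r 0 = 0)
    (hb : ∀ i, LinearIndependent ℂ (fun k => d i (b (i + 1) k))) (i : ℕ) :
    (c i).det (fam d b i ∘ e i) ≠ 0 := by
  have h0' : IsEmpty (Fin (r 0)) := by rw [h0]; infer_instance
  refine det_ne_zero_of_linearIndependent _ ?_
  exact (linearIndependent_fam (k := ℂ) h0' h.d_d hb i).comp _ (e i).injective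

/-- The families computing the torsion. -/
theorem HasTorsion.exists_families (h : HasTorsion d c n t) :
    ∃ (r : ℕ → ℕ) (b : ∀ i, Fin (r i) → C i) (e : ∀ i, κ i ≃ Fin (r (i + 1)) ⊕ Fin (r i)),
      r 0 = 0 ∧ (∀ i, (c i).det (fam d b i ∘ e i) ≠ 0) ∧
      t = ∏ i ∈ Finset.range n, ‖(c i).det (fam d b i ∘ e i)‖ ^ ((-1 : ℤ) ^ (i + 1)) := by
  obtain ⟨h1, τ, ⟨r, b, e, h0, hb, rfl⟩, rfl⟩ := h
  refine ⟨r, b, e, h0, det_ne_zero_of_isTorsion h1 h0 fun i => (hb i).1, ?_⟩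
  rw [norm_prod]
  refine Finset.prod_congr rfl fun i _ => ?_
  rw [norm_zpow]
  rfl

theorem HasTorsion.pos (h : HasTorsion d c n t) : 0 < t := by
  obtain ⟨r, b, e, -, h1, rfl⟩ := h.exists_families
  exact Finset.prod_pos fun i _ => zpow_pos (norm_pos_iff.mpr (h1 i)) _

/-- Lift bases of the images; by rank-nullity and acyclicity the family has as many members as the
basis. -/
theorem exists_hasTorsion (h : Acyclic d) (c : ∀ i, Basis (κ i) ℂ (C i)) (n : ℕ) :
    ∃ t, HasTorsion d c n t := by
  have hfin : ∀ i, Module.Finite ℂ (C i) := fun i => Module.Finite.of_basis (c i)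
  let r : ℕ → ℕ := fun i => match i with
    | 0 => 0
    | i + 1 => finrank ℂ (LinearMap.range (d i))
  have hch : ∀ i, ∃ b : Fin (r (i + 1)) → C (i + 1),
      LinearIndependent ℂ (fun k => d i (b k)) := fun i => by
    let B := finBasis ℂ (LinearMap.range (d i))
    choose b hb using fun k => (B k).2
    refine ⟨b, ?_⟩
    have := B.linearIndependent.map' (LinearMap.range (d i)).subtype (Submodule.ker_subtype _)
    rwa [show (fun k => d i (b k)) = (LinearMap.range (d i)).subtype ∘ B from funext hb]
  choose b hb using hch
  let b' : ∀ i, Fin (r i) → C i := fun i => match i with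
    | 0 => fun k => k.elim0
    | i + 1 => b i
  have h0 : IsEmpty (Fin (r 0)) := by change IsEmpty (Fin 0); infer_instance
  have hli := linearIndependent_fam (k := ℂ) (b := b') h0 h.d_d hb
  have hcard : ∀ i, Fintype.card (κ i) = r (i + 1) + r i := fun i => by
    rw [← finrank_eq_card_basis (c i)]
    cases i with
    | zero =>
      change _ = finrank ℂ (LinearMap.range (d 0)) + 0
      rw [LinearMap.range_eq_top.mpr h.1, finrank_top, add_zero]
    | succ i =>
      change _ = finrank ℂ (LinearMap.range (d (i + 1))) + finrank ℂ (LinearMap.range (d i))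
      rw [h.2 i]
      exact (LinearMap.finrank_range_add_finrank_ker (d i)).symm.trans (add_comm _ _)
  have he : ∀ i, Nonempty (κ i ≃ Fin (r (i + 1)) ⊕ Fin (r i)) := fun i =>
    Fintype.card_eq.mp (by simp [hcard])
  let e := fun i => (he i).some
  exact ⟨_, .of_families b' e h0 h.d_d fun i =>
    det_ne_zero_of_linearIndependent _ ((hli i).comp _ (e i).injective)⟩

theorem prod_telescope (p : ℕ → ℝ) (hp : ∀ i, p i ≠ 0) (n : ℕ) :
    ∏ i ∈ Finset.range n, (p (i + 1) * p i) ^ ((-1 : ℤ) ^ (i + 1)) =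
      p n ^ ((-1 : ℤ) ^ n) / p 0 := by
  induction n with
  | zero => simp [hp]
  | succ n ih =>
    rw [Finset.prod_range_succ, ih, mul_zpow, pow_succ, mul_neg_one, zpow_neg, zpow_neg]
    have h1 := zpow_ne_zero ((-1 : ℤ) ^ n) (hp n)
    field_simp

/-- Modulo boundaries `b' i` is obtained from `b i` by a matrix `P i`, and the same matrix relates
their boundaries. The base change is block triangular with diagonal `P (i + 1)`, `P i`, and these
factors telescope in the torsion. -/
theorem det_fam_change {r : ℕ → ℕ} {b b' : ∀ i, Fin (r i) → C i}
    {e : ∀ i, κ i ≃ Fin (r (i + 1)) ⊕ Fin (r i)} (h : Acyclic d) (h0 : r 0 = 0)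
    (hb : ∀ i, (c i).det (fam d b i ∘ e i) ≠ 0) :
    ∃ p : ℕ → ℂ, (∀ i, r i = 0 → p i = 1) ∧ ∀ i, (c i).det (fam d b' i ∘ e i) =
      (c i).det (fam d b i ∘ e i) * (p (i + 1) * p i) := by
  have h0' : IsEmpty (Fin (r 0)) := by rw [h0]; infer_instance
  let B : ∀ i, Basis (Fin (r (i + 1)) ⊕ Fin (r i)) ℂ (C i) := fun i => by
    have hb1 := (c i).is_basis_iff_det.mpr (isUnit_iff_ne_zero.mpr (hb i))
    refine Basis.mk (v := fam d b i) ((linearIndependent_equiv (e i)).mp hb1.1) ?_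
    rw [← hb1.2, EquivLike.range_comp]
  have hB : ∀ i, ⇑(B i) = fam d b i := fun i => Basis.coe_mk _ _
  let P : ∀ i, Matrix (Fin (r i)) (Fin (r i)) ℂ := fun i k l => (B i).repr (b' i l) (Sum.inr k)
  refine ⟨fun i => (P i).det, fun i hi => ?_, fun i => ?_⟩
  · have : IsEmpty (Fin (r i)) := by rw [hi]; infer_instance
    exact Matrix.det_isEmpty
  · have h1 : ∀ l, d i (b' (i + 1) l) = ∑ k, P (i + 1) k l • d i (b (i + 1) k) := fun l => by
      conv_lhs => rw [← (B (i + 1)).sum_repr (b' (i + 1) l)]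
      rw [Fintype.sum_sum_type]
      simp only [hB, fam, Sum.elim_inl, Sum.elim_inr, map_add, map_sum, map_smul, h.d_d, smul_zero,
        Finset.sum_const_zero, zero_add]
      rfl
    have h2 : (B i).toMatrix (fam d b' i) = Matrix.fromBlocks (P (i + 1))
        (Matrix.of fun k l => (B i).repr (b' i l) (Sum.inl k)) 0 (P i) := by
      ext k l
      rcases l with l | l
      · have h3 : fam d b' i (Sum.inl l) = ∑ k, P (i + 1) k l • B i (Sum.inl k) := by
          rw [hB]; exact h1 l
        rw [Basis.toMatrix_apply, h3, map_sum, Finsupp.finsetSum_apply]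
        simp only [map_smul, Basis.repr_self, Finsupp.smul_apply, smul_eq_mul]
        rcases k with k | k
        · rw [Finset.sum_eq_single k]
          · simp [Matrix.fromBlocks_apply₁₁]
          · intro j _ hj
            rw [Finsupp.single_eq_of_ne (by simpa using hj.symm), mul_zero]
          · simp
        · rw [Finset.sum_eq_zero]
          · simp [Matrix.fromBlocks_apply₂₁]
          · intro j _
            rw [Finsupp.single_eq_of_ne (by simp), mul_zero]
      · rcases k with k | k <;> rfl
    have h3 : (B i).det (fam d b' i) = (P (i + 1)).det * (P i).det := by
      rw [Basis.det_apply, h2, Matrix.det_fromBlocks_zero₂₁]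
    rw [← h3, ← Basis.det_reindex, ← Basis.det_reindex, ← hB]
    rw [Basis.det_apply, Basis.det_apply, Basis.det_apply, ← Matrix.det_mul,
      Basis.toMatrix_mul_toMatrix]

/-- The torsion is well defined up to sign. -/
theorem HasTorsion.unique (h : HasTorsion d c n t) (h' : HasTorsion d c n t')
    (hn : IsEmpty (κ n)) : t = t' := by
  obtain ⟨r, b, e, h0, hdet, rfl⟩ := h.exists_families
  obtain ⟨r', b', e', h0', hdet', rfl⟩ := h'.exists_families
  -- The ranks are forced by `r 0 = 0` and `card (κ i) = r (i + 1) + r i`.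
  have hr : r = r' := by
    ext i
    induction i with
    | zero => rw [h0, h0']
    | succ i ih =>
      have h1 := Fintype.card_congr (e i)
      have h2 := Fintype.card_congr (e' i)
      simp only [Fintype.card_sum, Fintype.card_fin] at h1 h2
      omega
  subst hr
  -- The complex vanishes in degree `n`, so the last factor left by the telescoping is `1`.
  have hrn : r n = 0 := by
    have h1 := Fintype.card_congr (e n)
    simp only [Fintype.card_sum, Fintype.card_fin, Fintype.card_eq_zero] at h1
    omega
  obtain ⟨p, hp1, hp⟩ := det_fam_change (b' := b') h.1 h0 hdet
  have hp0 : ∀ i, p i ≠ 0 := fun i hi => hdet' i (by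
    rw [← norm_eq_zero, norm_det_comp _ _ _ (e i), hp, hi]
    simp)
  rw [← mul_one (∏ i ∈ Finset.range n, ‖(c i).det (fam d b i ∘ e i)‖ ^ ((-1 : ℤ) ^ (i + 1)))]
  have h3 := prod_telescope (fun i => ‖p i‖) (fun i => norm_ne_zero_iff.mpr (hp0 i)) n
  simp only [hp1 n hrn, hp1 0 h0, norm_one, one_zpow, div_one] at h3
  rw [← h3, ← Finset.prod_mul_distrib]
  refine Finset.prod_congr rfl fun i _ => ?_
  rw [norm_det_comp _ (fam d b' i) (e' i) (e i), hp, norm_mul, norm_mul, ← mul_zpow]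

theorem HasTorsion.norm_torsion (h : HasTorsion d c n t) (hn : IsEmpty (κ n)) :
    ‖torsion d c n‖ = t := by
  obtain ⟨h1, τ, h2, h3⟩ := id h
  have hex : ∃ τ, IsTorsion d c n τ := ⟨τ, h2⟩
  rw [torsion, dif_pos hex]
  exact HasTorsion.unique ⟨h1, _, hex.choose_spec, rfl⟩ h hn

/-- The Euler characteristic of an acyclic complex is zero. -/
theorem Acyclic.prod_zpow (h : Acyclic d) (c : ∀ i, Basis (κ i) ℂ (C i)) (hn : IsEmpty (κ n))
    {D : ℝ} (hD : D ≠ 0) :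
    ∏ i ∈ Finset.range n, (D ^ Fintype.card (κ i)) ^ ((-1 : ℤ) ^ (i + 1)) = 1 := by
  obtain ⟨t, ht⟩ := exists_hasTorsion h c n
  obtain ⟨r, b, e, h0, -, -⟩ := ht.exists_families
  have hcard : ∀ i, Fintype.card (κ i) = r (i + 1) + r i := fun i => by
    simpa using Fintype.card_congr (e i)
  have hrn : r n = 0 := by
    have := hcard n
    rw [Fintype.card_eq_zero] at this
    omega
  have h3 := prod_telescope (fun i => D ^ r i) (fun i => pow_ne_zero _ hD) n
  simp only [hrn, h0, pow_zero, one_zpow, div_one, ← pow_add] at h3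
  rw [← h3]
  simp only [hcard]

end HasTorsion

end SurgeryTorsion

/-! ### Isomorphisms, exact sequences and direct sums -/

namespace SurgeryTorsion

open Module

section Determinants

theorem det_map_equiv {M N κ κ' : Type*} [AddCommGroup M] [Module ℂ M] [AddCommGroup N]
    [Module ℂ N] [Fintype κ] [DecidableEq κ] [Fintype κ'] [DecidableEq κ'] (c : Basis κ ℂ M)
    (c' : Basis κ' ℂ N) (φ : M ≃ₗ[ℂ] N) (ε : κ' ≃ κ) (F : κ → M) :
    c'.det (φ ∘ F ∘ ε) = c'.det (φ ∘ c ∘ ε) * c.det F := by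
  let B := (c.map φ).reindex ε.symm
  have hB : ⇑B = φ ∘ c ∘ ε := by ext k; simp [B]
  have h1 : B.det (φ ∘ F ∘ ε) = c.det F := by
    rw [Basis.det_reindex, Basis.det_map]
    congr 1
    ext k
    simp
  rw [← h1, ← hB, Basis.det_apply, Basis.det_apply, Basis.det_apply, ← Matrix.det_mul,
    Basis.toMatrix_mul_toMatrix]

/-- The matrix of `F` is block triangular: the part of `F` that comes from `M'` has no components
along the basis vectors that lift `c''`. -/
theorem det_of_exact {M' M M'' κ' κ κ'' : Type*} [AddCommGroup M'] [Module ℂ M'] [AddCommGroup M]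
    [Module ℂ M] [AddCommGroup M''] [Module ℂ M''] [Fintype κ'] [DecidableEq κ'] [Fintype κ]
    [DecidableEq κ] [Fintype κ''] [DecidableEq κ''] {c' : Basis κ' ℂ M'} {c : Basis κ ℂ M}
    {c'' : Basis κ'' ℂ M''} {inc : M' →ₗ[ℂ] M} {pr : M →ₗ[ℂ] M''} {s : κ' ⊕ κ'' ≃ κ}
    (h1 : ∀ k, c (s (Sum.inl k)) = inc (c' k)) (h2 : ∀ k, pr (c (s (Sum.inr k))) = c'' k)
    (h0 : ∀ x, pr (inc x) = 0) {F : κ → M} {F' : κ' → M'} {F'' : κ'' → M''}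
    (hF' : ∀ k, F (s (Sum.inl k)) = inc (F' k)) (hF'' : ∀ k, pr (F (s (Sum.inr k))) = F'' k) :
    c.det F = c'.det F' * c''.det F'' := by
  have r1 : ∀ k x, c.repr (inc x) (s (Sum.inl k)) = c'.repr x k := fun k => by
    suffices h : Finsupp.lapply (s (Sum.inl k)) ∘ₗ c.repr.toLinearMap ∘ₗ inc =
      Finsupp.lapply k ∘ₗ c'.repr.toLinearMap from LinearMap.congr_fun h
    refine c'.ext fun l => ?_
    simp [← h1, Finsupp.single_apply]
  have r2 : ∀ k x, c.repr (inc x) (s (Sum.inr k)) = 0 := fun k => by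
    suffices h : Finsupp.lapply (s (Sum.inr k)) ∘ₗ c.repr.toLinearMap ∘ₗ inc = 0 from
      LinearMap.congr_fun h
    refine c'.ext fun l => ?_
    simp [← h1]
  have r3 : ∀ k x, c.repr x (s (Sum.inr k)) = c''.repr (pr x) k := fun k => by
    suffices h : Finsupp.lapply (s (Sum.inr k)) ∘ₗ c.repr.toLinearMap =
      Finsupp.lapply k ∘ₗ c''.repr.toLinearMap ∘ₗ pr from LinearMap.congr_fun h
    refine c.ext fun l => ?_
    obtain ⟨l | l, rfl⟩ := s.surjective l
    · simp [h1, r2, h0]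
    · simp [h2, Finsupp.single_apply]
  have hs : F = (F ∘ s) ∘ s.symm := by ext k; simp
  rw [hs, ← Basis.det_reindex, Basis.det_apply, Basis.det_apply, Basis.det_apply,
    ← Matrix.det_fromBlocks_zero₂₁ _
      (Matrix.of fun k l => c.repr (F (s (Sum.inr l))) (s (Sum.inl k)))]
  congr 1
  ext k l
  rcases k with k | k <;> rcases l with l | l <;>
    simp [Basis.toMatrix_apply, hF', r1, r2, r3, hF'', Matrix.fromBlocks_apply₁₁,
      Matrix.fromBlocks_apply₁₂, Matrix.fromBlocks_apply₂₁, Matrix.fromBlocks_apply₂₂]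

theorem det_of_sum {M N κ K : Type*} [AddCommGroup M] [Module ℂ M] [AddCommGroup N] [Module ℂ N]
    [Fintype κ] [DecidableEq κ] [Fintype K] [DecidableEq K] {c : Basis κ ℂ M}
    {c' : Basis (κ × K) ℂ N} {inc : K → M →ₗ[ℂ] N} (h : ∀ x k, c' (x, k) = inc k (c x))
    (F : K → κ → M) : c'.det (fun x => inc x.2 (F x.2 x.1)) = ∏ k, c.det (F k) := by
  have r1 : ∀ k l x y, c'.repr (inc k y) (x, l) = if l = k then c.repr y x else 0 := by
    intro k l x
    have h1 : Finsupp.lapply (x, l) ∘ₗ c'.repr.toLinearMap ∘ₗ inc k =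
        (if l = k then (1 : ℂ) else 0) • (Finsupp.lapply x ∘ₗ c.repr.toLinearMap) := by
      refine c.ext fun y => ?_
      by_cases hl : l = k
      · subst hl
        by_cases hxy : y = x <;> simp [← h, hxy]
      · have : ¬ k = l := fun h => hl h.symm
        simp [← h, hl]
    intro y
    have := LinearMap.congr_fun h1 y
    by_cases hl : l = k
    · simpa [hl] using this
    · simpa [hl] using this
  simp only [Basis.det_apply]
  rw [← Matrix.det_blockDiagonal]
  congr 1
  ext ⟨x, k⟩ ⟨y, l⟩
  rw [Basis.toMatrix_apply, r1, Matrix.blockDiagonal_apply]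
  by_cases hkl : k = l
  · subst hkl; simp [Basis.toMatrix_apply]
  · simp [hkl]

end Determinants

section Operations

variable {C : ℕ → Type*} [∀ i, AddCommGroup (C i)] [∀ i, Module ℂ (C i)]
variable {κ : ℕ → Type*} [∀ i, Fintype (κ i)] [∀ i, DecidableEq (κ i)]
variable {d : ∀ i, C (i + 1) →ₗ[ℂ] C i} {c : ∀ i, Basis (κ i) ℂ (C i)} {n : ℕ} {t : ℝ}

/-- The isomorphisms need not preserve the bases; it is enough that their determinants cancel in the
alternating product. -/
theorem HasTorsion.map {D : ℕ → Type*} [∀ i, AddCommGroup (D i)] [∀ i, Module ℂ (D i)]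
    {κ' : ℕ → Type*} [∀ i, Fintype (κ' i)] [∀ i, DecidableEq (κ' i)]
    {d' : ∀ i, D (i + 1) →ₗ[ℂ] D i} (h : HasTorsion d c n t) (c' : ∀ i, Basis (κ' i) ℂ (D i))
    (φ : ∀ i, C i ≃ₗ[ℂ] D i) (hφ : ∀ i x, φ i (d i x) = d' i (φ (i + 1) x))
    (ε : ∀ i, κ' i ≃ κ i)
    (hq : ∏ i ∈ Finset.range n, ‖(c' i).det (φ i ∘ c i ∘ ε i)‖ ^ ((-1 : ℤ) ^ (i + 1)) = 1) :
    HasTorsion d' c' n t := by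
  obtain ⟨r, b, e, h0, hdet, rfl⟩ := h.exists_families
  have h0' : IsEmpty (Fin (r 0)) := by rw [h0]; infer_instance
  have hfam : ∀ i, (c' i).det (fam d' (fun i => φ i ∘ b i) i ∘ ((ε i).trans (e i))) =
      (c' i).det (φ i ∘ c i ∘ ε i) * (c i).det (fam d b i ∘ e i) := fun i => by
    rw [← det_map_equiv]
    congr 1
    ext k
    simp only [Function.comp_apply, Equiv.trans_apply, fam]
    rcases e i (ε i k) with l | l
    · simp [hφ]
    · simp
  have hne : ∀ i, (c' i).det (φ i ∘ c i ∘ ε i) ≠ 0 := fun i => by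
    refine det_ne_zero_of_linearIndependent _ ?_
    exact (((c i).linearIndependent.map' (φ i).toLinearMap (φ i).ker).comp _ (ε i).injective)
  have := HasTorsion.of_families (n := n) (c := c') (d := d') (fun i => φ i ∘ b i)
    (fun i => (ε i).trans (e i)) h0'
    (fun i x => by
      obtain ⟨x, rfl⟩ := (φ (i + 2)).surjective x
      rw [← hφ, ← hφ, h.1.d_d, map_zero])
    (fun i => by rw [hfam]; exact mul_ne_zero (hne i) (hdet i))
  convert this using 1
  rw [← one_mul (∏ i ∈ Finset.range n, _), ← hq, ← Finset.prod_mul_distrib]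
  refine Finset.prod_congr rfl fun i _ => ?_
  rw [hfam, norm_mul, mul_zpow]

section Exact

variable {C' : ℕ → Type*} [∀ i, AddCommGroup (C' i)] [∀ i, Module ℂ (C' i)]
variable {C'' : ℕ → Type*} [∀ i, AddCommGroup (C'' i)] [∀ i, Module ℂ (C'' i)]
variable {d' : ∀ i, C' (i + 1) →ₗ[ℂ] C' i} {d'' : ∀ i, C'' (i + 1) →ₗ[ℂ] C'' i}
variable {inc : ∀ i, C' i →ₗ[ℂ] C i} {pr : ∀ i, C i →ₗ[ℂ] C'' i}

/-- The torsion is multiplicative. -/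
theorem HasTorsion.of_exact {κ' κ'' : ℕ → Type*} [∀ i, Fintype (κ' i)] [∀ i, DecidableEq (κ' i)]
    [∀ i, Fintype (κ'' i)] [∀ i, DecidableEq (κ'' i)] {c' : ∀ i, Basis (κ' i) ℂ (C' i)}
    {c'' : ∀ i, Basis (κ'' i) ℂ (C'' i)} {t' t'' : ℝ} (h' : HasTorsion d' c' n t')
    (h'' : HasTorsion d'' c'' n t'') (hdd : ∀ i x, d i (d (i + 1) x) = 0)
    (hinc : ∀ i x, inc i (d' i x) = d i (inc (i + 1) x))
    (hpr : ∀ i x, pr i (d i x) = d'' i (pr (i + 1) x))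
    (h0 : ∀ i x, pr i (inc i x) = 0) (s : ∀ i, κ' i ⊕ κ'' i ≃ κ i)
    (h1 : ∀ i k, c i (s i (Sum.inl k)) = inc i (c' i k))
    (h2 : ∀ i k, pr i (c i (s i (Sum.inr k))) = c'' i k) : HasTorsion d c n (t' * t'') := by
  obtain ⟨r', b', e', h0', hdet', rfl⟩ := h'.exists_families
  obtain ⟨r'', b'', e'', h0'', hdet'', rfl⟩ := h''.exists_families
  have hsurj : ∀ i, Function.Surjective (pr i) := fun i => by
    rw [← LinearMap.range_eq_top, eq_top_iff, ← (c'' i).span_eq, Submodule.span_le]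
    rintro _ ⟨k, rfl⟩
    exact ⟨_, h2 i k⟩
  choose lift hlift using hsurj
  -- The images of the family of the subcomplex, together with arbitrary lifts of the family of the
  -- quotient.
  let b : ∀ i, Fin (r' i) ⊕ Fin (r'' i) → C i := fun i =>
    Sum.elim (fun l => inc i (b' i l)) fun l => lift i (b'' i l)
  let e : ∀ i, κ i ≃ (Fin (r' (i + 1)) ⊕ Fin (r'' (i + 1))) ⊕ (Fin (r' i) ⊕ Fin (r'' i)) :=
    fun i => (s i).symm.trans (((e' i).sumCongr (e'' i)).trans (Equiv.sumSumSumComm _ _ _ _))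
  have hfam : ∀ i, (c i).det (fam d b i ∘ e i) =
      (c' i).det (fam d' b' i ∘ e' i) * (c'' i).det (fam d'' b'' i ∘ e'' i) := fun i => by
    refine det_of_exact (h1 i) (h2 i) (h0 i) (fun k => ?_) fun k => ?_
    · rcases hk : e' i k with l | l <;> simp [e, fam, b, hk, hinc]
    · rcases hk : e'' i k with l | l <;> simp [e, fam, b, hk, hpr, hlift]
  have hE : IsEmpty (Fin (r' 0) ⊕ Fin (r'' 0)) := by
    rw [h0', h0'']
    infer_instance
  have := HasTorsion.of_families (n := n) (c := c) (d := d) b e hE hdd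
    (fun i => by rw [hfam]; exact mul_ne_zero (hdet' i) (hdet'' i))
  convert this using 1
  rw [← Finset.prod_mul_distrib]
  refine Finset.prod_congr rfl fun i _ => ?_
  rw [hfam, norm_mul, mul_zpow]

theorem Acyclic.quotient (h' : Acyclic d') (h : Acyclic d)
    (hinc : ∀ i x, inc i (d' i x) = d i (inc (i + 1) x))
    (hpr : ∀ i x, pr i (d i x) = d'' i (pr (i + 1) x))
    (h0 : ∀ i x, pr i (inc i x) = 0) (hinj : ∀ i x, inc i x = 0 → x = 0)
    (hsurj : ∀ i, Function.Surjective (pr i)) (hex : ∀ i x, pr i x = 0 → ∃ y, inc i y = x) :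
    Acyclic d'' := by
  refine ⟨fun y => ?_, fun i => le_antisymm ?_ fun y hy => ?_⟩
  · obtain ⟨x, rfl⟩ := hsurj 0 y
    obtain ⟨z, rfl⟩ := h.1 x
    exact ⟨pr 1 z, (hpr 0 z).symm⟩
  · rintro _ ⟨y, rfl⟩
    obtain ⟨x, rfl⟩ := hsurj _ y
    rw [LinearMap.mem_ker, ← hpr, ← hpr, h.d_d, map_zero]
  · obtain ⟨x, rfl⟩ := hsurj _ y
    rw [LinearMap.mem_ker, ← hpr] at hy
    obtain ⟨u, hu⟩ := hex _ _ hy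
    have hu' : ∃ v, d' i v = u := by
      cases i with
      | zero => exact h'.1 u
      | succ i =>
        have : u ∈ LinearMap.ker (d' i) := hinj _ _ (by rw [hinc, hu, h.d_d])
        rwa [← h'.2] at this
    obtain ⟨v, rfl⟩ := hu'
    have hx : x - inc (i + 1) v ∈ LinearMap.ker (d i) := by
      rw [LinearMap.mem_ker, map_sub, ← hinc, hu, sub_self]
    rw [← h.2] at hx
    obtain ⟨z, hz⟩ := hx
    exact ⟨pr (i + 2) z, by rw [← hpr, hz, map_sub, h0, sub_zero]⟩

end Exact

theorem HasTorsion.sum {D : ℕ → Type*} [∀ i, AddCommGroup (D i)] [∀ i, Module ℂ (D i)]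
    {K : Type*} [Fintype K] [DecidableEq K] {d : K → ∀ i, C (i + 1) →ₗ[ℂ] C i} {t : K → ℝ}
    (h : ∀ k, HasTorsion (d k) c n (t k)) {d' : ∀ i, D (i + 1) →ₗ[ℂ] D i}
    {c' : ∀ i, Basis (κ i × K) ℂ (D i)} {inc : K → ∀ i, C i →ₗ[ℂ] D i}
    (hinc : ∀ k i x, inc k i (d k i x) = d' i (inc k (i + 1) x))
    (hc : ∀ i x k, c' i (x, k) = inc k i (c i x)) : HasTorsion d' c' n (∏ k, t k) := by
  choose r b e h0 hdet ht using fun k => (h k).exists_families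
  let I : ℕ → Type _ := fun i => Σ k, Fin (r k i)
  let b' : ∀ i, I i → D i := fun i l => inc l.1 i (b l.1 i l.2)
  let e' : ∀ i, κ i × K ≃ I (i + 1) ⊕ I i := fun i =>
    ((Equiv.prodComm _ _).trans (Equiv.sigmaEquivProd _ _).symm).trans
      ((Equiv.sigmaCongrRight fun k => e k i).trans (Equiv.sigmaSumDistrib _ _))
  have hfam : ∀ i, (c' i).det (fam d' b' i ∘ e' i) =
      ∏ k, (c i).det (fam (d k) (b k) i ∘ e k i) := fun i => by
    rw [← det_of_sum (hc i)]
    congr 1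
    ext1 ⟨x, k⟩
    have he' : e' i (x, k) = Sum.map (Sigma.mk k) (Sigma.mk k) (e k i x) := rfl
    rw [Function.comp_apply, he', Function.comp_apply]
    rcases hk : e k i x with l | l <;> simp [fam, b', hinc]
  have hE : IsEmpty (I 0) := ⟨fun l => by
    have := l.2
    rw [h0] at this
    exact this.elim0⟩
  have hdd : ∀ i x, d' i (d' (i + 1) x) = 0 := fun i => by
    suffices hs : d' i ∘ₗ d' (i + 1) = 0 from LinearMap.congr_fun hs
    refine (c' (i + 2)).ext fun ⟨x, k⟩ => ?_
    rw [LinearMap.comp_apply, hc, ← hinc, ← hinc, (h k).1.d_d, map_zero, LinearMap.zero_apply]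
  have := HasTorsion.of_families (n := n) (c := c') (d := d') b' e' hE hdd
    (fun i => by rw [hfam]; exact Finset.prod_ne_zero_iff.mpr fun k _ => hdet k i)
  convert this using 1
  simp_rw [hfam, ht, norm_prod, ← Finset.prod_zpow]
  exact Finset.prod_comm

end Operations

end SurgeryTorsion

/-! ### Torsion of a complex with an integral structure -/

namespace SurgeryTorsion

open Module

section Lattice

theorem finrank_eq_of_relIndex_ne_zero {E : Type*} [AddCommGroup E] [Module.Free ℤ E]
    [Module.Finite ℤ E] {B Z : Submodule ℤ E} (h : B ≤ Z)
    (hi : B.toAddSubgroup.relIndex Z.toAddSubgroup ≠ 0) : finrank ℤ B = finrank ℤ Z := by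
  have h0 : (B.toAddSubgroup.addSubgroupOf Z.toAddSubgroup).FiniteIndex := ⟨hi⟩
  have h1 : Finite (Z ⧸ B.comap Z.subtype) :=
    AddSubgroup.finite_quotient_of_finiteIndex (H := B.toAddSubgroup.addSubgroupOf Z.toAddSubgroup)
  rw [Submodule.finiteQuotient_iff] at h1
  rw [← h1]
  exact (Submodule.comapSubtypeEquivOfLe h).symm.finrank_eq

theorem index_span_range {E κ : Type*} [AddCommGroup E] [Fintype κ] [DecidableEq κ]
    (ε : Basis κ ℤ E) {F : κ → E} (hF : LinearIndependent ℤ F) :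
    (Submodule.span ℤ (Set.range F)).toAddSubgroup.index = (ε.det F).natAbs := by
  have : Module.Free ℤ E := Module.Free.of_basis ε
  have : Module.Finite ℤ E := Module.Finite.of_basis ε
  have := Submodule.natAbs_det_basis_change ε _ (Basis.span hF)
  rw [show ((↑) : Submodule.span ℤ (Set.range F) → E) ∘ Basis.span hF = F from
    funext fun k => congrArg Subtype.val (Basis.span_apply hF k)] at this
  rw [this]
  rfl

variable {E : ℕ → Type*} [∀ i, AddCommGroup (E i)] {δ : ∀ i, E (i + 1) →ₗ[ℤ] E i}
variable {I : ℕ → Type*} {b : ∀ i, I i → E i}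

/-- The span `L` of the family meets the cycles `Z` exactly in the boundaries `B`, and `Z + L` is
everything; hence the index of `L` is that of `B` in `Z`. -/
theorem index_span_fam (h0 : IsEmpty (I 0)) (hdd : ∀ i x, δ i (δ (i + 1) x) = 0)
    (hli : ∀ i, LinearIndependent ℤ fun l => δ i (b (i + 1) l))
    (hspan : ∀ i, Submodule.span ℤ (Set.range fun l => δ i (b (i + 1) l)) =
      LinearMap.range (δ i)) (i : ℕ) :
    (Submodule.span ℤ (Set.range (fam δ b i))).toAddSubgroup.index = homIndex δ i := by
  have h1 : (Submodule.span ℤ (Set.range (fam δ b i))).toAddSubgroup ⊓ cyc δ i =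
      (LinearMap.range (δ i)).toAddSubgroup := by
    cases i with
    | zero =>
      rw [fam, Set.Sum.elim_range, Set.range_eq_empty (b 0), Set.union_empty, hspan]
      exact inf_top_eq _
    | succ i =>
      rw [fam, Set.Sum.elim_range, Submodule.span_union, hspan]
      ext x
      constructor
      · rintro ⟨hx, hx'⟩
        obtain ⟨y, hy, z, hz, rfl⟩ := Submodule.mem_sup.mp hx
        obtain ⟨y, rfl⟩ := hy
        have hz' : z ∈ LinearMap.ker (δ i) := by
          have hx'' : δ i (δ (i + 1) y + z) = 0 := hx'
          rwa [map_add, hdd, zero_add] at hx''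
        have h1 : LinearIndependent ℤ (δ i ∘ b (i + 1)) := hli i
        rw [Submodule.disjoint_def.mp (Submodule.range_ker_disjoint h1) z hz hz', add_zero]
        exact ⟨y, rfl⟩
      · rintro ⟨y, rfl⟩
        exact ⟨Submodule.mem_sup_left ⟨y, rfl⟩, hdd i y⟩
  have h2 : cyc δ i ⊔ (Submodule.span ℤ (Set.range (fam δ b i))).toAddSubgroup = ⊤ := by
    cases i with
    | zero => exact top_sup_eq _
    | succ i =>
      rw [eq_top_iff]
      intro x _
      have hx : δ i x ∈ Submodule.map (δ i) (Submodule.span ℤ (Set.range (b (i + 1)))) := by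
        rw [Submodule.map_span, ← Set.range_comp]
        change δ i x ∈ Submodule.span ℤ (Set.range fun l => δ i (b (i + 1) l))
        rw [hspan]
        exact ⟨x, rfl⟩
      obtain ⟨y, hy, hxy⟩ := hx
      refine AddSubgroup.mem_sup.mpr ⟨x - y, ?_, y, ?_, sub_add_cancel x y⟩
      · change δ i (x - y) = 0
        rw [map_sub, hxy, sub_self]
      · change y ∈ Submodule.span ℤ (Set.range (fam δ b (i + 1)))
        rw [fam, Set.Sum.elim_range, Submodule.span_union]
        exact Submodule.mem_sup_right hy
  rw [homIndex, ← h1, AddSubgroup.inf_relIndex_right, ← AddSubgroup.relIndex_sup_right, h2,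
    AddSubgroup.relIndex_top_right]

theorem det_map_lattice {E C κ : Type*} [AddCommGroup E] [AddCommGroup C] [Module ℂ C] [Fintype κ]
    [DecidableEq κ] {ε : Basis κ ℤ E} {c : Basis κ ℂ C} {j : E →+ C} (hj : ∀ k, j (ε k) = c k)
    (F : κ → E) : c.det (j ∘ F) = (ε.det F : ℤ) := by
  have hrepr : ∀ x k, c.repr (j x) k = (ε.repr x k : ℤ) := fun x k => by
    conv_lhs => rw [← ε.sum_repr x]
    rw [map_sum, map_sum, Finsupp.finsetSum_apply, Finset.sum_eq_single k]
    · rw [map_zsmul, hj, map_zsmul, Basis.repr_self]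
      simp
    · intro l _ hl
      rw [map_zsmul, hj, map_zsmul, Basis.repr_self]
      simp [hl]
    · simp
  rw [Basis.det_apply, Basis.det_apply, ← eq_intCast (Int.castRingHom ℂ), RingHom.map_det]
  congr 1
  ext k l
  simp [Basis.toMatrix_apply, hrepr]

variable {C : ℕ → Type*} [∀ i, AddCommGroup (C i)] [∀ i, Module ℂ (C i)]
variable {κ : ℕ → Type*} [∀ i, Fintype (κ i)] [∀ i, DecidableEq (κ i)]
variable {d : ∀ i, C (i + 1) →ₗ[ℂ] C i} {c : ∀ i, Basis (κ i) ℂ (C i)} {n : ℕ}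

/-- The torsion of a complex with an integral structure all of whose homology groups are finite. -/
theorem hasTorsion_of_lattice (ε : ∀ i, Basis (κ i) ℤ (E i)) {j : ∀ i, E i →+ C i}
    (hj : ∀ i k, j i (ε i k) = c i k) (hjd : ∀ i x, j i (δ i x) = d i (j (i + 1) x))
    (hdd : ∀ i x, δ i (δ (i + 1) x) = 0) (hfin : ∀ i, homIndex δ i ≠ 0) :
    HasTorsion d c n (∏ i ∈ Finset.range n, (homIndex δ i : ℝ) ^ ((-1 : ℤ) ^ (i + 1))) := by
  have hfree : ∀ i, Module.Free ℤ (E i) := fun i => Module.Free.of_basis (ε i)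
  have hfinite : ∀ i, Module.Finite ℤ (E i) := fun i => Module.Finite.of_basis (ε i)
  let r : ℕ → ℕ := fun i => match i with
    | 0 => 0
    | i + 1 => finrank ℤ (LinearMap.range (δ i))
  have hch : ∀ i, ∃ b : Fin (r (i + 1)) → E (i + 1), LinearIndependent ℤ (fun k => δ i (b k)) ∧
      Submodule.span ℤ (Set.range fun k => δ i (b k)) = LinearMap.range (δ i) := fun i => by
    let B := finBasis ℤ (LinearMap.range (δ i))
    choose b hb using fun k => (B k).2
    have hB : (fun k => δ i (b k)) = (LinearMap.range (δ i)).subtype ∘ B := funext hb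
    refine ⟨b, ?_, ?_⟩
    · have := B.linearIndependent.map' (LinearMap.range (δ i)).subtype (Submodule.ker_subtype _)
      rwa [hB]
    · rw [hB, Set.range_comp, ← Submodule.map_span, B.span_eq, Submodule.map_top,
        Submodule.range_subtype]
  choose b hb using hch
  let b' : ∀ i, Fin (r i) → E i := fun i => match i with
    | 0 => fun k => k.elim0
    | i + 1 => b i
  have h0 : IsEmpty (Fin (r 0)) := by change IsEmpty (Fin 0); infer_instance
  have hli := linearIndependent_fam (k := ℤ) (b := b') h0 hdd fun i => (hb i).1
  have hcard : ∀ i, Fintype.card (κ i) = r (i + 1) + r i := fun i => by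
    rw [← finrank_eq_card_basis (ε i)]
    cases i with
    | zero =>
      have h1 : (LinearMap.range (δ 0)).toAddSubgroup.relIndex (⊤ : Submodule ℤ (E 0)).toAddSubgroup
        ≠ 0 := hfin 0
      change _ = finrank ℤ (LinearMap.range (δ 0)) + 0
      rw [finrank_eq_of_relIndex_ne_zero le_top h1, finrank_top, add_zero]
    | succ i =>
      change _ = finrank ℤ (LinearMap.range (δ (i + 1))) + finrank ℤ (LinearMap.range (δ i))
      have h1 : LinearMap.range (δ (i + 1)) ≤ LinearMap.ker (δ i) := by
        rintro _ ⟨x, rfl⟩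
        exact hdd i x
      rw [finrank_eq_of_relIndex_ne_zero h1 (hfin (i + 1)),
        ← (δ i).quotKerEquivRange.finrank_eq]
      exact (Submodule.finrank_quotient_add_finrank (LinearMap.ker (δ i))).symm.trans (add_comm _ _)
  have he : ∀ i, Nonempty (κ i ≃ Fin (r (i + 1)) ⊕ Fin (r i)) := fun i =>
    Fintype.card_eq.mp (by simp [hcard])
  let e := fun i => (he i).some
  -- The determinant of an integral family is, up to sign, the index of its span, which
  -- `index_span_fam` identifies with the order of the homology group.
  have hdet : ∀ i, ‖(c i).det (fam d (fun i => j i ∘ b' i) i ∘ e i)‖ = homIndex δ i := fun i => by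
    have h1 : fam d (fun i => j i ∘ b' i) i ∘ e i = j i ∘ (fam δ b' i ∘ e i) := by
      ext k
      simp only [Function.comp_apply, fam]
      rcases e i k with l | l
      · simp [hjd]
      · simp
    rw [h1, det_map_lattice (hj i), ← index_span_fam (b := b') h0 hdd (fun i => (hb i).1)
      (fun i => (hb i).2), ← EquivLike.range_comp (fam δ b' i) (e i),
      index_span_range (ε i) ((hli i).comp _ (e i).injective), Complex.norm_intCast,
      Nat.cast_natAbs, Int.cast_abs]
  have := HasTorsion.of_families (n := n) (c := c) (d := d) (fun i => j i ∘ b' i) e h0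
    (fun i => by
      suffices hs : d i ∘ₗ d (i + 1) = 0 from LinearMap.congr_fun hs
      refine (c (i + 2)).ext fun k => ?_
      rw [LinearMap.comp_apply, ← hj, ← hjd, ← hjd, hdd, map_zero, LinearMap.zero_apply])
    (fun i => by
      rw [← norm_ne_zero_iff, hdet]
      exact_mod_cast hfin i)
  simpa only [hdet] using this

end Lattice

end SurgeryTorsion

/-! ### Torsion of simplicial chains with transported coefficients -/

namespace SurgeryTorsion

open Module

section BoundarySquared

variable {ι : Type*} [LinearOrder ι]

theorem neg_one_pow_filter_insert {k : Type*} [CommRing k] {τ : Finset ι} {v u : ι} (hv : v ∉ τ) (hu : u ∉ τ)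
    (hvu : v ≠ u) : (-1 : k) ^ (τ.filter (· < v)).card * (-1) ^ ((insert v τ).filter (· < u)).card =
      -((-1) ^ (τ.filter (· < u)).card * (-1) ^ ((insert u τ).filter (· < v)).card) := by
  have key : ∀ {a b : ι}, a ∉ τ → a < b → (-1 : k) ^ ((insert a τ).filter (· < b)).card =
      -(-1) ^ (τ.filter (· < b)).card := fun {a b} ha hab => by
    rw [Finset.filter_insert, if_pos hab, Finset.card_insert_of_notMem
      (fun h => ha (Finset.mem_filter.mp h).1), pow_succ, mul_neg_one]
  have key' : ∀ {a b : ι}, ¬ a < b → (-1 : k) ^ ((insert a τ).filter (· < b)).card =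
      (-1) ^ (τ.filter (· < b)).card := fun {a b} hab => by
    rw [Finset.filter_insert, if_neg hab]
  rcases lt_or_gt_of_ne hvu with h | h
  · rw [key hv h, key' h.not_gt]; ring
  · rw [key' h.not_gt, key hu h]; ring

-- By the cocycle condition the term for two added vertices depends on their order only through its
-- sign, which changes when they are exchanged. The double sum therefore equals its negative.
open Classical in
theorem bd_bd [Fintype ι] {W : Type*} [AddCommGroup W] [Module ℂ W]
    {K : PreAbstractSimplicialComplex ι} {U : ι → ι → W →ₗ[ℂ] W}
    (hU : ∀ σ ∈ K.faces, ∀ a ∈ σ, ∀ b ∈ σ, ∀ e ∈ σ, ∀ x, U b e (U a b x) = U a e x) (i : ℕ)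
    (w : RFace K.faces (i + 2) → W) : bd K.faces U i (bd K.faces U (i + 1) w) = 0 := by
  ext τ
  let f : Finset ι → W := fun s =>
    if h : s ∈ K.faces ∧ s.card = i + 2 + 1 then
      U (RFace.first (A := K.faces) (i := i + 2) ⟨s, h⟩) τ.first (w ⟨s, h⟩) else 0
  let S : ι → ι → W := fun v u => if v ∉ τ.1 ∧ u ∉ τ.1 ∧ v ≠ u then
    ((-1 : ℂ) ^ (τ.1.filter (· < v)).card * (-1) ^ ((insert v τ.1).filter (· < u)).card) •
      f (insert u (insert v τ.1)) else 0
  have hS : bd K.faces U i (bd K.faces U (i + 1) w) τ = ∑ v, ∑ u, S v u := by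
    rw [bd_apply]
    refine Finset.sum_congr rfl fun v _ => ?_
    split_ifs with hv
    · rw [bd_apply, map_sum, Finset.smul_sum]
      refine Finset.sum_congr rfl fun u _ => ?_
      change _ • U _ _ (if h : u ∉ insert v τ.1 ∧ insert u (insert v τ.1) ∈ K.faces then _ else _) =
        _
      by_cases hu : u ∉ insert v τ.1
      · have hu' := hu
        rw [Finset.mem_insert, not_or] at hu'
        have h1 : S v u = ((-1 : ℂ) ^ (τ.1.filter (· < v)).card *
            (-1) ^ ((insert v τ.1).filter (· < u)).card) • f (insert u (insert v τ.1)) :=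
          if_pos ⟨hv.1, hu'.2, Ne.symm hu'.1⟩
        rw [h1]
        by_cases hK : insert u (insert v τ.1) ∈ K.faces
        · have hc : (insert u (insert v τ.1)).card = i + 2 + 1 := by
            rw [Finset.card_insert_of_notMem hu, Finset.card_insert_of_notMem hv.1, τ.2.2]
          rw [dif_pos ⟨hu, hK⟩]
          simp only [f]
          rw [dif_pos ⟨hK, hc⟩, map_smul, smul_smul]
          congr 1
          refine hU _ hK _ (RFace.first_mem _) _ ?_ _ ?_ _
          · exact Finset.mem_insert_of_mem (RFace.first_mem (τ.cons v hv))
          · exact Finset.mem_insert_of_mem (Finset.mem_insert_of_mem τ.first_mem)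
        · rw [dif_neg fun h => hK h.2]
          simp only [f]
          rw [dif_neg fun h => hK h.1, map_zero, smul_zero, smul_zero]
      · rw [dif_neg fun h => hu h.1, map_zero, smul_zero]
        symm
        refine if_neg fun h => hu ?_
        rw [Finset.mem_insert, not_or]
        exact ⟨h.2.2.symm, h.2.1⟩
    · symm
      refine Finset.sum_eq_zero fun u _ => ?_
      by_cases hvu : v ∉ τ.1 ∧ u ∉ τ.1 ∧ v ≠ u
      · refine (if_pos hvu).trans ?_
        simp only [f]
        rw [dif_neg, smul_zero]
        intro h
        exact hv ⟨hvu.1, mem_faces_of_subset h.1 (Finset.subset_insert _ _)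
          (Finset.insert_nonempty _ _)⟩
      · exact if_neg hvu
  have hanti : ∀ v u, S v u = -S u v := fun v u => by
    by_cases hvu : v ∉ τ.1 ∧ u ∉ τ.1 ∧ v ≠ u
    · refine (if_pos hvu).trans ?_
      rw [neg_one_pow_filter_insert hvu.1 hvu.2.1 hvu.2.2, neg_smul, Finset.insert_comm]
      congr 1
      exact (if_pos ⟨hvu.2.1, hvu.1, hvu.2.2.symm⟩).symm
    · have h1 : S v u = 0 := if_neg hvu
      have h2 : S u v = 0 := if_neg fun h => hvu ⟨h.2.1, h.1, h.2.2.symm⟩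
      rw [h1, h2, neg_zero]
  have h2 : (∑ v, ∑ u, S v u) = -∑ v, ∑ u, S v u := by
    conv_lhs => rw [Finset.sum_comm]
    rw [← Finset.sum_neg_distrib]
    refine Finset.sum_congr rfl fun v _ => ?_
    rw [← Finset.sum_neg_distrib]
    exact Finset.sum_congr rfl fun u _ => hanti u v
  rw [hS, Pi.zero_apply]
  have h3 : (2 : ℂ) • (∑ v, ∑ u, S v u) = 0 := by
    rw [two_smul]
    nth_rewrite 2 [h2]
    exact add_neg_cancel _
  exact (smul_eq_zero.mp h3).resolve_left two_ne_zero

end BoundarySquared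

section ChainTorsion

variable {ι : Type*} [LinearOrder ι] [Fintype ι] {A A' A'' : Set (Finset ι)}
variable {W ω : Type*} [AddCommGroup W] [Module ℂ W] [Fintype ω] [DecidableEq ω]

open Classical in
/-- The basis `w_k ⊗ τ` of the chains. -/
def chainBasis {k W ω : Type*} [CommRing k] [AddCommGroup W] [Module k W] (A : Set (Finset ι))
    (w : Basis ω k W) (i : ℕ) : Basis (ω × RFace A i) k (RFace A i → W) :=
  (Pi.basis fun _ => w).reindex ((Equiv.sigmaEquivProd _ _).trans (Equiv.prodComm _ _))

open Classical in
theorem chainBasis_apply {k W ω : Type*} [CommRing k] [AddCommGroup W] [Module k W]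
    (A : Set (Finset ι)) (w : Basis ω k W) (i : ℕ) (l : ω) (τ : RFace A i) :
    chainBasis A w i (l, τ) = Pi.single τ (w l) := by
  simp [chainBasis, Equiv.sigmaEquivProd]

open Classical in
/-- The chains on `A` with coefficients transported by `U` are acyclic with torsion of absolute
value `t`. -/
def ChainTorsion (A : Set (Finset ι)) (U : ι → ι → W →ₗ[ℂ] W) (w : Basis ω ℂ W) (t : ℝ) : Prop :=
  HasTorsion (C := fun i => RFace A i → W) (κ := fun i => ω × RFace A i) (bd A U)
    (chainBasis A w) (Fintype.card ι) t

instance isEmpty_prod_rface (A : Set (Finset ι)) : IsEmpty (ω × RFace A (Fintype.card ι)) :=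
  ⟨fun x => by
    have := Finset.card_le_univ x.2.1
    rw [x.2.2.2] at this
    omega⟩

variable {U : ι → ι → W →ₗ[ℂ] W} {w : Basis ω ℂ W} {t t' t'' : ℝ}

theorem ChainTorsion.unique (h : ChainTorsion A U w t) (h' : ChainTorsion A U w t') : t = t' := by
  classical
  exact HasTorsion.unique h h' (isEmpty_prod_rface A)

theorem ChainTorsion.pos (h : ChainTorsion A U w t) : 0 < t := by
  classical
  exact HasTorsion.pos h

theorem exists_chainTorsion (h : Acyclic (C := fun i => RFace A i → W) (bd A U))
    (w : Basis ω ℂ W) : ∃ t, ChainTorsion A U w t := by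
  classical
  exact exists_hasTorsion h _ _

theorem ChainTorsion.acyclic (h : ChainTorsion A U w t) :
    Acyclic (C := fun i => RFace A i → W) (bd A U) := h.1

-- The torsion is invariant under a change of gauge. Every simplex contributes the same factor `D`,
-- and the total exponent of `D` is zero because an acyclic complex has Euler characteristic zero.
open Classical in
theorem ChainTorsion.congr {W' ω' : Type*} [AddCommGroup W'] [Module ℂ W'] [Fintype ω']
    [DecidableEq ω'] (h : ChainTorsion A U w t) {U' : ι → ι → W' →ₗ[ℂ] W'} (w' : Basis ω' ℂ W')
    (g : ι → W ≃ₗ[ℂ] W') (ε : ω' ≃ ω) {D : ℝ} (hD : ∀ v, ‖w'.det (g v ∘ w ∘ ε)‖ = D) (hD0 : 0 < D)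
    (hg : ∀ σ ∈ A, ∀ a ∈ σ, ∀ b ∈ σ, ∀ x, g b (U a b x) = U' a b (g a x)) :
    ChainTorsion A U' w' t := by
  refine HasTorsion.map (D := fun i => RFace A i → W') h (chainBasis A w')
    (fun i => LinearEquiv.piCongrRight fun τ => g τ.first)
    (fun i x => ?_) (fun i => Equiv.prodCongr ε (Equiv.refl _)) ?_
  · ext τ
    simp only [LinearEquiv.piCongrRight_apply, bd_apply, map_sum]
    refine Finset.sum_congr rfl fun v _ => ?_
    split_ifs with hv
    · rw [map_smul, hg _ hv.2 _ (RFace.first_mem (τ.cons v hv)) _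
        (Finset.mem_insert_of_mem τ.first_mem)]
    · exact map_zero _
  · have hdet : ∀ i, ‖(chainBasis A w' i).det ((LinearEquiv.piCongrRight fun τ : RFace A i =>
        g τ.first) ∘ chainBasis A w i ∘ Equiv.prodCongr ε (Equiv.refl _))‖ =
        D ^ Fintype.card (RFace A i) := fun i => by
      have h1 := det_of_sum (c := w') (c' := chainBasis A w' i)
        (inc := fun τ => LinearMap.single ℂ (fun _ : RFace A i => W') τ)
        (fun x τ => chainBasis_apply A w' i x τ) (fun τ => g τ.first ∘ w ∘ ε)
      have h2 : (LinearEquiv.piCongrRight fun τ : RFace A i => g τ.first) ∘ chainBasis A w i ∘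
          Equiv.prodCongr ε (Equiv.refl _) = fun x : ω' × RFace A i =>
          LinearMap.single ℂ (fun _ : RFace A i => W') x.2 ((g x.2.first ∘ w ∘ ε) x.1) := by
        ext ⟨l, τ⟩ σ
        simp only [Function.comp_apply, Equiv.prodCongr_apply, Prod.map_apply, Equiv.refl_apply,
          chainBasis_apply, LinearEquiv.piCongrRight_apply, LinearMap.single_apply]
        by_cases hσ : σ = τ
        · subst hσ; simp
        · simp [hσ]
      rw [h2, h1, norm_prod]
      simp only [hD, Finset.prod_const, Finset.card_univ]
    simp only [hdet]
    rcases isEmpty_or_nonempty ω' with hω | hω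
    · rcases isEmpty_or_nonempty ι with hι | ⟨⟨v⟩⟩
      · simp
      · have : D = 1 := by rw [← hD v, Basis.det_apply, Matrix.det_isEmpty, norm_one]
        simp [this]
    -- The vanishing Euler characteristic counts each simplex `card ω` times. It gives the wanted
    -- product only to this power, which suffices for a nonnegative real number.
    · have h1 := Acyclic.prod_zpow h.1 (chainBasis A w) (isEmpty_prod_rface A) hD0.ne'
      have h2 : (∏ i ∈ Finset.range (Fintype.card ι),
          (D ^ Fintype.card (RFace A i)) ^ ((-1 : ℤ) ^ (i + 1))) ^ Fintype.card ω' = 1 := by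
        rw [← h1, ← Finset.prod_pow]
        refine Finset.prod_congr rfl fun i _ => ?_
        rw [Fintype.card_prod, Fintype.card_congr ε, mul_comm, pow_mul, ← zpow_natCast,
          ← zpow_natCast, ← zpow_natCast, ← zpow_mul, ← zpow_mul, ← zpow_mul, ← zpow_mul]
        congr 1
        ring
      exact (pow_eq_one_iff_of_nonneg (Finset.prod_nonneg fun i _ => by positivity)
        Fintype.card_ne_zero).mp h2

end ChainTorsion

end SurgeryTorsion

/-! ### Subcomplexes, diagonal coefficients, and characters from a lattice -/

namespace SurgeryTorsion

open Module

section Split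

variable {ι : Type*} [LinearOrder ι] [Fintype ι] {A A' A'' : Set (Finset ι)}
variable {W : Type*} [AddCommGroup W] [Module ℂ W]

open Classical in
/-- Extension of chains by zero. -/
def extendBy (A A' : Set (Finset ι)) (W : Type*) [AddCommGroup W] [Module ℂ W] (i : ℕ) :
    (RFace A' i → W) →ₗ[ℂ] (RFace A i → W) :=
  LinearMap.pi fun τ => if h : τ.1 ∈ A' then LinearMap.proj ⟨τ.1, h, τ.2.2⟩ else 0

open Classical in
theorem extendBy_apply (i : ℕ) (f : RFace A' i → W) (τ : RFace A i) :
    extendBy A A' W i f τ = if h : τ.1 ∈ A' then f ⟨τ.1, h, τ.2.2⟩ else 0 := by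
  simp only [extendBy, LinearMap.pi_apply]
  split_ifs <;> rfl

/-- Restriction of chains. -/
def restrictTo (h : A'' ⊆ A) (W : Type*) [AddCommGroup W] [Module ℂ W] (i : ℕ) :
    (RFace A i → W) →ₗ[ℂ] (RFace A'' i → W) :=
  LinearMap.pi fun τ => LinearMap.proj ⟨τ.1, h τ.2.1, τ.2.2⟩

theorem restrictTo_apply (h : A'' ⊆ A) (i : ℕ) (f : RFace A i → W) (τ : RFace A'' i) :
    restrictTo h W i f τ = f ⟨τ.1, h τ.2.1, τ.2.2⟩ := rfl

/-- A set of simplices `A` is the disjoint union of `A'` and `A''`, where no facet of a simplex of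
`A'` lies in `A''`. -/
structure IsSplit (A A' A'' : Set (Finset ι)) : Prop where
  left : A' ⊆ A
  right : A'' ⊆ A
  cover : ∀ τ ∈ A, τ ∈ A' ∨ τ ∈ A''
  disjoint : ∀ τ ∈ A', τ ∉ A''
  up : ∀ τ ∈ A'', ∀ v, insert v τ ∉ A'

variable {U : ι → ι → W →ₗ[ℂ] W}

theorem IsSplit.extendBy_bd (hA : IsSplit A A' A'') (i : ℕ) (f : RFace A' (i + 1) → W) :
    extendBy A A' W i (bd A' U i f) = bd A U i (extendBy A A' W (i + 1) f) := by
  classical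
  ext τ
  rw [extendBy_apply, bd_apply]
  split_ifs with hτ
  · rw [bd_apply]
    refine Finset.sum_congr rfl fun v _ => ?_
    by_cases hv : v ∉ τ.1 ∧ insert v τ.1 ∈ A'
    · rw [dif_pos hv, dif_pos ⟨hv.1, hA.left hv.2⟩, extendBy_apply,
        dif_pos (show (τ.cons v _).1 ∈ A' from hv.2)]
      rfl
    · rw [dif_neg hv]
      split_ifs with hv'
      · rw [extendBy_apply,
          dif_neg (show ¬ (τ.cons v hv').1 ∈ A' from fun h => hv ⟨hv'.1, h⟩), map_zero, smul_zero]
      · rfl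
  · symm
    refine Finset.sum_eq_zero fun v _ => ?_
    split_ifs with hv
    · rw [extendBy_apply, dif_neg, map_zero, smul_zero]
      exact hA.up _ ((hA.cover _ τ.2.1).resolve_left hτ) v
    · rfl

theorem IsSplit.restrictTo_bd (hA : IsSplit A A' A'') (i : ℕ) (f : RFace A (i + 1) → W) :
    restrictTo hA.right W i (bd A U i f) = bd A'' U i (restrictTo hA.right W (i + 1) f) := by
  classical
  ext τ
  rw [restrictTo_apply, bd_apply, bd_apply]
  refine Finset.sum_congr rfl fun v _ => ?_
  by_cases hv : v ∉ τ.1 ∧ insert v τ.1 ∈ A''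
  · rw [dif_pos hv, dif_pos ⟨hv.1, hA.right hv.2⟩]
    rfl
  · rw [dif_neg hv, dif_neg]
    intro h
    exact hv ⟨h.1, (hA.cover _ h.2).resolve_left (hA.up _ τ.2.1 v)⟩

theorem IsSplit.restrictTo_extendBy (hA : IsSplit A A' A'') (i : ℕ) (f : RFace A' i → W) :
    restrictTo hA.right W i (extendBy A A' W i f) = 0 := by
  ext τ
  rw [restrictTo_apply, extendBy_apply, dif_neg fun h => hA.disjoint _ h τ.2.1]
  rfl

theorem IsSplit.acyclic_quotient (hA : IsSplit A A' A'')
    (h' : Acyclic (C := fun i => RFace A' i → W) (bd A' U))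
    (h : Acyclic (C := fun i => RFace A i → W) (bd A U)) :
    Acyclic (C := fun i => RFace A'' i → W) (bd A'' U) := by
  classical
  refine Acyclic.quotient (C := fun i => RFace A i → W) (C' := fun i => RFace A' i → W)
    (C'' := fun i => RFace A'' i → W) h' h (inc := extendBy A A' W) (pr := restrictTo hA.right W)
    hA.extendBy_bd hA.restrictTo_bd hA.restrictTo_extendBy (fun i f hf => ?_) (fun i f => ?_)
    fun i f hf => ?_
  · ext τ
    have := congrFun hf ⟨τ.1, hA.left τ.2.1, τ.2.2⟩
    rwa [extendBy_apply, dif_pos (show τ.1 ∈ A' from τ.2.1)] at this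
  · refine ⟨extendBy A A'' W i f, ?_⟩
    ext τ
    rw [restrictTo_apply, extendBy_apply, dif_pos (show τ.1 ∈ A'' from τ.2.1)]
  · refine ⟨restrictTo hA.left W i f, ?_⟩
    ext τ
    rw [extendBy_apply]
    split_ifs with hτ
    · rfl
    · exact (congrFun hf ⟨τ.1, (hA.cover _ τ.2.1).resolve_left hτ, τ.2.2⟩).symm

open Classical in
/-- The simplices of `A` are those of `A'` and those of `A''`. -/
def IsSplit.faceEquiv (hA : IsSplit A A' A'') (i : ℕ) : RFace A' i ⊕ RFace A'' i ≃ RFace A i where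
  toFun := Sum.elim (fun τ => ⟨τ.1, hA.left τ.2.1, τ.2.2⟩) fun τ => ⟨τ.1, hA.right τ.2.1, τ.2.2⟩
  invFun τ := if h : τ.1 ∈ A' then Sum.inl ⟨τ.1, h, τ.2.2⟩ else
    Sum.inr ⟨τ.1, (hA.cover _ τ.2.1).resolve_left h, τ.2.2⟩
  left_inv τ := by
    rcases τ with τ | τ
    · exact dif_pos τ.2.1
    · exact dif_neg fun h => hA.disjoint _ h τ.2.1
  right_inv τ := by
    by_cases h : τ.1 ∈ A'
    · simp only [dif_pos h]; rfl
    · simp only [dif_neg h]; rfl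

theorem IsSplit.chainTorsion (hA : IsSplit A A' A'') {ω : Type*} [Fintype ω] [DecidableEq ω]
    {w : Basis ω ℂ W} {t' t'' : ℝ} (h' : ChainTorsion A' U w t') (h'' : ChainTorsion A'' U w t'')
    (hdd : ∀ i x, bd A U i (bd A U (i + 1) x) = 0) : ChainTorsion A U w (t' * t'') := by
  classical
  refine HasTorsion.of_exact (C := fun i => RFace A i → W) (C' := fun i => RFace A' i → W)
    (C'' := fun i => RFace A'' i → W) h' h'' hdd hA.extendBy_bd hA.restrictTo_bd
    hA.restrictTo_extendBy (fun i => (Equiv.prodSumDistrib _ _ _).symm.trans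
      (Equiv.prodCongr (Equiv.refl _) (hA.faceEquiv i))) (fun i k => ?_) fun i k => ?_
  · obtain ⟨l, τ⟩ := k
    change chainBasis A w i (l, ⟨τ.1, _⟩) = _
    rw [chainBasis_apply, chainBasis_apply]
    ext σ
    rw [extendBy_apply]
    by_cases h : σ.1 = τ.1
    · obtain rfl : σ = ⟨τ.1, hA.left τ.2.1, τ.2.2⟩ := Subtype.ext h
      rw [dif_pos (show τ.1 ∈ A' from τ.2.1)]
      simp
    · rw [Pi.single_eq_of_ne fun h' => h (congrArg Subtype.val h')]
      split_ifs
      · rw [Pi.single_eq_of_ne fun h' => h (congrArg Subtype.val h')]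
      · rfl
  · obtain ⟨l, τ⟩ := k
    change restrictTo _ _ _ (chainBasis A w i (l, ⟨τ.1, _⟩)) = _
    rw [chainBasis_apply, chainBasis_apply]
    ext σ
    rw [restrictTo_apply]
    by_cases h : σ = τ
    · subst h; simp
    · rw [Pi.single_eq_of_ne h, Pi.single_eq_of_ne]
      intro h'
      exact h (Subtype.ext (congrArg Subtype.val h' :))

end Split

section Diagonal

variable {ι : Type*} [LinearOrder ι] [Fintype ι] {A A' A'' : Set (Finset ι)}
variable {K : Type*} [Fintype K]

/-- A diagonal endomorphism. -/
def diag (u : K → ℂ) : (K → ℂ) →ₗ[ℂ] (K → ℂ) := LinearMap.pi fun k => u k • LinearMap.proj k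

theorem diag_apply {K : Type*} (u w : K → ℂ) (k : K) : diag u w k = u k * w k := rfl

theorem proj_bd {K : Type*} (u : K → ι → ι → ℂ) (k : K) (i : ℕ) (f : RFace A (i + 1) → K → ℂ) :
    (fun τ => bd A (fun a b => diag fun k => u k a b) i f τ k) =
      bd A (fun a b => u k a b • (LinearMap.id : ℂ →ₗ[ℂ] ℂ)) i fun τ => f τ k := by
  classical
  ext τ
  rw [bd_apply, bd_apply, Finset.sum_apply]
  refine Finset.sum_congr rfl fun v _ => ?_
  split_ifs
  · rfl
  · rfl

open Classical in
theorem single_bd (u : K → ι → ι → ℂ) (k : K) (i : ℕ) (f : RFace A (i + 1) → ℂ) :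
    (LinearMap.single ℂ (fun _ : K => ℂ) k).compLeft (RFace A i)
      (bd A (fun a b => u k a b • (LinearMap.id : ℂ →ₗ[ℂ] ℂ)) i f) =
      bd A (fun a b => diag fun k => u k a b) i
        ((LinearMap.single ℂ (fun _ : K => ℂ) k).compLeft (RFace A (i + 1)) f) := by
  refine bd_map A _ _ (LinearMap.single ℂ (fun _ : K => ℂ) k) (fun a b x => ?_) i f
  ext l
  rw [diag_apply]
  by_cases h : l = k
  · subst h; simp
  · simp [h]

theorem Acyclic.component {u : K → ι → ι → ℂ}
    (h : Acyclic (C := fun i => RFace A i → K → ℂ) (bd A fun a b => diag fun k => u k a b)) (k : K) :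
    Acyclic (C := fun i => RFace A i → ℂ) (bd A fun a b => u k a b • (LinearMap.id : ℂ →ₗ[ℂ] ℂ)) := by
  classical
  have hps : ∀ i (f : RFace A i → ℂ), (fun τ =>
      (LinearMap.single ℂ (fun _ : K => ℂ) k).compLeft (RFace A i) f τ k) = f := fun i f => by
    ext τ; simp
  refine ⟨fun f => ?_, fun i => le_antisymm ?_ fun f hf => ?_⟩
  · obtain ⟨g, hg⟩ := h.1 ((LinearMap.single ℂ (fun _ : K => ℂ) k).compLeft (RFace A 0) f)
    refine ⟨fun τ => g τ k, ?_⟩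
    rw [← proj_bd, hg]
    exact hps 0 f
  · rintro _ ⟨f, rfl⟩
    rw [LinearMap.mem_ker, ← hps _ f, ← proj_bd, ← proj_bd, h.d_d]
    rfl
  · have h1 : (LinearMap.single ℂ (fun _ : K => ℂ) k).compLeft (RFace A (i + 1)) f ∈
        LinearMap.ker (bd A (fun a b => diag fun k => u k a b) i) := by
      rw [LinearMap.mem_ker, ← single_bd, LinearMap.mem_ker.mp hf, map_zero]
    rw [← h.2] at h1
    obtain ⟨g, hg⟩ := h1
    refine ⟨fun τ => g τ k, ?_⟩
    rw [← proj_bd, hg]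
    exact hps _ f

/-- Diagonal transports split the complex into a direct sum over the characters, so the torsions
multiply. -/
theorem ChainTorsion.diag [DecidableEq K] {u : K → ι → ι → ℂ} {t : K → ℝ}
    (h : ∀ k, ChainTorsion A (fun a b => u k a b • (LinearMap.id : ℂ →ₗ[ℂ] ℂ)) (Basis.singleton Unit ℂ) (t k)) :
    ChainTorsion A (fun a b => SurgeryTorsion.diag fun k => u k a b) (Pi.basisFun ℂ K)
      (∏ k, t k) := by
  classical
  let ε : ∀ i, (Unit × RFace A i) × K ≃ K × RFace A i := fun i =>
    ((Equiv.punitProd _).prodCongr (Equiv.refl _)).trans (Equiv.prodComm _ _)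
  have h1 := HasTorsion.sum (C := fun i => RFace A i → ℂ) (D := fun i => RFace A i → K → ℂ) h
    (d' := bd A fun a b => SurgeryTorsion.diag fun k => u k a b)
    (c' := fun i => (chainBasis A (Pi.basisFun ℂ K) i).reindex (ε i).symm)
    (inc := fun k i => (LinearMap.single ℂ (fun _ : K => ℂ) k).compLeft (RFace A i))
    (fun k i f => by convert single_bd u k i f) (fun i x k => by
      rw [Basis.reindex_apply, Equiv.symm_symm]
      change chainBasis A _ i (k, x.2) = _
      rw [chainBasis_apply, show x = (x.1, x.2) from rfl, chainBasis_apply]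
      ext τ l
      by_cases hτ : τ = x.2
      · subst hτ; simp
      · simp [hτ])
  refine HasTorsion.map (C := fun i => RFace A i → K → ℂ) (D := fun i => RFace A i → K → ℂ) h1 _
    (fun i => LinearEquiv.refl ℂ _) (fun i x => rfl) (fun i => (ε i).symm) ?_
  refine Finset.prod_eq_one fun i _ => ?_
  have h2 : ⇑(LinearEquiv.refl ℂ (RFace A i → K → ℂ)) ∘
      ⇑((chainBasis A (Pi.basisFun ℂ K) i).reindex (ε i).symm) ∘ ⇑(ε i).symm =
      chainBasis A (Pi.basisFun ℂ K) i := by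
    ext x
    simp
  rw [h2, Basis.det_self, norm_one, one_zpow]

/-- The torsions of the quotient for the single characters. -/
theorem IsSplit.exists_component [DecidableEq K] (hA : IsSplit A A' A'') {u : K → ι → ι → ℂ}
    {t t' : ℝ}
    (h : ChainTorsion A (fun a b => SurgeryTorsion.diag fun k => u k a b) (Pi.basisFun ℂ K) t)
    (h' : ChainTorsion A' (fun a b => SurgeryTorsion.diag fun k => u k a b) (Pi.basisFun ℂ K) t') :
    ∃ f : K → ℝ, t' * ∏ k, f k = t ∧ ∀ k, ChainTorsion A'' (fun a b => u k a b • (LinearMap.id : ℂ →ₗ[ℂ] ℂ))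
      (Basis.singleton Unit ℂ) (f k) := by
  have hq := hA.acyclic_quotient h'.acyclic h.acyclic
  choose f hf using fun k => exists_chainTorsion (hq.component k) (Basis.singleton Unit ℂ)
  refine ⟨f, ?_, hf⟩
  exact (hA.chainTorsion h' (ChainTorsion.diag hf) h.acyclic.d_d).unique h

end Diagonal

section Lattice

variable {ι : Type*} [LinearOrder ι] [Fintype ι] {A : Set (Finset ι)} {lam : ℕ} [NeZero lam]

theorem exists_vandermonde_basis {n : ℕ} {u : Fin n → ℂ} (hu : Function.Injective u) :
    ∃ w : Basis (Fin n) ℂ (Fin n → ℂ), ∀ r k, w r k = u k ^ (r : ℕ) := by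
  let v : Fin n → Fin n → ℂ := fun r k => u k ^ (r : ℕ)
  have hv : IsUnit ((Pi.basisFun ℂ (Fin n)).det v) := by
    rw [isUnit_iff_ne_zero, Pi.basisFun_det_apply,
      show Matrix.of v = (Matrix.vandermonde u).transpose from rfl, Matrix.det_transpose]
    exact Matrix.det_vandermonde_ne_zero_iff.mpr hu
  have hb := (Pi.basisFun ℂ (Fin n)).is_basis_iff_det.mpr hv
  exact ⟨Basis.mk hb.1 hb.2.ge, fun r k => by rw [Basis.mk_apply]⟩

/-- Evaluation at the `λ` distinct roots of `t ^ λ = -1` makes the lattice an integral structure in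
the sum of their characters, with a Vandermonde basis. Passing to the standard basis costs the same
factor on every simplex, so the torsion does not change. -/
theorem chainTorsion_of_lat {h : ι → ι → ℤ} {u : Fin lam → ℂ} (hu : Function.Injective u)
    (hlam : ∀ k, u k ^ lam = -1)
    (hdd : ∀ i (x : RFace A (i + 2) → Lat lam), bd A (fun a b => latShift lam (h a b)) i
      (bd A (fun a b => latShift lam (h a b)) (i + 1) x) = 0)
    (hfin : ∀ i, homIndex (C := fun i => RFace A i → Lat lam)
      (bd A fun a b => latShift lam (h a b)) i ≠ 0) :
    ChainTorsion A (fun a b => diag fun k => u k ^ h a b) (Pi.basisFun ℂ (Fin lam))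
      (∏ i ∈ Finset.range (Fintype.card ι), (homIndex (C := fun i => RFace A i → Lat lam)
        (bd A fun a b => latShift lam (h a b)) i : ℝ) ^ ((-1 : ℤ) ^ (i + 1))) := by
  classical
  obtain ⟨w, hw⟩ := exists_vandermonde_basis hu
  let j : Lat lam →ₗ[ℤ] (Fin lam → ℂ) := LinearMap.pi fun k => evalAt (u k) ∘ₗ ofLat lam
  have hj : ∀ r, j (Pi.single r 1) = w r := fun r => by
    ext k
    simp [j, ofLat_single, evalAt, hw]
  have hjU : ∀ a b x, j (latShift lam (h a b) x) = diag (fun k => u k ^ h a b) (j x) :=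
    fun a b x => by
      ext k
      exact evalAt_latShift lam (hlam k) _ _
  have key : ChainTorsion A (fun a b => diag fun k => u k ^ h a b) w _ :=
    hasTorsion_of_lattice (E := fun i => RFace A i → Lat lam) (C := fun i => RFace A i → Fin lam → ℂ)
      (chainBasis A (Pi.basisFun ℤ (Fin lam))) (j := fun i => j.toAddMonoidHom.compLeft (RFace A i))
      (fun i k => by
        obtain ⟨r, τ⟩ := k
        rw [chainBasis_apply, chainBasis_apply]
        ext1 σ
        by_cases hσ : σ = τ
        · subst hσ
          simpa using hj r
        · simp [hσ])
      (fun i x => by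
        ext1 τ
        simp only [AddMonoidHom.compLeft_apply, Function.comp_apply, bd_apply,
          LinearMap.toAddMonoidHom_coe, map_sum]
        refine Finset.sum_congr rfl fun v _ => ?_
        split_ifs with hv
        · rw [map_zsmul, hjU, ← Int.cast_smul_eq_zsmul ℂ]
          push_cast
          rfl
        · exact map_zero _) hdd hfin
  refine key.congr (Pi.basisFun ℂ (Fin lam)) (fun _ => LinearEquiv.refl ℂ _) (Equiv.refl _)
    (fun v => rfl) ?_ fun _ _ _ _ _ _ _ => rfl
  refine norm_pos_iff.mpr (det_ne_zero_of_linearIndependent _ ?_)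
  exact w.linearIndependent

end Lattice

end SurgeryTorsion

/-! ### Elements of finite order in `SL(2, ℂ)` and their action on forms -/

namespace SurgeryTorsion

open Module Matrix

section SpecialLinear

/-- The matrix with diagonal entries `z`, `z⁻¹`. -/
def dg (z : ℂˣ) : SL2 := ⟨!![(z : ℂ), 0; 0, ((z⁻¹ : ℂˣ) : ℂ)], by simp [det_fin_two]⟩

def upper (x : ℂ) : SL2 := ⟨!![1, x; 0, 1], by simp [det_fin_two]⟩

theorem dg_val (z : ℂˣ) : (dg z).1 = !![(z : ℂ), 0; 0, ((z⁻¹ : ℂˣ) : ℂ)] := rfl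

theorem upper_val (x : ℂ) : (upper x).1 = !![1, x; 0, 1] := rfl

theorem sl_ext {A B : SL2} (h : ∀ i j, A.1 i j = B.1 i j) : A = B :=
  Subtype.ext (Matrix.ext h)

theorem sl_mul_apply (A B : SL2) (i j : Fin 2) :
    (A * B).1 i j = A.1 i 0 * B.1 0 j + A.1 i 1 * B.1 1 j := by
  change (A.1 * B.1) i j = _
  rw [Matrix.mul_apply, Fin.sum_univ_two]

theorem sl_one_apply (i j : Fin 2) : (1 : SL2).1 i j = (1 : Matrix (Fin 2) (Fin 2) ℂ) i j := rfl

theorem dg_mul (y z : ℂˣ) : dg y * dg z = dg (y * z) := by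
  refine sl_ext fun i j => ?_
  fin_cases i <;> fin_cases j <;> simp [sl_mul_apply, dg_val, mul_comm]

theorem dg_one : dg 1 = 1 := by
  refine sl_ext fun i j => ?_
  fin_cases i <;> fin_cases j <;> simp [sl_one_apply, dg_val]

def dgHom : ℂˣ →* SL2 where
  toFun := dg
  map_one' := dg_one
  map_mul' y z := (dg_mul y z).symm

theorem dgHom_injective : Function.Injective dgHom := fun y z h => by
  have := congrArg (fun A : SL2 => A.1 0 0) h
  exact Units.ext (by simpa [dgHom, dg] using this)

theorem dg_mul_upper (z : ℂˣ) (x : ℂ) : dg z * upper x = upper (z ^ 2 * x) * dg z := by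
  refine sl_ext fun i j => ?_
  have := z.ne_zero
  fin_cases i <;> fin_cases j <;> simp [sl_mul_apply, dg_val, upper_val]
  field_simp

theorem upper_add (x y : ℂ) : upper (x + y) = upper x * upper y := by
  refine sl_ext fun i j => ?_
  fin_cases i <;> fin_cases j <;> simp [sl_mul_apply, upper_val, add_comm]

/-- Homomorphisms from `SL(2, ℂ)` to a commutative group are trivial. -/
theorem map_eq_one_of_comm {N : Type*} [CommGroup N] (φ : SL2 →* N) (A : SL2) : φ A = 1 := by
  have h1 := Abelianization.commutator_subset_ker φ
  rw [Matrix.SL2.commutator_eq_top (a := (2 : ℂ)) two_ne_zero (by norm_num)] at h1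
  exact h1 (Subgroup.mem_top A)

/-- The determinant is a character of a perfect group. Hence gauge transformations by group elements
do not affect the torsion. -/
theorem det_sigma (n : ℕ) (A : SL2) : LinearMap.det (sigma n A) = 1 :=
  congrArg Units.val (map_eq_one_of_comm
    (LinearMap.det.comp (sigma n : SL2 →* (V n →ₗ[ℂ] V n))).toHomUnits A)

theorem exists_first_column (v : Fin 2 → ℂ) (hv : v ≠ 0) : ∃ Q : SL2, ∀ i, Q.1 i 0 = v i := by
  by_cases h : v 0 = 0
  · have h1 : v 1 ≠ 0 := fun h1 => hv (by ext i; fin_cases i <;> simp [h, h1])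
    refine ⟨⟨!![0, -(v 1)⁻¹; v 1, 0], by simp [det_fin_two, h1]⟩, fun i => ?_⟩
    fin_cases i <;> simp [h]
  · refine ⟨⟨!![v 0, 0; v 1, (v 0)⁻¹], by simp [det_fin_two, h]⟩, fun i => ?_⟩
    fin_cases i <;> simp

/-- Take for `Q` a matrix of determinant `1` whose first column is an eigenvector. -/
theorem exists_conj_triangular (A : SL2) : ∃ (Q : SL2) (z : ℂˣ) (x : ℂ),
    Q⁻¹ * A * Q = dg z * upper x := by
  obtain ⟨μ, hμ⟩ := Module.End.exists_eigenvalue (Matrix.toLin' A.1)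
  obtain ⟨v, hv⟩ := hμ.exists_hasEigenvector
  obtain ⟨Q, hQ⟩ := exists_first_column v hv.2
  have hAv : A.1 *ᵥ v = μ • v := by
    rw [← Matrix.toLin'_apply]; exact hv.apply_eq_smul
  have hcol : ∀ i, (A * Q).1 i 0 = μ * Q.1 i 0 := fun i => by
    have := congrFun hAv i
    simp only [Matrix.mulVec, dotProduct, Fin.sum_univ_two, Pi.smul_apply, smul_eq_mul] at this
    rw [sl_mul_apply, hQ, hQ, hQ, this]
  let B : SL2 := Q⁻¹ * A * Q
  have hB : ∀ i, B.1 i 0 = μ * (1 : Matrix (Fin 2) (Fin 2) ℂ) i 0 := fun i => by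
    have h1 : (Q⁻¹ * Q).1 i 0 = (1 : Matrix (Fin 2) (Fin 2) ℂ) i 0 := by
      rw [inv_mul_cancel]; rfl
    rw [← h1, show B = Q⁻¹ * (A * Q) from mul_assoc _ _ _, sl_mul_apply Q⁻¹ (A * Q),
      hcol, hcol, sl_mul_apply]
    ring
  have h00 : B.1 0 0 = μ := by simpa using hB 0
  have h10 : B.1 1 0 = 0 := by simpa using hB 1
  have hdet := B.2
  rw [det_fin_two, h00, h10, mul_zero, sub_zero] at hdet
  have hμ0 : μ ≠ 0 := left_ne_zero_of_mul_eq_one hdet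
  refine ⟨Q, Units.mk0 μ hμ0, μ⁻¹ * B.1 0 1, ?_⟩
  change B = _
  refine sl_ext fun i j => ?_
  fin_cases i <;> fin_cases j <;> simp [sl_mul_apply, dg_val, upper_val, h00, h10, hμ0]
  exact eq_inv_of_mul_eq_one_right hdet

theorem upper_pow (x : ℂ) (n : ℕ) : upper x ^ n = upper (n * x) := by
  induction n with
  | zero =>
    refine sl_ext fun i j => ?_
    fin_cases i <;> fin_cases j <;> simp [sl_one_apply, upper_val]
  | succ n ih => rw [pow_succ, ih, ← upper_add]; congr 1; push_cast; ring

/-- Elements of finite order are diagonalizable. -/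
theorem exists_conj_dg (A : SL2) (hA : 0 < orderOf A) : ∃ (Q : SL2) (z : ℂˣ),
    Q⁻¹ * A * Q = dg z := by
  obtain ⟨Q, z, x, h⟩ := exists_conj_triangular A
  by_cases hz : (z : ℂ) ^ 2 = 1
  -- For `z = ± 1` the diagonal part commutes with the unipotent part, and the `n`-th power has the
  -- entry `± n * x` off the diagonal, so finite order forces `x = 0`.
  · refine ⟨Q, z, ?_⟩
    suffices hx : x = 0 by
      rw [h, hx]
      refine sl_ext fun i j => ?_
      fin_cases i <;> fin_cases j <;> simp [sl_mul_apply, dg_val, upper_val]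
    have hcomm : Commute (dg z) (upper x) := by
      rw [commute_iff_eq, dg_mul_upper, hz, one_mul]
    have h1 : (dg z * upper x) ^ orderOf A = 1 := by
      rw [← h, show Q⁻¹ * A * Q = Q⁻¹ * A * (Q⁻¹)⁻¹ by rw [inv_inv], conj_pow, pow_orderOf_eq_one,
        mul_one, mul_inv_cancel]
    have h3 : dg z ^ orderOf A = dg (z ^ orderOf A) := (map_pow dgHom z _).symm
    rw [hcomm.mul_pow, upper_pow, h3] at h1
    have h2 := congrArg (fun A : SL2 => A.1 0 1) h1
    have hA' : orderOf A ≠ 0 := hA.ne'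
    simpa [sl_mul_apply, sl_one_apply, dg_val, upper_val, hA'] using h2
  · have hz1 : (1 - (z : ℂ) ^ 2) ≠ 0 := fun h => hz (by linear_combination -h)
    -- The solution of `z⁻² y + x - y = 0`, the condition that conjugation by `upper y` removes `x`.
    let y : ℂ := -(z ^ 2 * x / (1 - z ^ 2))
    refine ⟨Q * upper (-y), z, ?_⟩
    have h4 : (upper (-y))⁻¹ = upper y := by
      rw [inv_eq_iff_mul_eq_one, ← upper_add]
      refine sl_ext fun i j => ?_
      fin_cases i <;> fin_cases j <;> simp [sl_one_apply, upper_val]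
    rw [_root_.mul_inv_rev, h4]
    have h5 : upper y * Q⁻¹ * A * (Q * upper (-y)) = upper y * (Q⁻¹ * A * Q) * upper (-y) := by
      group
    rw [h5, h]
    refine sl_ext fun i j => ?_
    have := z.ne_zero
    fin_cases i <;> fin_cases j <;> simp [sl_mul_apply, dg_val, upper_val]
    simp only [y]
    field_simp
    ring

end SpecialLinear

section Eigenbasis

open MvPolynomial

/-- The exponents of the `k`-th monomial of degree `n - 1`. -/
def expo (n : ℕ) (k : Fin n) : Fin 2 →₀ ℕ := Finsupp.single 0 (n - 1 - k) + Finsupp.single 1 (k : ℕ)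

theorem expo_zero (n : ℕ) (k : Fin n) : expo n k 0 = n - 1 - k := by simp [expo]

theorem expo_one (n : ℕ) (k : Fin n) : expo n k 1 = k := by simp [expo]

theorem expo_injective (n : ℕ) : Function.Injective (expo n) := fun k l h => by
  have := congrArg (fun m : Fin 2 →₀ ℕ => m 1) h
  simp only [expo_one] at this
  exact Fin.ext this

theorem degree_expo (n : ℕ) (k : Fin n) : (expo n k).degree = n - 1 := by
  have := k.2
  rw [Finsupp.degree_eq_sum, Fin.sum_univ_two, expo_zero, expo_one]
  omega

theorem exists_expo {n : ℕ} (hn : 1 ≤ n) {m : Fin 2 →₀ ℕ} (hm : m.degree = n - 1) :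
    ∃ k, expo n k = m := by
  rw [Finsupp.degree_eq_sum, Fin.sum_univ_two] at hm
  refine ⟨⟨m 1, by omega⟩, ?_⟩
  ext i
  fin_cases i
  · change expo n _ 0 = m 0
    rw [expo_zero]
    change n - 1 - m 1 = m 0
    omega
  · exact expo_one n _

/-- The coefficients of a form. -/
def coeffs (n : ℕ) : V n →ₗ[ℂ] (Fin n → ℂ) :=
  LinearMap.pi fun k => MvPolynomial.lcoeff ℂ (expo n k) ∘ₗ (V n).subtype

theorem coeffs_apply (n : ℕ) (p : V n) (k : Fin n) : coeffs n p k = coeff (expo n k) p.1 := rfl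

theorem coeffs_bijective {n : ℕ} (hn : 1 ≤ n) : Function.Bijective (coeffs n) := by
  constructor
  · rw [injective_iff_map_eq_zero]
    intro p hp
    refine Subtype.ext (MvPolynomial.ext _ _ fun m => ?_)
    by_cases hm : m.degree = n - 1
    · obtain ⟨k, rfl⟩ := exists_expo hn hm
      exact congrFun hp k
    · exact IsHomogeneous.coeff_eq_zero ((mem_homogeneousSubmodule _ _).mp p.2) hm
  · intro f
    refine ⟨⟨∑ k, monomial (expo n k) (f k), Submodule.sum_mem _ fun k _ => ?_⟩, ?_⟩
    · exact (mem_homogeneousSubmodule _ _).mpr (isHomogeneous_monomial _ (degree_expo n k))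
    · ext k
      rw [coeffs_apply]
      simp only [coeff_sum, coeff_monomial]
      rw [Finset.sum_eq_single k]
      · simp
      · intro l _ hl
        rw [if_neg fun h => hl (expo_injective n h)]
      · simp

theorem dg_inv (z : ℂˣ) : (dg z)⁻¹ = dg z⁻¹ := (map_inv dgHom z).symm

theorem coeff_substInv_dg (z : ℂˣ) (p : MvPolynomial (Fin 2) ℂ) (m : Fin 2 →₀ ℕ) :
    coeff m (substInv (dg z) p) = (z : ℂ) ^ ((m 1 : ℤ) - m 0) * coeff m p := by
  induction p using MvPolynomial.induction_on' with
  | add p q hp hq => rw [map_add, coeff_add, hp, hq, coeff_add, mul_add]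
  | monomial l c =>
    have h1 : substInv (dg z) (monomial l c) = monomial l (c * (z : ℂ) ^ ((l 1 : ℤ) - l 0)) := by
      rw [substInv, aeval_monomial, Finsupp.prod_fintype _ _ (by simp), Fin.prod_univ_two, dg_inv]
      simp only [Fin.sum_univ_two, dg_val]
      simp only [Matrix.of_apply, Matrix.cons_val', Matrix.cons_val_zero, Matrix.cons_val_one,
        Matrix.cons_val_fin_one, C_0, zero_mul, add_zero, zero_add, inv_inv, mul_pow,
        algebraMap_eq, ← C_pow]
      have h2 : monomial l (c * (z : ℂ) ^ ((l 1 : ℤ) - l 0)) =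
          C (c * (z : ℂ) ^ ((l 1 : ℤ) - l 0)) * (X 0 ^ l 0 * X 1 ^ l 1) := by
        rw [monomial_eq, Finsupp.prod_fintype _ _ (by simp), Fin.prod_univ_two]
      have h3 : (z : ℂ) ^ ((l 1 : ℤ) - l 0) = ((z⁻¹ : ℂˣ) : ℂ) ^ l 0 * (z : ℂ) ^ l 1 := by
        rw [zpow_sub₀ z.ne_zero, zpow_natCast, zpow_natCast, Units.val_inv_eq_inv_val, inv_pow,
          div_eq_mul_inv, mul_comm]
      rw [h2, h3, C_mul, C_mul]
      ring
    rw [h1, coeff_monomial, coeff_monomial]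
    split_ifs with h
    · rw [h, mul_comm]
    · rw [mul_zero]

/-- The inverse matrix multiplies the two variables by `z⁻¹` and `z`, and the exponents are `n - 1 -
k` and `k`. For even `n` all weights are odd. -/
theorem coeffs_sigma_dg (n : ℕ) (z : ℂˣ) (p : V n) (k : Fin n) :
    coeffs n (sigma n (dg z) p) k = (z : ℂ) ^ (2 * (k : ℤ) + 1 - n) * coeffs n p k := by
  have h1 : coeffs n (sigma n (dg z) p) k = coeff (expo n k) (substInv (dg z) p.1) := rfl
  rw [h1, coeff_substInv_dg, coeffs_apply, expo_one, expo_zero]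
  congr 2
  have := k.2
  omega

/-- An element of order `2 λ` acts on `V n` diagonally, with the powers of a primitive root of unity
as eigenvalues. -/
theorem exists_eigenbasis (A : SL2) {lam : ℕ} (hlam : 0 < lam) (hA : orderOf A = 2 * lam) :
    ∃ z : ℂ, IsPrimitiveRoot z (2 * lam) ∧ ∀ n, 1 ≤ n → ∃ Θ : V n ≃ₗ[ℂ] (Fin n → ℂ),
      ∀ (m : ℤ) (p : V n), Θ (sigma n (A ^ m) p) =
        diag (fun k : Fin n => (z ^ (2 * ((k : ℕ) : ℤ) + 1 - n)) ^ m) (Θ p) := by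
  obtain ⟨Q, z, hQ⟩ := exists_conj_dg A (by omega)
  have hord : orderOf z = 2 * lam := by
    rw [← hA, ← orderOf_injective dgHom dgHom_injective]
    change orderOf (dg z) = _
    rw [← hQ, show Q⁻¹ * A * Q = MulAut.conj Q⁻¹ A by simp]
    exact (MulAut.conj Q⁻¹).orderOf_eq A
  refine ⟨z, ?_, fun n hn => ?_⟩
  · rw [← hord, ← orderOf_units]
    exact IsPrimitiveRoot.orderOf (z : ℂ)
  · let S : V n ≃ₗ[ℂ] V n := LinearEquiv.ofLinearMap (sigma n Q⁻¹) (sigma n Q)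
      (by rw [← Module.End.mul_eq_comp, ← map_mul, inv_mul_cancel, map_one]; rfl)
      (by rw [← Module.End.mul_eq_comp, ← map_mul, mul_inv_cancel, map_one]; rfl)
    refine ⟨S.trans (LinearEquiv.ofBijective (coeffs n) (coeffs_bijective hn)), fun m p => ?_⟩
    have h1 : sigma n Q⁻¹ (sigma n (A ^ m) p) = sigma n (dg (z ^ m)) (sigma n Q⁻¹ p) := by
      have h2 : Q⁻¹ * A ^ m = dg (z ^ m) * Q⁻¹ := by
        have h3 : dg (z ^ m) = (Q⁻¹ * A * Q) ^ m := by
          rw [hQ]; exact map_zpow dgHom z m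
        have h4 : (Q⁻¹ * A * Q) ^ m = Q⁻¹ * A ^ m * Q := by
          have := conj_zpow (a := Q⁻¹) (b := A) (i := m)
          rwa [inv_inv] at this
        rw [h3, h4, mul_assoc, mul_inv_cancel, mul_one]
      rw [← Module.End.mul_apply, ← map_mul, h2, map_mul, Module.End.mul_apply]
    ext k
    change coeffs n (sigma n Q⁻¹ (sigma n (A ^ m) p)) k =
      ((z : ℂ) ^ (2 * ((k : ℕ) : ℤ) + 1 - n)) ^ m * coeffs n (sigma n Q⁻¹ p) k
    rw [h1, coeffs_sigma_dg, Units.val_zpow_eq_zpow_val, ← _root_.zpow_mul,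
      ← _root_.zpow_mul, mul_comm m]

end Eigenbasis

end SurgeryTorsion

/-! ### Lifting paths, and the edge loops of a solid torus -/

namespace SurgeryTorsion

section PathClasses

open Path.Homotopic (Quotient)

variable {X Y : Type*} [TopologicalSpace X] [TopologicalSpace Y]

/-- The class `q` is the image of a path from `x` to `y`. -/
def IsSeg (P : C(X, Y)) {a b : Y} (q : Path.Homotopic.Quotient a b) (x y : X) : Prop :=
  ∃ (p : Path x y) (hx : a = P x) (hy : b = P y),
    q = (Path.Homotopic.Quotient.mk (p.map P.continuous)).cast hx hy

variable {P : C(X, Y)} {a b c : Y} {x y z : X}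

theorem exists_isSeg [PathConnectedSpace X] (hx : a = P x) (hy : b = P y) :
    ∃ q : Path.Homotopic.Quotient a b, IsSeg P q x y :=
  ⟨_, PathConnectedSpace.somePath x y, hx, hy, rfl⟩

theorem IsSeg.trans {q : Path.Homotopic.Quotient a b} {q' : Path.Homotopic.Quotient b c}
    (h : IsSeg P q x y) (h' : IsSeg P q' y z) : IsSeg P (q.trans q') x z := by
  obtain ⟨p, rfl, rfl, rfl⟩ := h
  obtain ⟨p', hy, rfl, rfl⟩ := h'
  refine ⟨p.trans p', rfl, rfl, ?_⟩
  rw [Path.map_trans]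
  rfl

theorem IsSeg.symm {q : Path.Homotopic.Quotient a b} (h : IsSeg P q x y) :
    IsSeg P q.symm y x := by
  obtain ⟨p, rfl, rfl, rfl⟩ := h
  exact ⟨p.symm, rfl, rfl, rfl⟩

/-- In a simply connected space all paths with given ends are homotopic, so a class downstairs is
determined by the ends of its lift. -/
theorem IsSeg.eq [SimplyConnectedSpace X] {q q' : Path.Homotopic.Quotient a b}
    (h : IsSeg P q x y) (h' : IsSeg P q' x y) : q = q' := by
  obtain ⟨p, rfl, rfl, rfl⟩ := h
  obtain ⟨p', hx, hy, rfl⟩ := h'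
  rw [Path.Homotopic.Quotient.mk_map, Path.Homotopic.Quotient.mk_map,
    Subsingleton.elim (Path.Homotopic.Quotient.mk p) (Path.Homotopic.Quotient.mk p')]

theorem IsSeg.translate {q : Path.Homotopic.Quotient a b} (h : IsSeg P q x y) (τ : C(X, X))
    (hτ : ∀ x, P (τ x) = P x) : IsSeg P q (τ x) (τ y) := by
  obtain ⟨p, rfl, rfl, rfl⟩ := h
  refine ⟨p.map τ.continuous, (hτ x).symm, (hτ y).symm, ?_⟩
  have : p.map P.continuous =
      ((p.map τ.continuous).map P.continuous).cast (hτ x).symm (hτ y).symm := by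
    ext t
    exact (hτ (p t)).symm
  rw [this]
  rfl

theorem isSeg_of_lift {p : Path a b} (p' : Path x y) (h : ∀ t, P (p' t) = p t) :
    IsSeg P (Path.Homotopic.Quotient.mk p) x y := by
  have hx : a = P x := by rw [← p.source, ← h, p'.source]
  have hy : b = P y := by rw [← p.target, ← h, p'.target]
  refine ⟨p', hx, hy, ?_⟩
  have : p = (p'.map P.continuous).cast hx hy := by
    ext t
    exact (h t).symm
  conv_lhs => rw [this]
  rfl

theorem pullLoop_mul (q : Path.Homotopic.Quotient a b) (g h : FundamentalGroup Y b) :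
    pullLoop q (g * h) = pullLoop q g * pullLoop q h := by
  change (q.trans (h.toPath.trans g.toPath)).trans q.symm =
    ((q.trans h.toPath).trans q.symm).trans ((q.trans g.toPath).trans q.symm)
  simp only [Path.Homotopic.Quotient.trans_assoc]
  rw [← Path.Homotopic.Quotient.trans_assoc q.symm q, Path.Homotopic.Quotient.symm_trans,
    Path.Homotopic.Quotient.refl_trans]

/-- `pullLoop q`, as a homomorphism. -/
def pullHom (q : Path.Homotopic.Quotient a b) : FundamentalGroup Y b →* FundamentalGroup Y a :=
  MonoidHom.mk' (pullLoop q) (pullLoop_mul q)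

theorem pullLoop_zpow (q : Path.Homotopic.Quotient a b) (g : FundamentalGroup Y b) (n : ℤ) :
    pullLoop q (g ^ n) = pullLoop q g ^ n := map_zpow (pullHom q) g n

/-- A square of paths, read as a relation between loops. -/
theorem square_loops {x₀ u v y : Y} (γu : Path.Homotopic.Quotient x₀ u)
    (γv : Path.Homotopic.Quotient x₀ v) (e : Path.Homotopic.Quotient u v)
    (su : Path.Homotopic.Quotient u y) (sv : Path.Homotopic.Quotient v y)
    (g : FundamentalGroup Y y) (q : Path.Homotopic.Quotient x₀ y)
    (h : e.trans sv = su.trans g.toPath) :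
    (FundamentalGroup.fromPath ((γv.trans sv).trans q.symm) : FundamentalGroup Y x₀) *
      FundamentalGroup.fromPath ((γu.trans e).trans γv.symm) =
    pullLoop q g * FundamentalGroup.fromPath ((γu.trans su).trans q.symm) := by
  change ((γu.trans e).trans γv.symm).trans ((γv.trans sv).trans q.symm) =
    ((γu.trans su).trans q.symm).trans ((q.trans g.toPath).trans q.symm)
  simp only [Path.Homotopic.Quotient.trans_assoc]
  rw [← Path.Homotopic.Quotient.trans_assoc γv.symm γv, Path.Homotopic.Quotient.symm_trans,
    Path.Homotopic.Quotient.refl_trans, ← Path.Homotopic.Quotient.trans_assoc q.symm q,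
    Path.Homotopic.Quotient.symm_trans, Path.Homotopic.Quotient.refl_trans,
    ← Path.Homotopic.Quotient.trans_assoc e, h, Path.Homotopic.Quotient.trans_assoc]

end PathClasses

section SolidTorus

variable {ι : Type*} [Fintype ι] {S : PreAbstractSimplicialComplex ι}

open Classical in
/-- The `S¹`-coordinate on a solid torus. -/
def angle (chart : Disk × Circle ≃ₜ realization S) (y : ι → ℝ) (_ : Unit) : Circle :=
  if h : y ∈ realization S then (chart.symm ⟨y, h⟩).2 else 1

theorem angle_eq (chart : Disk × Circle ≃ₜ realization S) (y : realization S) :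
    angle chart y () = (chart.symm y).2 := dif_pos y.2

theorem continuousOn_angle (chart : Disk × Circle ≃ₜ realization S) :
    ContinuousOn (fun y => angle chart y ()) (realization S) := by
  rw [continuousOn_iff_continuous_domRestrict]
  have : (realization S).domRestrict (fun y => angle chart y ()) = fun y => (chart.symm y).2 :=
    funext fun y => angle_eq chart y
  rw [this]
  fun_prop

theorem exists_logSystem [LinearOrder ι] (chart : Disk × Circle ≃ₜ realization S) :
    Nonempty (LogSystem S (angle chart)) := by
  choose g hg hg' using fun v => exists_log_closedStar (continuousOn_angle chart) v
  exact ⟨⟨fun v y _ => g v y, fun v => continuousOn_pi.mpr fun _ => hg v,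
    fun v y hy i => hg' v y hy⟩⟩

variable [LinearOrder ι] {K : PreAbstractSimplicialComplex ι}

/-- The universal covering of the solid torus, as a map to a larger space. -/
def cover (hS : S ≤ K) (chart : Disk × Circle ≃ₜ realization S) :
    C(Disk × ℝ, realization K) :=
  ⟨fun x => incl hS (chart (x.1, Circle.exp x.2)), by fun_prop⟩

theorem cover_eq (hS : S ≤ K) (chart : Disk × Circle ≃ₜ realization S)
    (G : LogSystem S (angle chart)) {v : ι} {y : ι → ℝ} (hy : y ∈ closedStar S v) :
    cover hS chart ((chart.symm ⟨y, closedStar_subset S v hy⟩).1, G.g v y ()) =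
      incl hS ⟨y, closedStar_subset S v hy⟩ := by
  have h1 : Circle.exp (G.g v y ()) = (chart.symm ⟨y, closedStar_subset S v hy⟩).2 := by
    rw [G.exp_eq v y hy]
    exact angle_eq chart ⟨y, _⟩
  change incl hS (chart (_, Circle.exp _)) = _
  rw [h1, Prod.mk.eta, Homeomorph.apply_symm_apply]

/-- The deck transformations of the universal covering. -/
def deck (n : ℤ) : C(Disk × ℝ, Disk × ℝ) := ⟨fun x => (x.1, x.2 + 2 * Real.pi * n), by fun_prop⟩

theorem circle_exp_add_period (s : ℝ) (n : ℤ) :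
    Circle.exp (s + 2 * Real.pi * n) = Circle.exp s := by
  rw [mul_comm]
  exact Circle.periodic_exp.int_mul n s

theorem cover_deck (hS : S ≤ K) (chart : Disk × Circle ≃ₜ realization S) (n : ℤ)
    (x : Disk × ℝ) : cover hS chart (deck n x) = cover hS chart x := by
  change incl hS (chart (x.1, Circle.exp (x.2 + 2 * Real.pi * n))) = _
  rw [circle_exp_add_period]
  rfl

instance : ContractibleSpace Disk :=
  (convex_closedBall (0 : ℂ) 1).contractibleSpace ⟨0, by simp⟩

/-- The core of the solid torus. -/
def coreLoop (hS : S ≤ K) (chart : Disk × Circle ≃ₜ realization S) :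
    FundamentalGroup (realization K) (incl hS (chart (Disk.zero, 1))) :=
  FundamentalGroup.fromPath (Path.Homotopic.Quotient.mk
    (circleLoop ((incl hS).comp ⟨fun w => chart (Disk.zero, w), by fun_prop⟩) _ rfl))

theorem isSeg_core (hS : S ≤ K) (chart : Disk × Circle ≃ₜ realization S) :
    IsSeg (cover hS chart) (coreLoop hS chart).toPath (Disk.zero, 0)
      (Disk.zero, 2 * Real.pi) := by
  refine isSeg_of_lift (P := cover hS chart)
    ⟨⟨fun t => (Disk.zero, 2 * Real.pi * (t : ℝ)), by fun_prop⟩, by simp, by simp⟩ fun t => rfl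

theorem isSeg_core_zpow (hS : S ≤ K) (chart : Disk × Circle ≃ₜ realization S) (n : ℤ) :
    IsSeg (cover hS chart) ((coreLoop hS chart) ^ n).toPath (Disk.zero, 0)
      (Disk.zero, 2 * Real.pi * n) := by
  have h1 : ∀ n : ℤ, IsSeg (cover hS chart) (coreLoop hS chart).toPath
      (Disk.zero, 2 * Real.pi * n) (Disk.zero, 2 * Real.pi * (n + 1 : ℤ)) := fun n => by
    have := (isSeg_core hS chart).translate (deck n) (cover_deck hS chart n)
    convert this using 2
    · rfl
    · simp [deck]
    · rfl
    · simp [deck]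
      ring
  induction n with
  | zero =>
    rw [zpow_zero, Int.cast_zero, mul_zero]
    refine isSeg_of_lift (P := cover hS chart) (Path.refl _) fun t => ?_
    change incl hS (chart (_, Circle.exp 0)) = _
    rw [Circle.exp_zero]
    rfl
  | succ n ih =>
    -- A product of loops traverses its right factor first; commuting the factors appends the new
    -- turn at the end.
    rw [zpow_add_one, ((Commute.refl (coreLoop hS chart)).zpow_left n).eq]
    exact ih.trans (h1 n)
  | pred n ih =>
    rw [zpow_sub_one, ((Commute.refl (coreLoop hS chart)).inv_right.zpow_left _).eq]
    have := h1 (-n - 1)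
    rw [sub_add_cancel] at this
    exact ih.trans this.symm

/-- Join every vertex to the base point of the core by a path inside the solid torus. In this gauge
an edge becomes the power of the core given by its holonomy, which is checked in the universal
covering `D² × ℝ`. -/
theorem exists_edge_gauge (hS : S ≤ K) (chart : Disk × Circle ≃ₜ realization S)
    (G : LogSystem S (angle chart)) {x₀ : realization K} (γ : Lifts K x₀)
    (q : Path.Homotopic.Quotient x₀ (incl hS (chart (Disk.zero, 1)))) :
    ∃ A : ι → FundamentalGroup (realization K) x₀, ∀ (s : Finset ι) (hs : s ∈ S.faces) (a b : ι)
      (ha : a ∈ s) (hb : b ∈ s), A b * edgeLoop γ (hS hs) ha hb =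
        pullLoop q (coreLoop hS chart) ^ hol G.g a b () * A a := by
  classical
  have hstar : ∀ v, {v} ∈ S.faces → (Pi.single v 1 : ι → ℝ) ∈ closedStar S v := fun v hv =>
    mem_closedStar.mpr ⟨{v}, hv, Finset.mem_singleton_self v,
      single_mem_cell (Finset.mem_singleton_self v)⟩
  let lift : ∀ v, {v} ∈ S.faces → Disk × ℝ := fun v hv =>
    ((chart.symm ⟨Pi.single v 1, closedStar_subset S v (hstar v hv)⟩).1, G.g v (Pi.single v 1) ())
  have hlift : ∀ v (hv : {v} ∈ S.faces), vertexPt K v (hS hv) = cover hS chart (lift v hv) :=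
    fun v hv => (cover_eq hS chart G (hstar v hv)).symm
  have h0 : incl hS (chart (Disk.zero, 1)) = cover hS chart (Disk.zero, 0) := by
    change _ = incl hS (chart (_, Circle.exp 0))
    rw [Circle.exp_zero]
  choose seg hseg using fun v (hv : {v} ∈ S.faces) => exists_isSeg (hlift v hv) h0
  refine ⟨fun v => if hv : {v} ∈ S.faces then FundamentalGroup.fromPath
    (((γ v (hS hv)).trans (seg v hv)).trans q.symm) else 1, fun s hs a b ha hb => ?_⟩
  have hav := vertex_mem hs ha
  have hbv := vertex_mem hs hb
  beta_reduce
  rw [dif_pos hav, dif_pos hbv, ← pullLoop_zpow]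
  refine square_loops (γ a (hS hav)) (γ b (hS hbv))
    (Path.Homotopic.Quotient.mk (edgePath (hS hs) ha hb)) (seg a hav) (seg b hbv) _ q ?_
  set n := hol G.g a b () with hn
  have hcell : ∀ t : unitInterval,
      AffineMap.lineMap (Pi.single a 1 : ι → ℝ) (Pi.single b 1) (t : ℝ) ∈ cell s := fun t => by
    refine (convex_cell s).segment_subset (single_mem_cell ha) (single_mem_cell hb) ?_
    rw [segment_eq_image_lineMap]
    exact ⟨t, t.2, rfl⟩
  have hst : ∀ t : unitInterval,
      AffineMap.lineMap (Pi.single a 1 : ι → ℝ) (Pi.single b 1) (t : ℝ) ∈ closedStar S a :=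
    fun t => mem_closedStar.mpr ⟨s, hs, ha, hcell t⟩
  have hga : G.g a (Pi.single b 1) () = G.g b (Pi.single b 1) () + 2 * Real.pi * n :=
    congrFun (G.hol_spec hs ha hb (single_mem_cell hb)) ()
  have hcont : Continuous fun t : unitInterval =>
      AffineMap.lineMap (Pi.single a 1 : ι → ℝ) (Pi.single b 1) (t : ℝ) := by fun_prop
  -- Lifted with the logarithm at `a`, the edge ends at the lift of `b` translated by the holonomy,
  -- for the latter lift was made with the logarithm at `b`.
  have hedge : IsSeg (cover hS chart) (Path.Homotopic.Quotient.mk (edgePath (hS hs) ha hb))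
      (lift a hav) (deck n (lift b hbv)) := by
    refine isSeg_of_lift (P := cover hS chart) ⟨⟨fun t =>
      ((chart.symm ⟨_, closedStar_subset S a (hst t)⟩).1, G.g a
        (AffineMap.lineMap (Pi.single a 1 : ι → ℝ) (Pi.single b 1) (t : ℝ)) ()), ?_⟩, ?_, ?_⟩
      fun t => cover_eq hS chart G (hst t)
    · refine Continuous.prodMk ?_ ?_
      · exact continuous_fst.comp (chart.symm.continuous.comp (hcont.subtype_mk _))
      · exact (continuous_apply ()).comp ((G.cont a).comp_continuous hcont hst)
    · simp [lift]
    · simp [lift, deck, hga]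
  have h1 : IsSeg (cover hS chart) (seg b hbv) (deck n (lift b hbv))
      (Disk.zero, 2 * Real.pi * n) := by
    have := (hseg b hbv).translate (deck n) (cover_deck hS chart n)
    convert this using 2
    · rfl
    · simp [deck]
  -- Both lifts run from the lift of `a` to the point at height `2 * π * n` over the centre of the
  -- disk.
  exact (hedge.trans h1).eq ((hseg a hav).trans (isSeg_core_zpow hS chart n))

end SolidTorus

end SurgeryTorsion

/-! ### The torsion of a solid torus relative to its boundary -/

namespace SurgeryTorsion

open Module

section SolidTorusTorsion

variable {ι : Type*} [Fintype ι] {S T : PreAbstractSimplicialComplex ι}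

theorem closedStar_mono (h : T ≤ S) (v : ι) : closedStar T v ⊆ closedStar S v := fun y hy => by
  obtain ⟨σ, h1, h2, h3⟩ := mem_closedStar.mp hy
  exact mem_closedStar.mpr ⟨σ, h h1, h2, h3⟩

open Classical in
/-- The two `S¹`-coordinates on the boundary of a solid torus. -/
def rimAngles (chart : Disk × Circle ≃ₜ realization S) (y : ι → ℝ) (i : Fin 2) : Circle :=
  if i = 1 then angle chart y () else
    if h : y ∈ realization S then Circle.exp (Complex.arg (chart.symm ⟨y, h⟩).1) else 1

variable {chart : Disk × Circle ≃ₜ realization S}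

theorem norm_chart_symm (hTS : T ≤ S)
    (hb : ∀ (z : Disk) (w : Circle), (chart (z, w) : ι → ℝ) ∈ realization T ↔ ‖(z : ℂ)‖ = 1)
    (y : realization T) : ‖((chart.symm (incl hTS y)).1 : ℂ)‖ = 1 := by
  rw [← hb _ (chart.symm (incl hTS y)).2, Prod.mk.eta, Homeomorph.apply_symm_apply]
  exact y.2

theorem rimAngles_zero (hTS : T ≤ S)
    (hb : ∀ (z : Disk) (w : Circle), (chart (z, w) : ι → ℝ) ∈ realization T ↔ ‖(z : ℂ)‖ = 1)
    (y : realization T) :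
    ((rimAngles chart y 0 : Circle) : ℂ) = ((chart.symm (incl hTS y)).1 : ℂ) := by
  have h : (y : ι → ℝ) ∈ realization S := realization_mono hTS y.2
  rw [rimAngles, if_neg (by decide), dif_pos h, Circle.coe_exp]
  have h1 := Complex.norm_mul_exp_arg_mul_I ((chart.symm (incl hTS y)).1 : ℂ)
  rw [norm_chart_symm hTS hb y, Complex.ofReal_one, one_mul] at h1
  exact h1

theorem rimAngles_one (hTS : T ≤ S) (y : realization T) :
    rimAngles chart y 1 = (chart.symm (incl hTS y)).2 := by
  rw [rimAngles, if_pos rfl]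
  exact angle_eq chart (incl hTS y)

/-- The logarithms on `S` are reused for coordinate `1`, so the holonomies on `T` and on `S` agree
and define the same characters. -/
theorem exists_logSystem_rim [LinearOrder ι] (hTS : T ≤ S)
    (hb : ∀ (z : Disk) (w : Circle), (chart (z, w) : ι → ℝ) ∈ realization T ↔ ‖(z : ℂ)‖ = 1)
    (G : LogSystem S (angle chart)) :
    ∃ G' : LogSystem T (rimAngles chart), ∀ a b, hol G'.g a b 1 = hol G.g a b () := by
  have hcont : ContinuousOn (fun y => rimAngles chart y 0) (realization T) := by
    rw [continuousOn_iff_continuous_domRestrict]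
    refine continuous_induced_rng.mpr ?_
    have : ((↑) : Circle → ℂ) ∘ (realization T).domRestrict (fun y => rimAngles chart y 0) =
        fun y => ((chart.symm (incl hTS y)).1 : ℂ) := funext fun y => rimAngles_zero hTS hb y
    change Continuous (((↑) : Circle → ℂ) ∘ _)
    rw [this]
    fun_prop
  choose g hg hg' using fun v => exists_log_closedStar hcont v
  refine ⟨⟨fun v y i => if i = 1 then G.g v y () else g v y, fun v => continuousOn_pi.mpr fun i => ?_,
    fun v y hy i => ?_⟩, fun a b => rfl⟩
  · by_cases hi : i = 1
    · simp only [hi, if_true]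
      exact (continuousOn_pi.mp (G.cont v) ()).mono (closedStar_mono hTS v)
    · simp only [hi, if_false]
      exact hg v
  · by_cases hi : i = 1
    · simp only [hi, if_true]
      rw [G.exp_eq v y (closedStar_mono hTS v hy)]
      rfl
    · have : i = 0 := by omega
      subst this
      simp only [hi, if_false]
      exact hg' v y hy

theorem exact_solidTorus [LinearOrder ι] (G : LogSystem S (angle chart)) :
    ListChain.Exact G.good := by
  refine G.exact_of_product (C := Metric.closedBall (0 : ℂ) 1) (convex_closedBall 0 1)
    (isCompact_closedBall 0 1) ⟨0, by simp⟩ (fun x => chart (x.1, x.2 ())) (by fun_prop)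
    (fun y => (chart.symm y).1) (by fun_prop) (fun y => ?_) (fun x => ?_)
  · change chart ((chart.symm y).1, angle chart y ()) = y
    rw [angle_eq, Prod.mk.eta, Homeomorph.apply_symm_apply]
  · ext1 i
    rw [angle_eq, Homeomorph.symm_apply_apply]

theorem exact_rim [LinearOrder ι] (hTS : T ≤ S)
    (hb : ∀ (z : Disk) (w : Circle), (chart (z, w) : ι → ℝ) ∈ realization T ↔ ‖(z : ℂ)‖ = 1)
    (G : LogSystem T (rimAngles chart)) : ListChain.Exact G.good := by
  refine G.exact_of_product (C := {(0 : ℝ)}) (convex_singleton 0) isCompact_singleton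
    (Set.singleton_nonempty 0)
    (fun x => ⟨chart (Disk.ofCircle (x.2 0), x.2 1), (hb _ _).mpr (Circle.norm_coe _)⟩)
    (by fun_prop) (fun _ => ⟨0, rfl⟩) (by fun_prop) (fun y => ?_) (fun x => ?_)
  · refine Subtype.ext (congrArg (fun y : realization S => (y : ι → ℝ))
      (a₂ := incl hTS y) ?_)
    rw [← chart.eq_symm_apply]
    exact Prod.ext (Subtype.ext (rimAngles_zero hTS hb y)) (rimAngles_one hTS y)
  · set y : realization T := ⟨chart (Disk.ofCircle (x.2 0), x.2 1), (hb _ _).mpr (Circle.norm_coe _)⟩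
    have hy : chart.symm (incl hTS y) = (Disk.ofCircle (x.2 0), x.2 1) :=
      chart.symm_apply_apply _
    ext1 i
    fin_cases i
    · refine Circle.ext ((rimAngles_zero hTS hb y).trans ?_)
      rw [hy]
      rfl
    · refine (rimAngles_one hTS y).trans ?_
      rw [hy]
      rfl

theorem nonempty_rim
    (hb : ∀ (z : Disk) (w : Circle), (chart (z, w) : ι → ℝ) ∈ realization T ↔ ‖(z : ℂ)‖ = 1) :
    (realization T).Nonempty :=
  ⟨_, (hb Disk.one 1).mpr (by simp [Disk.one])⟩

/-- With at most one vertex the realization would have at most one point. The bound ensures that the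
product defining the torsion reaches the degrees `0` and `1`. -/
theorem one_lt_card (chart : Disk × Circle ≃ₜ realization S) : 1 < Fintype.card ι := by
  by_contra hle
  have hsub : ∀ y ∈ stdSimplex ℝ ι, ∀ y' ∈ stdSimplex ℝ ι, y = y' := fun y hy y' hy' => by
    have := Fintype.card_le_one_iff_subsingleton.mp (not_lt.mp hle)
    ext v
    have h1 := hy.2
    have h2 := hy'.2
    rw [Fintype.sum_subsingleton _ v] at h1 h2
    rw [h1, h2]
  have h1 : chart (Disk.zero, 1) = chart (Disk.one, 1) := Subtype.ext
    (hsub _ (chart (Disk.zero, 1)).2.1 _ (chart (Disk.one, 1)).2.1)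
  have h2 := congrArg (fun x : Disk × Circle => (x.1 : ℂ)) (chart.injective h1)
  simp [Disk.zero, Disk.one] at h2

/-- Only `H₀`, of order `2`, contributes, with exponent `-1`. -/
theorem chainTorsion_solidTorus [LinearOrder ι] (G : LogSystem S (angle chart)) {lam : ℕ}
    [NeZero lam] {u : Fin lam → ℂ} (hu : Function.Injective u) (hlam : ∀ k, u k ^ lam = -1) :
    ChainTorsion S.faces (fun a b => diag fun k => u k ^ hol G.g a b ()) (Pi.basisFun ℂ (Fin lam))
      (1 / 2) := by
  have hne : (realization S).Nonempty := ⟨_, (chart (Disk.zero, 1)).2⟩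
  have hG := exact_solidTorus G
  have hi := G.homIndex_of_circle lam hG hne
  have := chainTorsion_of_lat hu hlam (fun i x => G.d_d_of_circle lam hG hne i x) fun i => by
    rw [hi]; split_ifs <;> norm_num
  simp only [hi] at this
  obtain ⟨n, hn⟩ := Nat.exists_eq_add_of_lt (one_lt_card chart)
  rw [hn, Finset.prod_range_succ'] at this
  simpa using this

/-- The groups `H₀` and `H₁`, both of order `2`, contribute with opposite exponents and cancel. -/
theorem chainTorsion_rim [LinearOrder ι] (hTS : T ≤ S)
    (hb : ∀ (z : Disk) (w : Circle), (chart (z, w) : ι → ℝ) ∈ realization T ↔ ‖(z : ℂ)‖ = 1)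
    (G : LogSystem S (angle chart)) {lam : ℕ} [NeZero lam]
    {u : Fin lam → ℂ} (hu : Function.Injective u) (hlam : ∀ k, u k ^ lam = -1) :
    ChainTorsion T.faces (fun a b => diag fun k => u k ^ hol G.g a b ()) (Pi.basisFun ℂ (Fin lam))
      1 := by
  obtain ⟨G', hG'⟩ := exists_logSystem_rim hTS hb G
  have hne := nonempty_rim hb
  have hG := exact_rim hTS hb G'
  have hi := G'.homIndex_of_torus lam hG hne
  have hdd := G'.d_d_of_torus lam hG hne
  simp only [hG'] at hi hdd
  have := chainTorsion_of_lat hu hlam hdd fun i => by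
    rw [hi]; split_ifs <;> norm_num
  simp only [hi] at this
  obtain ⟨n, hn⟩ := Nat.exists_eq_add_of_lt (one_lt_card chart)
  rw [hn, show 1 + n + 1 = n + 1 + 1 by ring, Finset.prod_range_succ',
    Finset.prod_range_succ'] at this
  simpa using this

theorem isSplit_of_le [LinearOrder ι] (hTS : T ≤ S) :
    IsSplit S.faces T.faces (S.faces \ T.faces) where
  left := hTS
  right := Set.sdiff_subset
  cover τ h := by
    by_cases h' : τ ∈ T.faces
    · exact Or.inl h'
    · exact Or.inr ⟨h, h'⟩
  disjoint _ h h' := h'.2 h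
  up τ h v h' := h.2 (mem_faces_of_subset h' (Finset.subset_insert v τ)
    (S.isRelLowerSet_faces h.1).1)

/-- The torsions of a solid torus relative to its boundary, for the characters of the fundamental
group which take a generator to an odd power of `z`. -/
theorem exists_relTorsion [LinearOrder ι] (hTS : T ≤ S)
    (hb : ∀ (z : Disk) (w : Circle), (chart (z, w) : ι → ℝ) ∈ realization T ↔ ‖(z : ℂ)‖ = 1)
    (G : LogSystem S (angle chart)) {lam : ℕ} [NeZero lam]
    {z : ℂ} (hz : IsPrimitiveRoot z (2 * lam)) :
    ∃ f : ℤ → ℝ, (∀ m, 0 < f m) ∧ (∀ m, f (m + lam) = f m) ∧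
      (∀ m : ℤ, ∏ k ∈ Finset.range lam, f (m + k) = 1 / 2) ∧
      ∀ m : ℤ, ChainTorsion (S.faces \ T.faces)
        (fun a b => (z ^ (2 * m + 1)) ^ hol G.g a b () • (LinearMap.id : ℂ →ₗ[ℂ] ℂ))
        (Basis.singleton Unit ℂ) (f m) := by
  have hz0 : z ≠ 0 := hz.ne_zero (by simp [NeZero.ne lam])
  have hzl : z ^ lam = -1 := by
    have h1 : IsPrimitiveRoot (z ^ lam) 2 :=
      hz.pow (by have := NeZero.pos lam; omega) (mul_comm 2 lam)
    exact h1.eq_neg_one_of_two_right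
  have hzl' : z ^ (2 * lam) = 1 := hz.pow_eq_one
  -- Any `λ` consecutive odd powers of `z` are distinct roots of `u ^ λ = -1`, so the lattice
  -- computes the product over them; dividing by the torsion `1` of the boundary leaves `1 / 2`.
  have key : ∀ m : ℤ, ∃ f : Fin lam → ℝ, ∏ k, f k = 1 / 2 ∧ ∀ k : Fin lam,
      ChainTorsion (S.faces \ T.faces) (fun a b =>
        (z ^ (2 * (m + (k : ℕ)) + 1)) ^ hol G.g a b () • (LinearMap.id : ℂ →ₗ[ℂ] ℂ))
        (Basis.singleton Unit ℂ) (f k) := fun m => by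
    have hu : Function.Injective fun k : Fin lam => z ^ (2 * (m + (k : ℕ)) + 1) := fun k l h => by
      have h1 : (z ^ (2 * m + 1)) * z ^ (2 * (k : ℕ)) = (z ^ (2 * m + 1)) * z ^ (2 * (l : ℕ)) := by
        rw [← zpow_natCast, ← zpow_natCast, ← zpow_add₀ hz0, ← zpow_add₀ hz0]
        convert h using 2 <;> push_cast <;> ring
      have h2 := hz.pow_inj (by omega) (by omega) (mul_left_cancel₀ (zpow_ne_zero _ hz0) h1)
      exact Fin.ext (by omega)
    have hlam : ∀ k : Fin lam, (z ^ (2 * (m + (k : ℕ)) + 1)) ^ lam = -1 := fun k => by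
      rw [← zpow_natCast, ← zpow_mul, mul_comm, zpow_mul, zpow_natCast, hzl,
        Odd.neg_one_zpow ⟨_, rfl⟩]
    obtain ⟨f, hf, hf'⟩ := (isSplit_of_le hTS).exists_component
      (u := fun (k : Fin lam) a b => (z ^ (2 * (m + (k : ℕ)) + 1)) ^ hol G.g a b ())
      (chainTorsion_solidTorus G hu hlam) (chainTorsion_rim hTS hb G hu hlam)
    exact ⟨f, by rwa [one_mul] at hf, hf'⟩
  have h1 : ∀ m : ℤ, ∃ t, ChainTorsion (S.faces \ T.faces)
      (fun a b => (z ^ (2 * m + 1)) ^ hol G.g a b () • (LinearMap.id : ℂ →ₗ[ℂ] ℂ))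
      (Basis.singleton Unit ℂ) t := fun m => by
    obtain ⟨f, -, hf⟩ := key m
    have := hf ⟨0, NeZero.pos lam⟩
    simp only [Nat.cast_zero, add_zero] at this
    exact ⟨_, this⟩
  choose f hf using h1
  -- The torsion depends only on the character, so the period comes from `z ^ (2 * λ) = 1` and the
  -- product from `key`.
  refine ⟨f, fun m => (hf m).pos, fun m => ?_, fun m => ?_, hf⟩
  · have h2 := hf (m + lam)
    have h3 : z ^ (2 * (m + lam) + 1) = z ^ (2 * m + 1) := by
      rw [show 2 * (m + lam) + 1 = (2 * m + 1) + ((2 * lam : ℕ) : ℤ) by push_cast; ring,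
        zpow_add₀ hz0, zpow_natCast, hzl', mul_one]
    rw [h3] at h2
    exact h2.unique (hf m)
  · obtain ⟨f', h2, h3⟩ := key m
    rw [← h2, Finset.prod_range]
    exact Finset.prod_congr rfl fun k _ => (hf _).unique (h3 k)

end SolidTorusTorsion

end SurgeryTorsion

/-! ### Edge loops as transport of coefficients -/

namespace SurgeryTorsion

open Module

section EdgeMap

variable {ι : Type*} [Fintype ι] [LinearOrder ι] {K M : PreAbstractSimplicialComplex ι}

theorem contractible_cell {s : Finset ι} (hs : s.Nonempty) : ContractibleSpace (cell s) := by
  obtain ⟨v, hv⟩ := hs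
  exact (convex_cell s).contractibleSpace ⟨_, single_mem_cell hv⟩

/-- Both paths lie in one closed simplex, which is contractible. -/
theorem edgePath_trans {s : Finset ι} (hs : s ∈ K.faces) {a b e : ι} (ha : a ∈ s) (hb : b ∈ s)
    (he : e ∈ s) :
    (Path.Homotopic.Quotient.mk (edgePath hs ha hb)).trans
      (Path.Homotopic.Quotient.mk (edgePath hs hb he)) =
      Path.Homotopic.Quotient.mk (edgePath hs ha he) := by
  have := contractible_cell ⟨a, ha⟩
  let P : C(cell s, realization K) := ⟨Set.inclusion (cell_subset_realization hs),
    continuous_inclusion (cell_subset_realization hs)⟩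
  have hseg : ∀ {a b : ι} (ha : a ∈ s) (hb : b ∈ s),
      IsSeg P (Path.Homotopic.Quotient.mk (edgePath hs ha hb))
        ⟨Pi.single a 1, single_mem_cell ha⟩ ⟨Pi.single b 1, single_mem_cell hb⟩ := fun {a b} ha hb => by
    refine isSeg_of_lift (P := P) ⟨⟨fun t =>
      ⟨AffineMap.lineMap (Pi.single a 1 : ι → ℝ) (Pi.single b 1) (t : ℝ), ?_⟩, ?_⟩, ?_, ?_⟩
      fun t => rfl
    · refine (convex_cell s).segment_subset (single_mem_cell ha) (single_mem_cell hb) ?_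
      rw [segment_eq_image_lineMap]
      exact ⟨t, t.2, rfl⟩
    · refine Continuous.subtype_mk ?_ _
      fun_prop
    · simp
    · simp
  exact ((hseg ha hb).trans (hseg hb he)).eq (hseg ha he)

/-- The connecting path at `b` cancels; the loop traversed first is the right factor. This cocycle
condition is what `bd_bd` needs. -/
theorem edgeLoop_mul {x₀ : realization K} (γ : Lifts K x₀) {s : Finset ι} (hs : s ∈ K.faces)
    {a b e : ι} (ha : a ∈ s) (hb : b ∈ s) (he : e ∈ s) :
    edgeLoop γ hs hb he * edgeLoop γ hs ha hb = edgeLoop γ hs ha he := by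
  change (((γ a _).trans _).trans (γ b _).symm).trans (((γ b _).trans _).trans (γ e _).symm) =
    ((γ a _).trans _).trans (γ e _).symm
  rw [← edgePath_trans hs ha hb he]
  simp only [Path.Homotopic.Quotient.trans_assoc]
  rw [← Path.Homotopic.Quotient.trans_assoc (γ b _).symm (γ b _),
    Path.Homotopic.Quotient.symm_trans, Path.Homotopic.Quotient.refl_trans]

theorem quotient_map_trans {X Y : Type*} [TopologicalSpace X] [TopologicalSpace Y] (f : C(X, Y))
    {x y z : X} (p : Path.Homotopic.Quotient x y) (q : Path.Homotopic.Quotient y z) :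
    (p.trans q).map f = (p.map f).trans (q.map f) := by
  induction p using Path.Homotopic.Quotient.ind with | mk p =>
  induction q using Path.Homotopic.Quotient.ind with | mk q =>
  rw [← Path.Homotopic.Quotient.mk_trans, ← Path.Homotopic.Quotient.mk_map,
    ← Path.Homotopic.Quotient.mk_map, ← Path.Homotopic.Quotient.mk_map,
    ← Path.Homotopic.Quotient.mk_trans, Path.map_trans]

theorem quotient_map_symm {X Y : Type*} [TopologicalSpace X] [TopologicalSpace Y] (f : C(X, Y))
    {x y : X} (p : Path.Homotopic.Quotient x y) : p.symm.map f = (p.map f).symm := by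
  induction p using Path.Homotopic.Quotient.ind with | mk p =>
  rfl

theorem trans_gauge {X : Type*} [TopologicalSpace X] {x y z : X}
    (p : Path.Homotopic.Quotient x y) (e : Path.Homotopic.Quotient y z)
    (q : Path.Homotopic.Quotient x z) (p' : Path.Homotopic.Quotient x y)
    (q' : Path.Homotopic.Quotient x z) :
    ((p.trans e).trans q.symm).trans (q.trans q'.symm) =
      (p.trans p'.symm).trans ((p'.trans e).trans q'.symm) := by
  simp only [Path.Homotopic.Quotient.trans_assoc]
  rw [← Path.Homotopic.Quotient.trans_assoc q.symm, Path.Homotopic.Quotient.symm_trans,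
    Path.Homotopic.Quotient.refl_trans, ← Path.Homotopic.Quotient.trans_assoc p'.symm,
    Path.Homotopic.Quotient.symm_trans, Path.Homotopic.Quotient.refl_trans]

/-- Passing to a larger complex changes the loops of edges by a gauge transformation. -/
theorem exists_gauge_of_le (h : M ≤ K) {x₀ : realization M} (γ : Lifts M x₀)
    (γ' : Lifts K (incl h x₀)) :
    ∃ B : ι → FundamentalGroup (realization K) (incl h x₀), ∀ (s : Finset ι) (hs : s ∈ M.faces)
      (a b : ι) (ha : a ∈ s) (hb : b ∈ s),
      B b * FundamentalGroup.map (incl h) x₀ (edgeLoop γ hs ha hb) =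
        edgeLoop γ' (h hs) ha hb * B a := by
  classical
  refine ⟨fun v => if hv : {v} ∈ M.faces then FundamentalGroup.fromPath
    (((γ v hv).map (incl h)).trans (γ' v (h hv)).symm) else 1, fun s hs a b ha hb => ?_⟩
  beta_reduce
  rw [dif_pos (vertex_mem hs ha), dif_pos (vertex_mem hs hb)]
  change Path.Homotopic.Quotient.trans (Path.Homotopic.Quotient.map
    (((γ a _).trans (Path.Homotopic.Quotient.mk (edgePath hs ha hb))).trans (γ b _).symm) (incl h))
      (((γ b _).map (incl h)).trans (γ' b _).symm) =
    (((γ a _).map (incl h)).trans (γ' a _).symm).trans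
      (((γ' a _).trans (Path.Homotopic.Quotient.mk (edgePath (h hs) ha hb))).trans (γ' b _).symm)
  rw [quotient_map_trans, quotient_map_trans, quotient_map_symm]
  exact trans_gauge _ (Path.Homotopic.Quotient.mk (edgePath (h hs) ha hb)) _ _ _

variable {W : Type*} [AddCommGroup W] [Module ℂ W]

open Classical in
/-- The transport of the coefficients along the edges of `K`. -/
def edgeMap {x₀ : realization K} (γ : Lifts K x₀)
    (R : Representation ℂ (FundamentalGroup (realization K) x₀) W) (a b : ι) : W →ₗ[ℂ] W :=
  if h : ∃ s ∈ K.faces, a ∈ s ∧ b ∈ s then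
    R (edgeLoop γ h.choose_spec.1 h.choose_spec.2.1 h.choose_spec.2.2) else 0

/-- The simplex enters `edgeLoop` only through proofs, so the chosen one may be replaced by any
other. -/
theorem edgeMap_eq {x₀ : realization K} (γ : Lifts K x₀)
    (R : Representation ℂ (FundamentalGroup (realization K) x₀) W) {s : Finset ι}
    (hs : s ∈ K.faces) {a b : ι} (ha : a ∈ s) (hb : b ∈ s) :
    edgeMap γ R a b = R (edgeLoop γ hs ha hb) :=
  dif_pos ⟨s, hs, ha, hb⟩

theorem edgeMap_edgeMap {x₀ : realization K} (γ : Lifts K x₀)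
    (R : Representation ℂ (FundamentalGroup (realization K) x₀) W) {s : Finset ι}
    (hs : s ∈ K.faces) {a b e : ι} (ha : a ∈ s) (hb : b ∈ s) (he : e ∈ s) (x : W) :
    edgeMap γ R b e (edgeMap γ R a b x) = edgeMap γ R a e x := by
  rw [edgeMap_eq γ R hs ha hb, edgeMap_eq γ R hs hb he, edgeMap_eq γ R hs ha he,
    ← edgeLoop_mul γ hs ha hb he, map_mul]
  rfl

theorem twistedBoundary_eq {x₀ : realization K} (γ : Lifts K x₀)
    (R : Representation ℂ (FundamentalGroup (realization K) x₀) W) :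
    twistedBoundary γ R = bd K.faces (edgeMap γ R) := by
  funext i
  refine LinearMap.ext fun f => funext fun τ => ?_
  refine Eq.trans ?_ (bd_apply K.faces (edgeMap γ R) i f τ).symm
  simp only [twistedBoundary, LinearMap.pi_apply, LinearMap.sum_apply]
  refine Finset.sum_congr rfl fun v _ => ?_
  by_cases h : v ∉ τ.1 ∧ insert v τ.1 ∈ K.faces
  · rw [dif_pos h, dif_pos h, edgeMap_eq γ R h.2 (RFace.first_mem (RFace.cons τ v h))
      (Finset.mem_insert_of_mem (RFace.first_mem τ))]
    rfl
  · rw [dif_neg h, dif_neg h]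
    rfl

/-- The automorphism of the coefficients given by an element of the group. -/
def repEquiv {G : Type*} [Group G] (R : Representation ℂ G W) (g : G) : W ≃ₗ[ℂ] W :=
  LinearEquiv.ofLinearMap (R g) (R g⁻¹)
    (by rw [← Module.End.mul_eq_comp, ← map_mul, mul_inv_cancel, map_one]; rfl)
    (by rw [← Module.End.mul_eq_comp, ← map_mul, inv_mul_cancel, map_one]; rfl)

theorem isAcyclicRep_iff {x₀ : realization K} (γ : Lifts K x₀)
    (R : Representation ℂ (FundamentalGroup (realization K) x₀) W) :
    IsAcyclicRep γ R ↔
      Acyclic (C := fun i => RFace K.faces i → W) (bd K.faces (edgeMap γ R)) := by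
  rw [IsAcyclicRep, twistedBoundary_eq]
  rfl

theorem ChainTorsion.norm_reidemeisterTorsion [Module.Finite ℂ W] {x₀ : realization K}
    (γ : Lifts K x₀) (R : Representation ℂ (FundamentalGroup (realization K) x₀) W) {t : ℝ}
    (h : ChainTorsion K.faces (edgeMap γ R) (Module.finBasis ℂ W) t) :
    ‖reidemeisterTorsion γ R‖ = t := by
  classical
  refine HasTorsion.norm_torsion (C := fun i => Face K i → W) ?_ ?_
  · rw [twistedBoundary_eq]
    refine HasTorsion.map (D := fun i => Face K i → W) h _ (fun i => LinearEquiv.refl ℂ _)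
      (fun i x => rfl) (fun i => (Equiv.sigmaEquivProd _ _).trans (Equiv.prodComm _ _)) ?_
    refine Finset.prod_eq_one fun i _ => ?_
    have hb : ((LinearEquiv.refl ℂ (Face K i → W)) ∘ chainBasis K.faces (Module.finBasis ℂ W) i ∘
        (Equiv.sigmaEquivProd (Face K i) (Fin (finrank ℂ W))).trans (Equiv.prodComm _ _)) =
        Pi.basis fun _ : Face K i => Module.finBasis ℂ W := by
      funext ⟨τ, l⟩
      change chainBasis K.faces (Module.finBasis ℂ W) i (l, τ) = _
      refine (chainBasis_apply K.faces (Module.finBasis ℂ W) i l τ).trans ?_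
      rw [Pi.basis_apply]
      funext σ
      by_cases h : σ = τ
      · subst h
        exact (Pi.single_eq_same (M := fun _ : RFace K.faces i => W) σ _).trans
          (Pi.single_eq_same (M := fun _ : Face K i => W) σ _).symm
      · exact (Pi.single_eq_of_ne (M := fun _ : RFace K.faces i => W) h _).trans
          (Pi.single_eq_of_ne (M := fun _ : Face K i => W) h _).symm
    refine (congrArg (fun x : ℂ => ‖x‖ ^ ((-1 : ℤ) ^ (i + 1)))
      ((congrArg (Pi.basis fun _ : Face K i => Module.finBasis ℂ W).det hb).trans
        (Basis.det_self _))).trans ?_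
    rw [norm_one, one_zpow]
  · exact ⟨fun x => (isEmpty_prod_rface (ω := Unit) K.faces).false ((), x.1)⟩

theorem norm_reidemeisterTorsion_spec [Module.Finite ℂ W] {x₀ : realization K}
    (γ : Lifts K x₀) (R : Representation ℂ (FundamentalGroup (realization K) x₀) W)
    (h : IsAcyclicRep γ R) :
    ChainTorsion K.faces (edgeMap γ R) (Module.finBasis ℂ W) ‖reidemeisterTorsion γ R‖ := by
  obtain ⟨t, ht⟩ := exists_chainTorsion ((isAcyclicRep_iff γ R).mp h) (Module.finBasis ℂ W)
  rwa [ht.norm_reidemeisterTorsion]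

end EdgeMap

end SurgeryTorsion

/-! ### Gluing the solid tori to `M` -/

namespace SurgeryTorsion

open Module

section Gluing

variable {ι : Type*} [Fintype ι] [LinearOrder ι] {K M S T : PreAbstractSimplicialComplex ι}

theorem det_repEquiv {G : Type*} [Group G] (ρ : G →* SL2) (n : ℕ) (g : G) :
    LinearMap.det (repEquiv ((sigma n).comp ρ) g : V n →ₗ[ℂ] V n) = 1 :=
  det_sigma n (ρ g)

/-- The torsion of a subcomplex, with the coefficients restricted from the larger complex. -/
theorem chainTorsion_of_le (h : M ≤ K) {x₀ : realization M} (γ : Lifts M x₀)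
    (γ' : Lifts K (incl h x₀)) (ρ' : FundamentalGroup (realization K) (incl h x₀) →* SL2) (n : ℕ)
    (hac : IsAcyclicRep γ (rhoN (ρ'.comp (FundamentalGroup.map (incl h) x₀)) n)) :
    ChainTorsion M.faces (edgeMap γ' (rhoN ρ' n)) (Module.finBasis ℂ (V n))
      ‖reidemeisterTorsion γ (rhoN (ρ'.comp (FundamentalGroup.map (incl h) x₀)) n)‖ := by
  obtain ⟨B, hB⟩ := exists_gauge_of_le h γ γ'
  refine (norm_reidemeisterTorsion_spec γ _ hac).congr _
    -- The gauge transformation acts through `sigma n`, hence with determinant `1`.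
    (fun v => repEquiv ((sigma n).comp ρ') (B v)) (Equiv.refl _) (D := 1) (fun v => ?_) one_pos
    fun s hs a ha b hb x => ?_
  · have := (Module.finBasis ℂ (V n)).det_comp
      (repEquiv ((sigma n).comp ρ') (B v) : V n →ₗ[ℂ] V n) (Module.finBasis ℂ (V n))
    rw [det_repEquiv, Basis.det_self, one_mul] at this
    exact (congrArg _ this).trans norm_one
  · rw [edgeMap_eq γ _ hs ha hb, edgeMap_eq γ' _ (h hs) ha hb]
    change sigma n (ρ' (B b)) (sigma n (ρ' (FundamentalGroup.map (incl h) x₀ _)) x) =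
      sigma n (ρ' _) (sigma n (ρ' (B a)) x)
    rw [← Module.End.mul_apply, ← Module.End.mul_apply, ← map_mul, ← map_mul, ← map_mul, ← map_mul,
      hB]

/-- The torsions of a solid torus in `K` relative to its boundary. -/
theorem exists_relTorsion_rep (hS : S ≤ K) (chart : Disk × Circle ≃ₜ realization S) (hTS : T ≤ S)
    (hb : ∀ (z : Disk) (w : Circle), (chart (z, w) : ι → ℝ) ∈ realization T ↔ ‖(z : ℂ)‖ = 1)
    {x₀ : realization K} (γ : Lifts K x₀)
    (q : Path.Homotopic.Quotient x₀ (incl hS (chart (Disk.zero, 1))))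
    (ρ : FundamentalGroup (realization K) x₀ →* SL2) {lam : ℕ} [NeZero lam]
    (hlam : orderOf (ρ (pullLoop q (coreLoop hS chart))) = 2 * lam) :
    ∃ f : ℤ → ℝ, (∀ m, 0 < f m) ∧ (∀ m, f (m + lam) = f m) ∧
      (∀ m : ℤ, ∏ k ∈ Finset.range lam, f (m + k) = 1 / 2) ∧
      ∀ N : ℕ, 1 ≤ N → ChainTorsion (S.faces \ T.faces) (edgeMap γ (rhoN ρ (2 * N)))
        (Module.finBasis ℂ (V (2 * N))) (∏ k ∈ Finset.range (2 * N), f (k - N)) := by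
  obtain ⟨G⟩ := exists_logSystem chart
  obtain ⟨A, hA⟩ := exists_edge_gauge hS chart G γ q
  obtain ⟨z, hz, hΘ⟩ := exists_eigenbasis _ (NeZero.pos lam) hlam
  obtain ⟨f, h1, h2, h3, h4⟩ := exists_relTorsion hTS hb G hz
  refine ⟨f, h1, h2, h3, fun N hN => ?_⟩
  obtain ⟨Θ, hΘ⟩ := hΘ (2 * N) (by omega)
  -- The weight `2k + 1 - 2N` is `2m + 1` for `m = k - N`.
  have h5 := ChainTorsion.diag (A := S.faces \ T.faces) (K := Fin (2 * N))
    (u := fun k a b => (z ^ (2 * ((k : ℕ) : ℤ) + 1 - (2 * N : ℕ))) ^ hol G.g a b ())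
    (t := fun k => f ((k : ℕ) - N)) fun k => by
      convert h4 ((k : ℕ) - N) using 6
      push_cast
      ring
  rw [Finset.prod_range]
  let w := Module.finBasis ℂ (V (2 * N))
  let w' := (Pi.basisFun ℂ (Fin (2 * N))).map Θ.symm
  let ε := w.indexEquiv w'
  have hΘ' : ∀ (m : ℤ) x, Θ.symm (diag (fun k : Fin (2 * N) =>
      (z ^ (2 * ((k : ℕ) : ℤ) + 1 - (2 * N : ℕ))) ^ m) x) =
      sigma (2 * N) (ρ (pullLoop q (coreLoop hS chart)) ^ m) (Θ.symm x) := fun m x => by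
    rw [LinearEquiv.symm_apply_eq, hΘ, LinearEquiv.apply_symm_apply]
  have hD : IsUnit (w.det (w' ∘ ε)) := by
    have := w.isUnit_det (w'.reindex ε.symm)
    rwa [Basis.coe_reindex] at this
  refine h5.congr w (fun v => Θ.symm.trans (repEquiv ((sigma (2 * N)).comp ρ) (A v)⁻¹)) ε
    (D := ‖w.det (w' ∘ ε)‖) (fun v => ?_) (norm_pos_iff.mpr hD.ne_zero)
    fun s hs a ha b hb x => ?_
  -- The passage to the eigenbasis has some determinant, but the same at all vertices, which is all
  -- that `ChainTorsion.congr` asks.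
  · have := w.det_comp (repEquiv ((sigma (2 * N)).comp ρ) (A v)⁻¹ : V (2 * N) →ₗ[ℂ] V (2 * N))
      (w' ∘ ε)
    rw [det_repEquiv, one_mul] at this
    rw [← this]
    congr 2
  · rw [edgeMap_eq γ _ (hS hs.1) ha hb]
    change sigma (2 * N) (ρ (A b)⁻¹) (Θ.symm (diag _ x)) =
      sigma (2 * N) (ρ (edgeLoop γ (hS hs.1) ha hb)) (sigma (2 * N) (ρ (A a)⁻¹) (Θ.symm x))
    rw [hΘ', ← Module.End.mul_apply, ← Module.End.mul_apply, ← map_mul, ← map_mul, ← map_zpow,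
      ← map_mul, ← map_mul]
    have h6 := hA s hs.1 a b ha hb
    have h7 : (A b)⁻¹ * pullLoop q (coreLoop hS chart) ^ hol G.g a b () =
        edgeLoop γ (hS hs.1) ha hb * (A a)⁻¹ := by
      rw [eq_mul_inv_iff_mul_eq, mul_assoc, ← h6, inv_mul_cancel_left]
    rw [h7]

variable {m : ℕ} {T : Fin m → PreAbstractSimplicialComplex ι} {P : ∀ j, PeripheralSystem (T j)}
  {α β : Fin m → ℤ}

theorem DehnFilling.T_le (F : DehnFilling M T P α β) (j : Fin m) : T j ≤ F.S j :=
  (F.inter_eq j).symm.le.trans inf_le_right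

theorem DehnFilling.mem_total (F : DehnFilling M T P α β) {s : Finset ι} :
    s ∈ F.total.faces ↔ s ∈ M.faces ∨ ∃ j, s ∈ (F.S j).faces := by
  change s ∈ M.faces ∪ ⋃ K ∈ Set.range F.S, K.faces ↔ _
  simp

/-- The torsion of the filled manifold is the product of the torsions of `M` and of the solid tori
relative to their boundaries. -/
theorem DehnFilling.chainTorsion_total (F : DehnFilling M T P α β) {W ω : Type*} [AddCommGroup W]
    [Module ℂ W] [Fintype ω] [DecidableEq ω] {w : Basis ω ℂ W} {U : ι → ι → W →ₗ[ℂ] W}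
    (hU : ∀ σ ∈ F.total.faces, ∀ a ∈ σ, ∀ b ∈ σ, ∀ e ∈ σ, ∀ x, U b e (U a b x) = U a e x) {t : ℝ}
    {f : Fin m → ℝ} (hM : ChainTorsion M.faces U w t)
    (hS : ∀ j, ChainTorsion ((F.S j).faces \ (T j).faces) U w (f j)) :
    ChainTorsion F.total.faces U w (t * ∏ j, f j) := by
  classical
  -- The solid tori are attached one at a time; `L` is the union of `M` with those already attached.
  have key : ∀ J : Finset (Fin m), ∃ L : PreAbstractSimplicialComplex ι,
      (∀ s, s ∈ L.faces ↔ s ∈ M.faces ∨ ∃ j ∈ J, s ∈ (F.S j).faces) ∧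
      ChainTorsion L.faces U w (t * ∏ j ∈ J, f j) := fun J => by
    induction J using Finset.induction_on with
    | empty => exact ⟨M, by simp, by simpa using hM⟩
    | insert j J hj ih =>
      obtain ⟨L, hL, hL'⟩ := ih
      have hLS : ∀ s, s ∈ (L ⊔ F.S j).faces ↔ s ∈ L.faces ∨ s ∈ (F.S j).faces := fun s => Iff.rfl
      have hmem : ∀ s, s ∈ (L ⊔ F.S j).faces ↔
          s ∈ M.faces ∨ ∃ i ∈ insert j J, s ∈ (F.S i).faces := fun s => by
        rw [hLS, hL]
        simp only [Finset.mem_insert, exists_eq_or_imp]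
        exact or_assoc.trans (or_congr_right or_comm)
      -- The new solid torus meets `M` in `T j` and the earlier solid tori nowhere, so what it adds
      -- is its part relative to the boundary.
      have hdisj : ∀ s ∈ L.faces, s ∈ (F.S j).faces → s ∈ (T j).faces := fun s hs hs' => by
        rcases (hL s).mp hs with h | ⟨i, hi, h⟩
        · rw [← F.inter_eq j]
          exact ⟨h, hs'⟩
        · have h1 : s ∈ (F.S i ⊓ F.S j).faces := ⟨h, hs'⟩
          rw [F.disjoint i j (by rintro rfl; exact hj hi)] at h1
          exact h1.elim
      have hTL : ∀ s ∈ (T j).faces, s ∈ L.faces := fun s hs => by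
        rw [← F.inter_eq j] at hs
        exact (hL s).mpr (Or.inl hs.1)
      have hsplit : IsSplit (L ⊔ F.S j).faces L.faces ((F.S j).faces \ (T j).faces) := {
        left := fun s h => Or.inl h
        right := fun s h => Or.inr h.1
        cover := fun s h => by
          by_cases hs : s ∈ L.faces
          · exact Or.inl hs
          · exact Or.inr ⟨((hLS s).mp h).resolve_left hs, fun h' => hs (hTL s h')⟩
        disjoint := fun s h h' => h'.2 (hdisj s h h'.1)
        up := fun s h v h' => h.2 (hdisj s (mem_faces_of_subset h' (Finset.subset_insert v s)
          ((F.S j).isRelLowerSet_faces h.1).1) h.1) }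
      refine ⟨L ⊔ F.S j, hmem, ?_⟩
      rw [Finset.prod_insert hj, mul_left_comm, mul_comm]
      refine hsplit.chainTorsion hL' (hS j) fun i x => bd_bd (fun σ hσ => hU σ ?_) i x
      rw [F.mem_total]
      rcases (hmem σ).mp hσ with h | ⟨i, -, h⟩
      · exact Or.inl h
      · exact Or.inr ⟨i, h⟩
  obtain ⟨L, hL, hL'⟩ := key Finset.univ
  have : L.faces = F.total.faces := Set.ext fun s => by rw [hL, F.mem_total]; simp
  rwa [this] at hL'

/-- The torsion of the filled manifold. -/
theorem DehnFilling.exists_torsion (F : DehnFilling M T P α β) (x₀ : realization M) (γ : Lifts M x₀)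
    (γ' : Lifts F.total (incl F.le_total x₀))
    (c' : ∀ j, Path.Homotopic.Quotient (incl F.le_total x₀)
      (incl (F.S_le_total j) (F.chart j (Disk.zero, 1))))
    (ρ' : FundamentalGroup (realization F.total) (incl F.le_total x₀) →* SL2) (lam : Fin m → ℕ)
    (hlam0 : ∀ j, lam j ≠ 0)
    (hlam : ∀ j, orderOf (ρ' (pullLoop (c' j) (F.core j))) = 2 * lam j) :
    ∃ f : Fin m → ℤ → ℝ, (∀ j k, 0 < f j k) ∧ (∀ j k, f j (k + lam j) = f j k) ∧
      (∀ j (k : ℤ), ∏ i ∈ Finset.range (lam j), f j (k + i) = 1 / 2) ∧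
      ∀ N : ℕ, 1 ≤ N →
        IsAcyclicRep γ (rhoN (ρ'.comp (FundamentalGroup.map (incl F.le_total) x₀)) (2 * N)) →
        IsAcyclicRep γ' (rhoN ρ' (2 * N)) ∧
        0 < ‖reidemeisterTorsion γ
          (rhoN (ρ'.comp (FundamentalGroup.map (incl F.le_total) x₀)) (2 * N))‖ ∧
        ‖reidemeisterTorsion γ' (rhoN ρ' (2 * N))‖ = ‖reidemeisterTorsion γ
          (rhoN (ρ'.comp (FundamentalGroup.map (incl F.le_total) x₀)) (2 * N))‖ *
          ∏ j, ∏ k ∈ Finset.range (2 * N), f j (k - N) := by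
  choose f h1 h2 h3 h4 using fun j =>
    have : NeZero (lam j) := ⟨hlam0 j⟩
    exists_relTorsion_rep (F.S_le_total j) (F.chart j) (F.T_le j) (F.boundary_iff j) γ' (c' j) ρ'
      (hlam j)
  refine ⟨f, h1, h2, h3, fun N hN hac => ?_⟩
  have h5 := chainTorsion_of_le F.le_total γ γ' ρ' (2 * N) hac
  have h6 := F.chainTorsion_total
    (fun σ hσ a ha b hb e he x => edgeMap_edgeMap γ' (rhoN ρ' (2 * N)) hσ ha hb he x) h5
    fun j => h4 j N hN
  exact ⟨(isAcyclicRep_iff _ _).mpr h6.acyclic, h5.pos, h6.norm_reidemeisterTorsion⟩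

end Gluing

end SurgeryTorsion

/-! ### Sums of periodic sequences, and limits in the extended reals -/

namespace SurgeryTorsion

section Asymptotics

/-- Full periods contribute exactly `s` each, and fewer than `lam` terms remain. The constant is
uniform in the starting point, which in the application moves with `N`. -/
theorem exists_abs_sum_sub_le {a : ℤ → ℝ} {lam : ℕ} (hlam : lam ≠ 0) (ha : ∀ k, a (k + lam) = a k)
    {s : ℝ} (hs : ∀ k : ℤ, ∑ i ∈ Finset.range lam, a (k + i) = s) :
    ∃ C, ∀ (n : ℕ) (k : ℤ), |∑ i ∈ Finset.range n, a (k + i) - n / lam * s| ≤ C := by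
  have hlam' : (0 : ℝ) < lam := by positivity
  set B := ∑ i ∈ Finset.range lam, |a i| with hB
  have hB0 : 0 ≤ B := Finset.sum_nonneg fun _ _ => abs_nonneg _
  have hbound : ∀ k, |a k| ≤ B := fun k => by
    have h1 : a (k % lam) = a k := by
      have := Function.Periodic.int_mul (f := a) ha (k / lam) (k % lam)
      rwa [Int.cast_id, mul_comm, Int.emod_add_mul_ediv, eq_comm] at this
    have h2 : 0 ≤ k % lam := Int.emod_nonneg _ (by exact_mod_cast hlam)
    have h3 : k % lam < lam := Int.emod_lt_of_pos _ (by positivity)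
    obtain ⟨i, hi⟩ := Int.eq_ofNat_of_zero_le h2
    rw [← h1, hi, hB]
    exact Finset.single_le_sum (f := fun i : ℕ => |a i|) (fun _ _ => abs_nonneg _)
      (Finset.mem_range.mpr (by omega))
  refine ⟨lam * B + |s|, fun n => ?_⟩
  induction n using Nat.strong_induction_on with
  | _ n ih =>
    intro k
    by_cases hn : n < lam
    · have hn' : (n : ℝ) ≤ lam := by exact_mod_cast hn.le
      have h1 : |∑ i ∈ Finset.range n, a (k + i)| ≤ lam * B := by
        refine (Finset.abs_sum_le_sum_abs _ _).trans
          ((Finset.sum_le_card_nsmul _ _ B fun i _ => hbound _).trans ?_)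
        rw [Finset.card_range, nsmul_eq_mul]
        exact mul_le_mul_of_nonneg_right hn' hB0
      have h2 : |(n : ℝ) / lam * s| ≤ |s| := by
        rw [abs_mul, abs_of_nonneg (by positivity)]
        exact mul_le_of_le_one_left (abs_nonneg s) ((div_le_one hlam').mpr hn')
      exact (abs_sub _ _).trans (add_le_add h1 h2)
    · obtain ⟨r, rfl⟩ := Nat.exists_eq_add_of_le (not_lt.mp hn)
      have h1 := ih r (by omega) (k + lam)
      rw [Finset.sum_range_add, hs]
      have h2 : ((lam + r : ℕ) : ℝ) / lam * s = s + r / lam * s := by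
        push_cast
        field_simp
      rw [h2, add_sub_add_left_eq_sub]
      simpa only [Nat.cast_add, add_assoc] using h1

theorem tendsto_coe_add {u v e : ℕ → ℝ} (hv : ∀ᶠ N in atTop, v N = u N + e N) {x : ℝ}
    (he : Tendsto e atTop (𝓝 x)) {l : EReal} (hu : Tendsto (fun N => (u N : EReal)) atTop (𝓝 l)) :
    Tendsto (fun N => (v N : EReal)) atTop (𝓝 (l + x)) := by
  have h1 : Tendsto (fun N => (e N : EReal)) atTop (𝓝 (x : EReal)) :=
    (continuous_coe_real_ereal.tendsto x).comp he
  have h2 := (EReal.continuousAt_add (p := (l, (x : EReal))) (Or.inr (EReal.coe_ne_bot x))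
    (Or.inr (EReal.coe_ne_top x))).tendsto.comp (hu.prodMk_nhds h1)
  refine h2.congr' (hv.mono fun N hN => ?_)
  beta_reduce
  rw [hN, EReal.coe_add]
  rfl

/-- A correction with a finite limit can be added and removed again even when `l` is infinite. -/
theorem tendsto_coe_iff {u v e : ℕ → ℝ} (hv : ∀ᶠ N in atTop, v N = u N + e N) {x : ℝ}
    (he : Tendsto e atTop (𝓝 (-x))) (l : EReal) :
    Tendsto (fun N => (u N : EReal)) atTop (𝓝 l) ↔
      Tendsto (fun N => (v N : EReal)) atTop (𝓝 (l - x)) := by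
  refine ⟨fun h => ?_, fun h => ?_⟩
  · have := tendsto_coe_add hv he h
    rwa [EReal.coe_neg, ← sub_eq_add_neg] at this
  · have := tendsto_coe_add (u := v) (v := u) (e := -e)
      (hv.mono fun N hN => by rw [hN, Pi.neg_apply]; ring) he.neg h
    rwa [neg_neg, EReal.sub_add_cancel] at this

theorem tendsto_div_of_abs_sub_le {e : ℕ → ℝ} {C r : ℝ}
    (h : ∀ N, |e N - 2 * (N : ℝ) * r| ≤ C) :
    Tendsto (fun N : ℕ => e N / (2 * (N : ℝ))) atTop (𝓝 r) := by
  have h0 : Tendsto (fun N : ℕ => 2 * (N : ℝ)) atTop atTop :=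
    tendsto_natCast_atTop_atTop.const_mul_atTop two_pos
  have h1 : Tendsto (fun N : ℕ => (e N - 2 * (N : ℝ) * r) / (2 * (N : ℝ))) atTop (𝓝 0) := by
    refine squeeze_zero_norm (fun N => ?_) (h0.const_div_atTop C)
    rw [norm_div, Real.norm_eq_abs, Real.norm_of_nonneg (by positivity : (0 : ℝ) ≤ 2 * N)]
    exact div_le_div_of_nonneg_right (h N) (by positivity)
  have h2 := h1.add_const r
  rw [zero_add] at h2
  refine h2.congr' ((eventually_ge_atTop 1).mono fun N hN => ?_)
  have : (N : ℝ) ≠ 0 := by positivity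
  field_simp
  ring

theorem tendsto_div_sq {e : ℕ → ℝ} {r : ℝ}
    (h : Tendsto (fun N : ℕ => e N / (2 * (N : ℝ))) atTop (𝓝 r)) :
    Tendsto (fun N : ℕ => e N / (2 * (N : ℝ)) ^ 2) atTop (𝓝 0) := by
  have h0 : Tendsto (fun N : ℕ => 2 * (N : ℝ)) atTop atTop :=
    tendsto_natCast_atTop_atTop.const_mul_atTop two_pos
  refine (h.div_atTop h0).congr fun N => ?_
  rw [div_div, sq]

end Asymptotics

end SurgeryTorsion

end

/-! ### Comparison of the limits -/

open SurgeryTorsion in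
theorem theorem3p5 {ι : Type*} [Fintype ι] [LinearOrder ι] {m : ℕ}
    (M : PreAbstractSimplicialComplex ι) (T : Fin m → PreAbstractSimplicialComplex ι)
    (hM : IsManifoldWithTorusBoundary M T)
    (P : ∀ j, PeripheralSystem (T j)) (α β : Fin m → ℤ) (F : DehnFilling M T P α β)
    (x₀ : realization M) (γ : Lifts M x₀) (γ' : Lifts F.total (incl F.le_total x₀))
    (c : ∀ j, Path.Homotopic.Quotient x₀ (incl (hM.le j) (P j).base))
    (c' : ∀ j, Path.Homotopic.Quotient (incl F.le_total x₀)
      (incl (F.S_le_total j) (F.chart j (Disk.zero, 1))))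
    (ρ : FundamentalGroup (realization M) x₀ →* SL2)
    (hρ : ∀ j, ρ (pullLoop (c j) (FundamentalGroup.map (incl (hM.le j)) (P j).base
      ((P j).q ^ α j * (P j).h ^ β j))) = 1)
    (ρ' : FundamentalGroup (realization F.total) (incl F.le_total x₀) →* SL2)
    (hρ' : ρ'.comp (FundamentalGroup.map (incl F.le_total) x₀) = ρ)
    (hbdry : ∀ j,
      HasEvenOrder (ρ (pullLoop (c j) (FundamentalGroup.map (incl (hM.le j)) (P j).base (P j).q))) ∨
      HasEvenOrder (ρ (pullLoop (c j) (FundamentalGroup.map (incl (hM.le j)) (P j).base (P j).h))))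
    (hcore : ∀ j, HasEvenOrder (ρ' (pullLoop (c' j) (F.core j))))
    (lam : Fin m → ℕ) (hlam : ∀ j, orderOf (ρ' (pullLoop (c' j) (F.core j))) = 2 * lam j)
    (hacyclic : ∀ N : ℕ, 1 ≤ N → IsAcyclicRep γ (rhoN ρ (2 * N))) :
    (∀ N : ℕ, 1 ≤ N → IsAcyclicRep γ' (rhoN ρ' (2 * N))) ∧
    (∀ l : EReal,
      Tendsto (fun N : ℕ => ((Real.log ‖reidemeisterTorsion γ (rhoN ρ (2 * N))‖ /
        (2 * (N : ℝ)) ^ 2 : ℝ) : EReal)) atTop (𝓝 l) ↔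
      Tendsto (fun N : ℕ => ((Real.log ‖reidemeisterTorsion γ' (rhoN ρ' (2 * N))‖ /
        (2 * (N : ℝ)) ^ 2 : ℝ) : EReal)) atTop (𝓝 l)) ∧
    (∀ l : EReal,
      Tendsto (fun N : ℕ => ((Real.log ‖reidemeisterTorsion γ (rhoN ρ (2 * N))‖ /
        (2 * (N : ℝ)) : ℝ) : EReal)) atTop (𝓝 l) ↔
      Tendsto (fun N : ℕ => ((Real.log ‖reidemeisterTorsion γ' (rhoN ρ' (2 * N))‖ /
        (2 * (N : ℝ)) : ℝ) : EReal)) atTop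
        (𝓝 (l - ((Real.log 2 * ∑ j, 1 / (lam j : ℝ) : ℝ) : EReal)))) := by
  subst hρ'
  have hlam0 : ∀ j, lam j ≠ 0 := fun j h => by
    have := (hcore j).1
    rw [hlam j, h] at this
    simp at this
  obtain ⟨f, hf0, hfp, hfs, hf⟩ := F.exists_torsion x₀ γ γ' c' ρ' lam hlam0 hlam
  set ρ := ρ'.comp (FundamentalGroup.map (incl F.le_total) x₀)
  -- The whole difference between the logarithms of the two torsions; only its growth in `N`
  -- matters.
  let e : ℕ → ℝ := fun N => ∑ j, ∑ k ∈ Finset.range (2 * N), Real.log (f j (k - N))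
  have hlog : ∀ N : ℕ, 1 ≤ N → Real.log ‖reidemeisterTorsion γ' (rhoN ρ' (2 * N))‖ =
      Real.log ‖reidemeisterTorsion γ (rhoN ρ (2 * N))‖ + e N := fun N hN => by
    obtain ⟨-, h1, h2⟩ := hf N hN (hacyclic N hN)
    have hp : ∀ j, ∏ k ∈ Finset.range (2 * N), f j (k - N) ≠ 0 := fun j =>
      Finset.prod_ne_zero_iff.mpr fun k _ => (hf0 j _).ne'
    rw [h2, Real.log_mul h1.ne' (Finset.prod_ne_zero_iff.mpr fun j _ => hp j),
      Real.log_prod fun j _ => hp j]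
    exact congrArg _ (Finset.sum_congr rfl fun j _ => Real.log_prod fun k _ => (hf0 j _).ne')
  -- The sum of the logarithms over a period is `-log 2`, since the product is `1 / 2`.
  have hC := fun j => exists_abs_sum_sub_le (a := fun k => Real.log (f j k)) (hlam0 j)
    (fun k => congrArg Real.log (hfp j k)) (s := -Real.log 2) fun k => by
      rw [← Real.log_prod fun i _ => (hf0 j _).ne', hfs, one_div, Real.log_inv]
  choose C hC using hC
  have he : Tendsto (fun N : ℕ => e N / (2 * (N : ℝ))) atTop
      (𝓝 (-(Real.log 2 * ∑ j, 1 / (lam j : ℝ)))) := by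
    refine tendsto_div_of_abs_sub_le (C := ∑ j, C j) fun N => ?_
    -- The `j`-th sum has `2N` terms beginning at `-N`, hence the main term `-(2N / λ_j) log 2`.
    have h1 : e N - 2 * (N : ℝ) * -(Real.log 2 * ∑ j, 1 / (lam j : ℝ)) =
        ∑ j, (∑ k ∈ Finset.range (2 * N), Real.log (f j (-N + k)) -
          (2 * N : ℕ) / lam j * -Real.log 2) := by
      rw [Finset.sum_sub_distrib, Finset.mul_sum, ← Finset.sum_neg_distrib, Finset.mul_sum]
      congr 1
      · simp only [e, neg_add_eq_sub]
      · refine Finset.sum_congr rfl fun j _ => ?_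
        push_cast
        ring
    rw [h1]
    exact (Finset.abs_sum_le_sum_abs _ _).trans (Finset.sum_le_sum fun j _ => hC j _ _)
  refine ⟨fun N hN => (hf N hN (hacyclic N hN)).1, fun l => ?_, fun l => ?_⟩
  -- The correction grows linearly in `N` and disappears after division by `(2N) ^ 2`.
  · have := tendsto_coe_iff (u := fun N : ℕ => Real.log ‖reidemeisterTorsion γ (rhoN ρ (2 * N))‖ /
        (2 * (N : ℝ)) ^ 2) (v := fun N : ℕ => Real.log ‖reidemeisterTorsion γ' (rhoN ρ' (2 * N))‖ /
        (2 * (N : ℝ)) ^ 2) (x := 0) ((eventually_ge_atTop 1).mono fun N hN => by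
          rw [hlog N hN, add_div]) (by rw [neg_zero]; exact tendsto_div_sq he) l
    rwa [EReal.coe_zero, sub_zero] at this
  · exact tendsto_coe_iff ((eventually_ge_atTop 1).mono fun N hN => by
      rw [hlog N hN, add_div]) he l
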